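/- Conventions. Let $\mu$ be the Riemannian area measure of the unit sphere $S^2$ (total mass $4\pi$), $Y_{lm}$ the standard complex spherical harmonics (orthonormal in $L^2(S^2,\mu)$, Condon–Shortley phase), $f^{lm}=\int_{S^2} f\,\overline{Y_{lm}}\,\mu$, and let $$\|f\|_{H^s(S^2)}^2=\sum_{l\ge 0}(1+l(l+1))^s\sum_{m=-l}^{l}|f^{lm}|^2 ;$$ $H^s(S^2)$ consists of the real-valued $f\in L^2(S^2)$ for which this is finite, and $\Delta$ is the (weak) Laplace–Beltrami operator of $S^2$. For $N\ge 2$ put $\hbar=2/\sqrt{N^2-1}$ and let $T^N_{lm}$ be the $N\times N$ matrices $$(T^N_{lm})_{m_1m_2}=\sqrt{\tfrac{N}{4\pi}}\,(-1)^{\frac{N-1}{2}-m_1}\sqrt{2l+1}\begin{pmatrix}\frac{N-1}{2}&l&\frac{N-1}{2}\\-m_1&m&m_2\end{pmatrix},\qquad m_1,m_2\in\{-\tfrac{N-1}{2},\dots,\tfrac{N-1}{2}\},$$ with the Wigner 3j-symbol. The quantization of $f$ is the skew-Hermitian matrix $p_N(f)=\sum_{l=0}^{N-1}\sum_{m=-l}^{l}\mathrm{i}f^{lm}T^N_{lm}$.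 Let $X_a=\hbar S_a$, $a=1,2,3$, where $S_a$ are the standard Hermitian spin-$\frac{N-1}{2}$ matrices in the weight basis, so that $[X_a,X_b]=\mathrm{i}\hbar\varepsilon_{abc}X_c$ and $\sum_a X_a^2=\mathbb I$, and let $\Delta_N W=-\hbar^{-2}\sum_{a}[X_a,[X_a,W]]$ be the Hoppe–Yau Laplacian (with spectrum $-l(l+1)$, $0\le l\le N-1$). For fields $\rho,q,\xi,\psi$ with quantizations $P=p_N(\rho)$, $Q=p_N(q)$, $\Xi=p_N(\xi)$, $\Psi=p_N(\psi)$ put $$\mathcal I=\int_{S^2}(\xi\Delta\psi-\rho q)\,\mu,\qquad H=-\tfrac12\int_{S^2}(\psi\Delta\psi-q^2)\,\mu-\tfrac12\int_{S^2}(\xi\Delta\xi-\rho^2)\,\mu,$$ $$\mathcal I^N=\tfrac{4\pi}{N}\operatorname{tr}\!\big(\Xi^\dagger\Delta_N\Psi-P^\dagger Q\big),\qquad H^N=-\tfrac{2\pi}{N}\operatorname{tr}\!\big(\Psi^\dagger\Delta_N\Psi-Q^\dagger Q\big)-\tfrac{2\pi}{N}\operatorname{tr}\!\big(\Xi^\dagger\Delta_N\Xi-P^\dagger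 P\big).$$ Theorem. Let $s>1$ be real, $\rho,q\in H^s(S^2)$ and $\xi,\psi\in H^{s+2}(S^2)$. Then $\Delta\xi,\Delta\psi$ exist in $L^2(S^2)$, $\mathcal I^N\to\mathcal I$ and $H^N\to H$ as $N\to\infty$, and for every $N\ge 2$ $$|\mathcal I^N-\mathcal I|\le 2\hbar^s\big(\|\xi\|_{H^s}\|\psi\|_{H^{s+2}}+\|\rho\|_{H^s}\|q\|_{H^s}\big),$$ $$|H^N-H|\le 2\hbar^s\big(\|\psi\|_{H^s}\|\psi\|_{H^{s+2}}+\|q\|_{H^s}^2+\|\rho\|_{H^s}^2+\|\xi\|_{H^s}\|\xi\|_{H^{s+2}}\big).$$ In particular both errors are $O(N^{-s})$ as $N\to\infty$. -/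

import Mathlib

open MeasureTheory Filter Topology Asymptotics
open scoped Manifold ContDiff Matrix

noncomputable section

namespace SphereMHD

/-- The unit sphere `S²` in `ℝ³`. -/
abbrev S2 : Type := Metric.sphere (0 : EuclideanSpace ℝ (Fin 3)) 1

/-- The Riemannian area measure `μ` of `S²` (total mass `4π`). -/
def area : Measure S2 := (volume : Measure (EuclideanSpace ℝ (Fin 3))).toSphere

/-! ### Spherical harmonics and Sobolev spaces -/

/-- The Legendre polynomial `P_l = (1 / (2^l l!)) d^l/dx^l (x² - 1)^l`. -/
def legendrePoly (l : ℕ) : Polynomial ℝ :=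
  Polynomial.C (1 / (2 ^ l * (l.factorial : ℝ))) *
    Polynomial.derivative^[l] ((Polynomial.X ^ 2 - 1) ^ l)

/-- The spherical harmonic `Y_{lm}` for `0 ≤ m`, with the Condon–Shortley phase:
`(-1)^m √((2l+1)/(4π) (l-m)!/(l+m)!) sin^m θ P_l^{(m)}(cos θ) e^{imφ}`,
where `sin^m θ e^{imφ} = (x₁ + i x₂)^m` and `cos θ = x₃`. It is used for `m ≤ l` only. -/
def sphericalHarmonicNonneg (l m : ℕ) (x : S2) : ℂ :=
  (-1) ^ m *
    (Real.sqrt ((2 * l + 1) / (4 * Real.pi) *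
      (((l - m).factorial : ℝ) / ((l + m).factorial : ℝ))) : ℂ) *
    ((x.1 0 : ℂ) + Complex.I * (x.1 1 : ℂ)) ^ m *
    (((Polynomial.derivative^[m] (legendrePoly l)).eval (x.1 2) : ℝ) : ℂ)

/-- The spherical harmonic `Y_{lm}`, `-l ≤ m ≤ l`, with `Y_{l,-m} = (-1)^m conj Y_{lm}`. -/
def sphericalHarmonic (l : ℕ) (m : ℤ) (x : S2) : ℂ :=
  if 0 ≤ m then sphericalHarmonicNonneg l m.natAbs x
  else (-1) ^ m.natAbs * (starRingEnd ℂ) (sphericalHarmonicNonneg l m.natAbs x)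

/-- The Fourier coefficient `f^{lm} = ∫ f conj(Y_{lm}) dμ`. -/
def sphericalCoeff (f : S2 → ℝ) (l : ℕ) (m : ℤ) : ℂ :=
  ∫ x, (f x : ℂ) * (starRingEnd ℂ) (sphericalHarmonic l m x) ∂area

/-- The degree-`l` term `(1 + l(l+1))^s ∑_m |f^{lm}|²` of the squared `H^s` norm. -/
def sobolevTerm (s : ℝ) (f : S2 → ℝ) (l : ℕ) : ℝ :=
  (1 + (l : ℝ) * (l + 1)) ^ s * ∑ m ∈ Finset.Icc (-(l : ℤ)) l, ‖sphericalCoeff f l m‖ ^ 2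

/-- `f ∈ H^s(S²)`, for a real-valued `f` and `s ≥ 0`. -/
def MemSobolev (s : ℝ) (f : S2 → ℝ) : Prop :=
  MemLp f 2 area ∧ Summable (sobolevTerm s f)

/-- `‖f‖_{H^s(S²)} = ‖(1 - Δ)^{s/2} f‖_{L²(S²)}`. -/
def sobolevNorm (s : ℝ) (f : S2 → ℝ) : ℝ :=
  Real.sqrt (∑' l : ℕ, sobolevTerm s f l)

/-! ### The Laplace–Beltrami operator -/

/-- The Laplace–Beltrami operator on smooth functions: the Euclidean Laplacian of the extension
of `φ` that is constant along rays, restricted to the sphere. Outside of `0` this extension does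
not depend on the value given to it at `0`. -/
def smoothLaplacian (φ : S2 → ℝ) (x : S2) : ℝ :=
  Laplacian.laplacian
    (fun y : EuclideanSpace ℝ (Fin 3) =>
      if h : y = 0 then (0 : ℝ)
      else φ ⟨‖y‖⁻¹ • y, by simp [norm_smul, norm_ne_zero_iff.mpr h]⟩) x.1

/-- `g ∈ L²(S²)` is the weak Laplacian of `f`: `∫ g φ dμ = ∫ f Δφ dμ` for all smooth `φ`. -/
def IsWeakLaplacian (f g : S2 → ℝ) : Prop :=
  MemLp g 2 area ∧ ∀ φ : S2 → ℝ, ContMDiff (𝓡 2) 𝓘(ℝ, ℝ) ∞ φ →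
    ∫ x, g x * φ x ∂area = ∫ x, f x * smoothLaplacian φ x ∂area

open Classical in
/-- The weak Laplacian `Δf` (unique up to null sets; `0` if there is none in `L²`). -/
def lapl (f : S2 → ℝ) : S2 → ℝ :=
  if h : ∃ g, IsWeakLaplacian f g then h.choose else 0

/-- The cross-helicity `∫ (ξ Δψ - ρ q) dμ`. -/
def crossHelicity (ρ q ξ ψ : S2 → ℝ) : ℝ :=
  ∫ x, (ξ x * lapl ψ x - ρ x * q x) ∂area

/-- The energy `-½ ∫ (ψ Δψ - q²) dμ - ½ ∫ (ξ Δξ - ρ²) dμ`. -/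
def hamiltonian (ρ q ξ ψ : S2 → ℝ) : ℝ :=
  -(1 / 2) * ∫ x, (ψ x * lapl ψ x - q x ^ 2) ∂area
    - (1 / 2) * ∫ x, (ξ x * lapl ξ x - ρ x ^ 2) ∂area

/-! ### Quantization -/

/-- `1 / n!`, with the convention that it vanishes for negative `n`. -/
def invFactorial (n : ℤ) : ℝ := if 0 ≤ n then 1 / (n.toNat.factorial : ℝ) else 0

/-- `(n / 2)!` for a nonnegative even integer `n`. -/
def halfFactorial (n : ℤ) : ℝ := ((n / 2).toNat.factorial : ℝ)

/-- The Wigner 3j-symbol `(a/2 b/2 c/2; α/2 β/2 γ/2)` by Racah's formula. All arguments are twice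
the usual (integer or half-integer) ones. It is `0` unless the selection rules hold. -/
def wigner3j (a b c α β γ : ℤ) : ℝ :=
  if |α| ≤ a ∧ |β| ≤ b ∧ |γ| ≤ c ∧ 2 ∣ a - α ∧ 2 ∣ b - β ∧ 2 ∣ c - γ ∧
      α + β + γ = 0 ∧ |a - b| ≤ c ∧ c ≤ a + b then
    (-1) ^ ((a - b - γ) / 2) *
    Real.sqrt (halfFactorial (a + b - c) * halfFactorial (a - b + c) *
      halfFactorial (-a + b + c) / halfFactorial (a + b + c + 2)) *
    Real.sqrt (halfFactorial (a - α) * halfFactorial (a + α) * halfFactorial (b - β) *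
      halfFactorial (b + β) * halfFactorial (c - γ) * halfFactorial (c + γ)) *
    ∑ k ∈ Finset.range (((a + b - c) / 2).toNat + 1),
      (-1) ^ k * invFactorial k * invFactorial ((a + b - c) / 2 - k) *
        invFactorial ((a - α) / 2 - k) * invFactorial ((b + β) / 2 - k) *
        invFactorial ((c - b + α) / 2 + k) * invFactorial ((c - a - β) / 2 + k)
  else 0

/-- `ħ = 2 / √(N² - 1)`. -/
def hbar (N : ℕ) : ℝ := 2 / Real.sqrt ((N : ℝ) ^ 2 - 1)

/-- The matrix harmonic `T_{lm}^N`. The index `i = 0, …, N-1` stands for the weight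
`m₁ = (N-1)/2 - i`. The factor `√(N/(4π))` makes the `T_{lm}^N` orthonormal for the inner product
`(4π/N) tr(A† B)`. -/
def matrixHarmonic (N l : ℕ) (m : ℤ) : Matrix (Fin N) (Fin N) ℂ :=
  Matrix.of fun i k =>
    ((Real.sqrt (N / (4 * Real.pi)) * (-1) ^ (i : ℕ) * Real.sqrt (2 * l + 1) *
      wigner3j ((N : ℤ) - 1) (2 * l) ((N : ℤ) - 1)
        (-((N : ℤ) - 1 - 2 * (i : ℕ))) (2 * m) ((N : ℤ) - 1 - 2 * (k : ℕ)) : ℝ) : ℂ)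

/-- The quantization `p_N(f) = ∑_{l < N} ∑_{|m| ≤ l} i f^{lm} T_{lm}^N`. -/
def quantize (N : ℕ) (f : S2 → ℝ) : Matrix (Fin N) (Fin N) ℂ :=
  ∑ l ∈ Finset.range N, ∑ m ∈ Finset.Icc (-(l : ℤ)) l,
    (Complex.I * sphericalCoeff f l m) • matrixHarmonic N l m

/-- The spin raising operator `S₊`, with `S₊ |m⟩ = √((j - m)(j + m + 1)) |m + 1⟩`,
`j = (N-1)/2`, the index `k` standing for `m = j - k`. -/
def spinRaising (N : ℕ) : Matrix (Fin N) (Fin N) ℂ :=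
  Matrix.of fun i k =>
    if (i : ℕ) + 1 = (k : ℕ) then (Real.sqrt ((k : ℕ) * ((N : ℝ) - (k : ℕ))) : ℂ) else 0

/-- The Hermitian generators `X_a^N = ħ S_a` of the spin `(N-1)/2` representation, for which
`[X_a, X_b] = i ħ ε_{abc} X_c` and `X_1² + X_2² + X_3² = 1`. -/
def spinGenerator (N : ℕ) : Fin 3 → Matrix (Fin N) (Fin N) ℂ :=
  ![((hbar N / 2 : ℝ) : ℂ) • (spinRaising N + (spinRaising N)ᴴ),
    (((hbar N / 2 : ℝ) : ℂ) * (-Complex.I)) • (spinRaising N - (spinRaising N)ᴴ),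
    ((hbar N : ℝ) : ℂ) • Matrix.diagonal fun i : Fin N => (((N : ℝ) - 1) / 2 - (i : ℕ) : ℂ)]

/-- The Hoppe–Yau Laplacian `Δ_N W = -ħ⁻² ∑_a [X_a, [X_a, W]]`, with spectrum `-l(l+1)`. -/
def hoppeYau (N : ℕ) (W : Matrix (Fin N) (Fin N) ℂ) : Matrix (Fin N) (Fin N) ℂ :=
  -(((1 / hbar N ^ 2 : ℝ) : ℂ) • ∑ a : Fin 3, ⁅spinGenerator N a, ⁅spinGenerator N a, W⁆⁆)

/-- The quantized cross-helicity `(4π/N) tr(Ξ† Δ_N Ψ - P† Q)` of `P = p_N(ρ)`, `Q = p_N(q)`,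
`Ξ = p_N(ξ)`, `Ψ = p_N(ψ)`. -/
def quantizedCrossHelicity (N : ℕ) (ρ q ξ ψ : S2 → ℝ) : ℂ :=
  (4 * Real.pi / N : ℂ) *
    ((quantize N ξ)ᴴ * hoppeYau N (quantize N ψ) - (quantize N ρ)ᴴ * quantize N q).trace

/-- The quantized Hamiltonian
`-(2π/N) tr(Ψ† Δ_N Ψ - Q† Q) - (2π/N) tr(Ξ† Δ_N Ξ - P† P)`. -/
def quantizedHamiltonian (N : ℕ) (ρ q ξ ψ : S2 → ℝ) : ℂ :=
  -(2 * Real.pi / N : ℂ) *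
      ((quantize N ψ)ᴴ * hoppeYau N (quantize N ψ) - (quantize N q)ᴴ * quantize N q).trace
    - (2 * Real.pi / N : ℂ) *
      ((quantize N ξ)ᴴ * hoppeYau N (quantize N ξ) - (quantize N ρ)ᴴ * quantize N ρ).trace

end SphereMHD

end

open SphereMHD

noncomputable section

namespace SphereMHD

/-! ### Racah sums and their contiguous relations -/

/-! Quantization is an exact spectral truncation. The matrices `matrixHarmonic N l m` with `l < N`,
`|m| ≤ l` are orthonormal for `(4π/N) tr(A† B)`, and `hoppeYau N` acts on them with the eigenvalues
`-l(l+1)` of the Laplacian of the sphere on the spherical harmonics. Hence each matrix functional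
equals the partial sum over `l < N` of the Parseval series of its continuum counterpart
(`quantizedCrossHelicity_eq`, `quantizedHamiltonian_eq`), and the error is the tail of that series.
Cauchy–Schwarz, in `m` and then in `l`, together with `(1 + l(l+1))^(-s) ≤ ħ^s` for `l ≥ N`, bounds
the tail (`norm_pairing_error_le`).

On the matrix side everything follows from the ladder relations `lie_spinRaising_matrixHarmonic` and
`lie_spinLowering_matrixHarmonic`, which come from two contiguous relations for the sum in Racah's
formula. They give the eigenvalues through the Casimir operator and the orthogonality in `l` through
adjointness. They also reduce every norm to the case `m = l`, where the Racah sum has a single term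
and the norm is a convolution of binomial coefficients.

On the sphere the calculus is done with derivatives along the three coordinate rotations. They
integrate to zero because rotations preserve the area, so they are skew-adjoint, and the sum of
their squares is the Laplacian (`smoothLaplacian_eq_sum_rotDeriv₂`). The Legendre equation then
yields the eigenvalue equation and orthonormality of the spherical harmonics, and Stone–Weierstrass
their completeness (`harmonicBasis`). For `f` in `H^(s+2)` a weak Laplacian exists by Riesz–Fischer
(`MemSobolev.exists_isWeakLaplacian`), and every weak Laplacian has the coefficients `-l(l+1)
f^{lm}` (`IsWeakLaplacian.sphericalCoeff_eq`), so the choice made in `lapl` is harmless. -/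

lemma invFactorial_pred (n : ℤ) : invFactorial (n - 1) = n * invFactorial n := by
  unfold invFactorial
  -- The recursion survives at `n = 0`, where both sides vanish. This is what lets the later
  -- manipulations of Racah sums ignore the ends of the summation range.
  rcases lt_trichotomy n 0 with h | h | h
  · rw [if_neg (by omega), if_neg (by omega), mul_zero]
  · subst h; simp
  · obtain ⟨k, rfl⟩ : ∃ k : ℕ, n = k + 1 := ⟨(n - 1).toNat, by omega⟩
    have h1 : ((k : ℤ) + 1 - 1).toNat = k := by omega
    have h2 : ((k : ℤ) + 1).toNat = k + 1 := by omega
    rw [if_pos (by omega), if_pos (by omega), h1, h2, Nat.factorial_succ]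
    have := Nat.factorial_ne_zero k
    push_cast
    field_simp

lemma invFactorial_of_neg {n : ℤ} (h : n < 0) : invFactorial n = 0 := if_neg (by omega)

lemma invFactorial_natCast (n : ℕ) : invFactorial n = 1 / (n.factorial : ℝ) := by
  simp [invFactorial]

/-- The sum in Racah's formula for the symbol `(j l j; -m₁ m m₂)`, where `A = j + m₁` and
`B = j - m₁`. -/
def racahSum (l : ℕ) (A B m : ℤ) : ℝ :=
  ∑ k ∈ Finset.range (l + 1), (-1) ^ k * invFactorial k * invFactorial (l - k) *
    invFactorial (A - k) * invFactorial (l + m - k) * invFactorial (B - l + k) *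
    invFactorial (k - m)

/-- Each of these conditions makes an argument of a reciprocal factorial negative in every term; for
`A - m` and `B + m`, because they are the sums `(A - k) + (k - m)` and `(B - l + k) + (l + m - k)`.
-/
lemma racahSum_eq_zero {l : ℕ} {A B m : ℤ} (h : A < 0 ∨ B < 0 ∨ A - m < 0 ∨ B + m < 0 ∨ l < |m|) :
    racahSum l A B m = 0 := by
  refine Finset.sum_eq_zero fun k hk => ?_
  have hk' : k ≤ l := by simpa [Nat.lt_succ_iff] using hk
  have h6 : A - k < 0 ∨ l + m - k < 0 ∨ B - l + k < 0 ∨ k - m < 0 := by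
    rcases h with h | h | h | h | h
    · omega
    · omega
    · omega
    · omega
    · rcases abs_cases m with h' | h' <;> omega
  rcases h6 with h | h | h | h <;> simp [invFactorial_of_neg h]

/-- Creative telescoping: up to sign, the combination of summands is the difference `G (k + 1) - G
k` of an explicit certificate `G`. -/
lemma racahSum_raise (l : ℕ) (A B m : ℤ) :
    (B : ℝ) * racahSum l A B m - (A - m + 1) * racahSum l (A + 1) (B - 1) m =
      -(l + m + 1) * racahSum l (A + 1) (B - 1) (m + 1) := by
  set G : ℕ → ℝ := fun k => (-1) ^ k * invFactorial (k - 1) * invFactorial (l - k) *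
    invFactorial (A + 1 - k) * invFactorial (l + m + 1 - k) * invFactorial (B - l + k - 1) *
    invFactorial (k - m - 1) with hG
  have hs : ∑ k ∈ Finset.range (l + 1), (G (k + 1) - G k) = 0 := by
    rw [Finset.sum_range_sub]
    -- Both ends vanish: `G 0` contains `1/(-1)!` from `k - 1`, and `G (l + 1)` contains it from `l
    -- - k`.
    have h0 : G 0 = 0 := by simp [hG, invFactorial_of_neg]
    have h1 : G (l + 1) = 0 := by simp [hG, invFactorial_of_neg]
    rw [h0, h1, sub_zero]
  rw [← sub_eq_zero, ← neg_eq_zero, ← hs]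
  simp only [racahSum, Finset.mul_sum, ← Finset.sum_sub_distrib, ← Finset.sum_neg_distrib]
  refine Finset.sum_congr rfl fun k _ => ?_
  simp only [hG]
  -- All reciprocal factorials are rewritten as polynomials times one common set of them; what
  -- remains is a polynomial identity.
  have e1 : invFactorial (A - k) = (A + 1 - k) * invFactorial (A + 1 - k) := by
    have := invFactorial_pred (A + 1 - k); push_cast at this; rw [← this]; congr 1; ring
  have e2 : invFactorial (l + m - k) = (l + m + 1 - k) * invFactorial (l + m + 1 - k) := by
    have := invFactorial_pred (l + m + 1 - k); push_cast at this; rw [← this]; congr 1; ring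
  have e3 : invFactorial (B - l + k - 1) = (B - l + k) * invFactorial (B - l + k) := by
    have := invFactorial_pred (B - l + k); push_cast at this; rw [← this]
  have e4 : invFactorial (k - m - 1) = (k - m) * invFactorial (k - m) := by
    have := invFactorial_pred (k - m); push_cast at this; rw [← this]
  have e5 : invFactorial (k - 1) = k * invFactorial k := by
    have := invFactorial_pred k; push_cast at this; rw [← this]
  have e6 : invFactorial (l - k - 1) = (l - k) * invFactorial (l - k) := by
    have := invFactorial_pred (l - k); push_cast at this; rw [← this]
  have g1 : (((k + 1 : ℕ) : ℤ) - 1) = k := by push_cast; ring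
  have g2 : ((l : ℤ) - ((k + 1 : ℕ) : ℤ)) = l - k - 1 := by push_cast; ring
  have g3 : (A + 1 - ((k + 1 : ℕ) : ℤ)) = A - k := by push_cast; ring
  have g4 : ((l : ℤ) + m + 1 - ((k + 1 : ℕ) : ℤ)) = l + m - k := by push_cast; ring
  have g5 : (B - l + ((k + 1 : ℕ) : ℤ) - 1) = B - l + k := by push_cast; ring
  have g6 : (((k + 1 : ℕ) : ℤ) - m - 1) = k - m := by push_cast; ring
  have g7 : (B - 1 - l + k : ℤ) = B - l + k - 1 := by ring
  have g8 : ((l : ℤ) + (m + 1) - k) = l + m + 1 - k := by ring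
  have g9 : ((k : ℤ) - (m + 1)) = k - m - 1 := by ring
  simp only [g1, g2, g3, g4, g5, g6, g7, g8, g9, e1, e2, e3, e4, e5, e6]
  rw [pow_succ]
  ring

/-- The mirror image of `racahSum_raise`, with its own telescoping certificate. -/
lemma racahSum_lower (l : ℕ) (A B m : ℤ) :
    (A : ℝ) * racahSum l A B m - (B + m + 1) * racahSum l (A - 1) (B + 1) m =
      -(l - m + 1) * racahSum l (A - 1) (B + 1) (m - 1) := by
  set G : ℕ → ℝ := fun k => (-1) ^ k * invFactorial (k - 1) * invFactorial (l - k) *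
    invFactorial (A - k) * invFactorial (l + m - k) * invFactorial (B - l + k) *
    invFactorial (k - m) with hG
  have hs : ∑ k ∈ Finset.range (l + 1), (G (k + 1) - G k) = 0 := by
    rw [Finset.sum_range_sub]
    have h0 : G 0 = 0 := by simp [hG, invFactorial_of_neg]
    have h1 : G (l + 1) = 0 := by simp [hG, invFactorial_of_neg]
    rw [h0, h1, sub_zero]
  rw [← sub_eq_zero, ← neg_eq_zero, ← hs]
  simp only [racahSum, Finset.mul_sum, ← Finset.sum_sub_distrib, ← Finset.sum_neg_distrib]
  refine Finset.sum_congr rfl fun k _ => ?_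
  simp only [hG]
  have e1 : invFactorial (A - k - 1) = (A - k) * invFactorial (A - k) := by
    have := invFactorial_pred (A - k); push_cast at this; rw [← this]
  have e2 : invFactorial (l + m - k - 1) = (l + m - k) * invFactorial (l + m - k) := by
    have := invFactorial_pred (l + m - k); push_cast at this; rw [← this]
  have e3 : invFactorial (B - l + k) = (B - l + k + 1) * invFactorial (B - l + k + 1) := by
    have := invFactorial_pred (B - l + k + 1); push_cast at this; rw [← this]; congr 1; ring
  have e4 : invFactorial (k - m) = (k - m + 1) * invFactorial (k - m + 1) := by
    have := invFactorial_pred (k - m + 1); push_cast at this; rw [← this]; congr 1; ring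
  have e5 : invFactorial (k - 1) = k * invFactorial k := by
    have := invFactorial_pred k; push_cast at this; rw [← this]
  have e6 : invFactorial (l - k - 1) = (l - k) * invFactorial (l - k) := by
    have := invFactorial_pred (l - k); push_cast at this; rw [← this]
  have g1 : (((k + 1 : ℕ) : ℤ) - 1) = k := by push_cast; ring
  have g2 : ((l : ℤ) - ((k + 1 : ℕ) : ℤ)) = l - k - 1 := by push_cast; ring
  have g3 : (A - ((k + 1 : ℕ) : ℤ)) = A - k - 1 := by push_cast; ring
  have g4 : ((l : ℤ) + m - ((k + 1 : ℕ) : ℤ)) = l + m - k - 1 := by push_cast; ring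
  have g5 : (B - l + ((k + 1 : ℕ) : ℤ)) = B - l + k + 1 := by push_cast; ring
  have g6 : (((k + 1 : ℕ) : ℤ) - m) = k - m + 1 := by push_cast; ring
  have g7 : (B + 1 - l + k : ℤ) = B - l + k + 1 := by ring
  have g8 : ((l : ℤ) + (m - 1) - k) = l + m - k - 1 := by ring
  have g9 : ((k : ℤ) - (m - 1)) = k - m + 1 := by ring
  have g10 : (A - 1 - k : ℤ) = A - k - 1 := by ring
  simp only [g1, g2, g3, g4, g5, g6, g7, g8, g9, g10, e1, e2, e3, e4, e5, e6]
  rw [pow_succ]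
  ring

/-- For `m = l` the factor `1/(k - m)!` kills every term except `k = l`. -/
lemma racahSum_top (l : ℕ) (A B : ℤ) :
    racahSum l A B l = (-1) ^ l * (invFactorial l) ^ 2 * invFactorial (A - l) * invFactorial B := by
  unfold racahSum
  rw [Finset.sum_range_succ, Finset.sum_eq_zero]
  · have h1 : ((l : ℤ) + l - l) = l := by ring
    have h2 : (B - l + l : ℤ) = B := by ring
    have h0 : invFactorial 0 = 1 := by simp [invFactorial]
    simp only [h1, h2, sub_self, h0]
    ring
  · intro k hk
    have : k < l := by simpa using hk
    rw [invFactorial_of_neg (n := (k : ℤ) - l) (by omega), mul_zero]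

/-! ### Entries of the matrix harmonics and ladder relations -/

/-- `√(n!)` for an integer `n`. -/
def sqrtFactorial (n : ℤ) : ℝ := √(n.toNat.factorial : ℝ)

lemma sqrtFactorial_eq {n : ℤ} (h : 1 ≤ n) :
    sqrtFactorial n = √(n : ℝ) * sqrtFactorial (n - 1) := by
  obtain ⟨k, rfl⟩ : ∃ k : ℕ, n = k + 1 := ⟨(n - 1).toNat, by omega⟩
  have h1 : ((k : ℤ) + 1 - 1).toNat = k := by omega
  have h2 : ((k : ℤ) + 1).toNat = k + 1 := by omega
  unfold sqrtFactorial
  rw [h1, h2, ← Real.sqrt_mul (by positivity), Nat.factorial_succ]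
  push_cast
  rfl

lemma sqrtFactorial_sq (n : ℤ) : sqrtFactorial n ^ 2 = n.toNat.factorial :=
  Real.sq_sqrt (by positivity)

/-- The entry of `T_{lm}^N` in row `i` and column `i + m`, up to a factor that depends on `N` and
`l` only and a sign. -/
def harmonicEntry (N l : ℕ) (m i : ℤ) : ℝ :=
  sqrtFactorial (N - 1 - i) * sqrtFactorial i * sqrtFactorial (l - m) * sqrtFactorial (l + m) *
    sqrtFactorial (i + m) * sqrtFactorial (N - 1 - i - m) * racahSum l (N - 1 - i) i m

/-- The normalization factor of `T_{lm}^N`. -/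
def harmonicFactor (N l : ℕ) : ℝ :=
  √(N / (4 * Real.pi)) * √(2 * l + 1) *
    √((l.factorial : ℝ) ^ 2 * ((N : ℤ) - 1 - l).toNat.factorial / (N + l).factorial)

/-- Entries beyond the edge of the matrix vanish automatically, so the ladder relations hold at the
border without correction terms. -/
lemma harmonicEntry_eq_zero {N l : ℕ} {m i : ℤ}
    (h : i < 0 ∨ N ≤ i ∨ i + m < 0 ∨ N ≤ i + m ∨ l < |m|) : harmonicEntry N l m i = 0 := by
  rw [harmonicEntry, racahSum_eq_zero (by omega), mul_zero]

/-- The square roots complete the factorials of the three entries to one common prefactor, and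
`racahSum_raise` remains. Only the position `(i, i + m + 1)` has to lie in the matrix; the
neighbours `i + 1` and `i + m` may fall outside. -/
lemma harmonicEntry_raise (N l : ℕ) (m i : ℤ) (h0 : 0 ≤ i) (hN : i < N) (h0' : 0 ≤ i + m + 1)
    (hN' : i + m + 1 < N) :
    √((i + 1) * (N - 1 - i)) * harmonicEntry N l m (i + 1)
        - harmonicEntry N l m i * √((i + m + 1) * (N - 1 - i - m)) =
      -(√((l - m) * (l + m + 1)) * harmonicEntry N l (m + 1) i) := by
  by_cases hm : (l : ℤ) < |m|
  · rw [harmonicEntry_eq_zero (by omega), harmonicEntry_eq_zero (i := i) (by omega)]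
    by_cases hm' : (l : ℤ) < |m + 1|
    · rw [harmonicEntry_eq_zero (by omega)]; simp
    -- The one value with `m` inadmissible and `m + 1` admissible; there the ladder coefficient is
    -- zero.
    · have : m = -l - 1 := by
        rcases abs_cases m with h | h <;> rcases abs_cases (m + 1) with h' | h' <;> omega
      subst this
      push_cast
      rw [show (l : ℝ) + (-l - 1) + 1 = 0 by ring]
      simp
  have hm1 : -(l : ℤ) ≤ m ∧ m ≤ l := abs_le.mp (not_lt.mp hm)
  have key := racahSum_raise l (N - 1 - (i + 1)) (i + 1) m
  have E1 : √((i + 1) * (N - 1 - i)) * harmonicEntry N l m (i + 1) =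
      sqrtFactorial (N - 1 - i) * sqrtFactorial i * sqrtFactorial (l - m) * sqrtFactorial (l + m) *
      sqrtFactorial (i + m + 1) * sqrtFactorial (N - 1 - i - m - 1) * ((i + 1) *
        racahSum l (N - 1 - (i + 1)) (i + 1) m) := by
    rcases eq_or_lt_of_le (show i ≤ N - 1 by omega) with h | h
    · rw [harmonicEntry_eq_zero (by omega), racahSum_eq_zero (by omega)]; simp
    · have a1 := sqrtFactorial_eq (n := i + 1) (by omega)
      have a2 := sqrtFactorial_eq (n := N - 1 - i) (by omega)
      have p1 : (0 : ℝ) ≤ i + 1 := by exact_mod_cast (by omega : 0 ≤ i + 1)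
      have r1 := Real.mul_self_sqrt p1
      have c1 : (N - 1 - (i + 1) : ℤ) = N - 1 - i - 1 := by ring
      have c2 : (N - 1 - i - 1 - m : ℤ) = N - 1 - i - m - 1 := by ring
      have c3 : i + 1 + m = i + m + 1 := by ring
      rw [Real.sqrt_mul p1, harmonicEntry, c1, c2, c3, a1, a2]
      push_cast
      rw [show i + 1 - 1 = i by ring]
      linear_combination (√((N : ℝ) - 1 - i) * sqrtFactorial (N - 1 - i - 1) * sqrtFactorial i *
        sqrtFactorial (l - m) * sqrtFactorial (l + m) *
        sqrtFactorial (i + m + 1) * sqrtFactorial (N - 1 - i - m - 1) *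
        racahSum l (N - 1 - i - 1) (i + 1) m) * r1
  have E2 : harmonicEntry N l m i * √((i + m + 1) * (N - 1 - i - m)) =
      sqrtFactorial (N - 1 - i) * sqrtFactorial i * sqrtFactorial (l - m) * sqrtFactorial (l + m) *
      sqrtFactorial (i + m + 1) * sqrtFactorial (N - 1 - i - m - 1) * ((N - 1 - i - m) *
        racahSum l (N - 1 - i) i m) := by
    rcases eq_or_lt_of_le h0' with h | h
    · rw [harmonicEntry_eq_zero (by omega), racahSum_eq_zero (by omega)]; simp
    · have a1 := sqrtFactorial_eq (n := i + m + 1) (by omega)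
      have a2 := sqrtFactorial_eq (n := N - 1 - i - m) (by omega)
      have p1 : (0 : ℝ) ≤ i + m + 1 := by exact_mod_cast (by omega : 0 ≤ i + m + 1)
      have p2 : (0 : ℝ) ≤ N - 1 - i - m := by
        exact_mod_cast (by omega : 0 ≤ (N : ℤ) - 1 - i - m)
      have r1 := Real.mul_self_sqrt p2
      rw [Real.sqrt_mul p1, harmonicEntry, a1, a2]
      push_cast
      rw [show i + m + 1 - 1 = i + m by ring]
      linear_combination (√((i : ℝ) + m + 1) * sqrtFactorial (N - 1 - i) * sqrtFactorial i *
        sqrtFactorial (l - m) * sqrtFactorial (l + m) *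
        sqrtFactorial (i + m) * sqrtFactorial (N - 1 - i - m - 1) *
        racahSum l (N - 1 - i) i m) * r1
  have E3 : √((l - m) * (l + m + 1)) * harmonicEntry N l (m + 1) i =
      sqrtFactorial (N - 1 - i) * sqrtFactorial i * sqrtFactorial (l - m) * sqrtFactorial (l + m) *
      sqrtFactorial (i + m + 1) * sqrtFactorial (N - 1 - i - m - 1) * ((l + m + 1) *
        racahSum l (N - 1 - i) i (m + 1)) := by
    rcases eq_or_lt_of_le hm1.2 with h | h
    · rw [harmonicEntry_eq_zero, racahSum_eq_zero]; simp
      · rw [h, abs_of_nonneg] <;> omega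
      · rw [h, abs_of_nonneg] <;> omega
    · have a1 := sqrtFactorial_eq (n := l - m) (by omega)
      have a2 := sqrtFactorial_eq (n := l + m + 1) (by omega)
      have p2 : (0 : ℝ) ≤ l + m + 1 := by exact_mod_cast (by omega : 0 ≤ (l : ℤ) + m + 1)
      have p1 : (0 : ℝ) ≤ l - m := by exact_mod_cast (by omega : 0 ≤ (l : ℤ) - m)
      have r1 := Real.mul_self_sqrt p2
      have c1 : (l + (m + 1) : ℤ) = l + m + 1 := by ring
      have c2 : (l - (m + 1) : ℤ) = l - m - 1 := by ring
      have c3 : (i + (m + 1) : ℤ) = i + m + 1 := by ring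
      have c4 : (N - 1 - i - (m + 1) : ℤ) = N - 1 - i - m - 1 := by ring
      rw [Real.sqrt_mul p1, harmonicEntry, c1, c2, c3, c4, a1, a2]
      push_cast
      rw [show (l + m + 1 - 1 : ℤ) = l + m by ring]
      linear_combination (√((l : ℝ) - m) * sqrtFactorial (N - 1 - i) * sqrtFactorial i *
        sqrtFactorial (l - m - 1) * sqrtFactorial (l + m) *
        sqrtFactorial (i + m + 1) * sqrtFactorial (N - 1 - i - m - 1) *
        racahSum l (N - 1 - i) i (m + 1)) * r1
  rw [E1, E2, E3]
  rw [show (N - 1 - (i + 1) + 1 : ℤ) = N - 1 - i by ring, show i + 1 - 1 = i by ring] at key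
  push_cast at key
  linear_combination (sqrtFactorial (N - 1 - i) * sqrtFactorial i * sqrtFactorial (l - m) *
    sqrtFactorial (l + m) * sqrtFactorial (i + m + 1) * sqrtFactorial (N - 1 - i - m - 1)) * key

lemma harmonicEntry_lower (N l : ℕ) (m i : ℤ) (h0 : 0 ≤ i) (hN : i < N) (h0' : 0 ≤ i + m - 1)
    (hN' : i + m - 1 < N) :
    √(i * (N - i)) * harmonicEntry N l m (i - 1)
        - harmonicEntry N l m i * √((i + m) * (N - i - m)) =
      -(√((l + m) * (l - m + 1)) * harmonicEntry N l (m - 1) i) := by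
  by_cases hm : (l : ℤ) < |m|
  · rw [harmonicEntry_eq_zero (by omega), harmonicEntry_eq_zero (i := i) (by omega)]
    by_cases hm' : (l : ℤ) < |m - 1|
    · rw [harmonicEntry_eq_zero (by omega)]; simp
    · have : m = l + 1 := by
        rcases abs_cases m with h | h <;> rcases abs_cases (m - 1) with h' | h' <;> omega
      subst this
      push_cast
      simp
  have hm1 : -(l : ℤ) ≤ m ∧ m ≤ l := abs_le.mp (not_lt.mp hm)
  have key := racahSum_lower l (N - i) (i - 1) m
  have E1 : √(i * (N - i)) * harmonicEntry N l m (i - 1) =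
      sqrtFactorial (N - i - 1) * sqrtFactorial i * sqrtFactorial (l - m) * sqrtFactorial (l + m) *
      sqrtFactorial (i + m - 1) * sqrtFactorial (N - i - m) * ((N - i) *
        racahSum l (N - i) (i - 1) m) := by
    rcases eq_or_lt_of_le h0 with h | h
    · rw [harmonicEntry_eq_zero (by omega), racahSum_eq_zero (by omega)]; simp
    · have a1 := sqrtFactorial_eq (n := i) (by omega)
      have a2 := sqrtFactorial_eq (n := N - i) (by omega)
      have p1 : (0 : ℝ) ≤ i := by exact_mod_cast h0
      have p2 : (0 : ℝ) ≤ N - i := by exact_mod_cast (by omega : 0 ≤ (N : ℤ) - i)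
      have r1 := Real.mul_self_sqrt p2
      have c1 : (N - 1 - (i - 1) : ℤ) = N - i := by ring
      have c3 : i - 1 + m = i + m - 1 := by ring
      rw [Real.sqrt_mul p1, harmonicEntry, c1, c3, a1, a2]
      push_cast
      linear_combination (√(i : ℝ) * sqrtFactorial (N - i - 1) * sqrtFactorial (i - 1) *
        sqrtFactorial (l - m) * sqrtFactorial (l + m) *
        sqrtFactorial (i + m - 1) * sqrtFactorial (N - i - m) *
        racahSum l (N - i) (i - 1) m) * r1
  have E2 : harmonicEntry N l m i * √((i + m) * (N - i - m)) =
      sqrtFactorial (N - i - 1) * sqrtFactorial i * sqrtFactorial (l - m) * sqrtFactorial (l + m) *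
      sqrtFactorial (i + m - 1) * sqrtFactorial (N - i - m) * ((i + m) *
        racahSum l (N - 1 - i) i m) := by
    rcases eq_or_lt_of_le (show i + m ≤ N by omega) with h | h
    · rw [harmonicEntry_eq_zero (by omega), racahSum_eq_zero (by omega)]; simp
    · have a1 := sqrtFactorial_eq (n := i + m) (by omega)
      have a2 := sqrtFactorial_eq (n := N - i - m) (by omega)
      have p1 : (0 : ℝ) ≤ i + m := by exact_mod_cast (by omega : 0 ≤ i + m)
      have r1 := Real.mul_self_sqrt p1
      rw [Real.sqrt_mul p1, harmonicEntry, show (N - 1 - i - m : ℤ) = N - i - m - 1 by ring,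
        show (N - 1 - i : ℤ) = N - i - 1 by ring, a1, a2]
      push_cast
      linear_combination (√((N : ℝ) - i - m) * sqrtFactorial (N - i - 1) * sqrtFactorial i *
        sqrtFactorial (l - m) * sqrtFactorial (l + m) *
        sqrtFactorial (i + m - 1) * sqrtFactorial (N - i - m - 1) *
        racahSum l (N - i - 1) i m) * r1
  have E3 : √((l + m) * (l - m + 1)) * harmonicEntry N l (m - 1) i =
      sqrtFactorial (N - i - 1) * sqrtFactorial i * sqrtFactorial (l - m) * sqrtFactorial (l + m) *
      sqrtFactorial (i + m - 1) * sqrtFactorial (N - i - m) * ((l - m + 1) *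
        racahSum l (N - 1 - i) i (m - 1)) := by
    rcases eq_or_lt_of_le hm1.1 with h | h
    · rw [harmonicEntry_eq_zero, racahSum_eq_zero]; simp
      · rw [← h, abs_of_neg] <;> omega
      · rw [← h, abs_of_neg] <;> omega
    · have a1 := sqrtFactorial_eq (n := l + m) (by omega)
      have a2 := sqrtFactorial_eq (n := l - m + 1) (by omega)
      have p1 : (0 : ℝ) ≤ l + m := by exact_mod_cast (by omega : 0 ≤ (l : ℤ) + m)
      have p2 : (0 : ℝ) ≤ l - m + 1 := by exact_mod_cast (by omega : 0 ≤ (l : ℤ) - m + 1)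
      have r1 := Real.mul_self_sqrt p2
      have c1 : (l + (m - 1) : ℤ) = l + m - 1 := by ring
      have c2 : (l - (m - 1) : ℤ) = l - m + 1 := by ring
      have c3 : (i + (m - 1) : ℤ) = i + m - 1 := by ring
      have c4 : (N - 1 - i - (m - 1) : ℤ) = N - i - m := by ring
      rw [Real.sqrt_mul p1, harmonicEntry, c1, c2, c3, c4, a1, a2,
        show (N - 1 - i : ℤ) = N - i - 1 by ring]
      push_cast
      rw [show (l - m + 1 - 1 : ℤ) = l - m by ring]
      linear_combination (√((l : ℝ) + m) * sqrtFactorial (N - i - 1) * sqrtFactorial i *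
        sqrtFactorial (l - m) * sqrtFactorial (l + m - 1) *
        sqrtFactorial (i + m - 1) * sqrtFactorial (N - i - m) *
        racahSum l (N - i - 1) i (m - 1)) * r1
  rw [E1, E2, E3]
  rw [show (N - i - 1 : ℤ) = N - 1 - i by ring, show i - 1 + 1 = i by ring] at key
  push_cast at key
  rw [show (N - i - 1 : ℤ) = N - 1 - i by ring]
  linear_combination (sqrtFactorial (N - 1 - i) * sqrtFactorial i * sqrtFactorial (l - m) *
    sqrtFactorial (l + m) * sqrtFactorial (i + m - 1) * sqrtFactorial (N - i - m)) * key

lemma neg_one_zpow_congr {a b : ℤ} (h : 2 ∣ a - b) : (-1 : ℝ) ^ a = (-1) ^ b := by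
  obtain ⟨c, hc⟩ := h
  rw [show a = 2 * c + b by omega, zpow_add₀ (by norm_num), zpow_mul]
  simp

lemma racahSum_eq_wigner_sum (N l : ℕ) (m : ℤ) (i : ℕ) :
    (∑ n ∈ Finset.range (((((N : ℤ) - 1) + 2 * l - (N - 1)) / 2).toNat + 1),
      (-1 : ℝ) ^ n * invFactorial n * invFactorial ((((N : ℤ) - 1) + 2 * l - (N - 1)) / 2 - n) *
        invFactorial ((((N : ℤ) - 1) - -((N : ℤ) - 1 - 2 * i)) / 2 - n) *
        invFactorial ((2 * l + 2 * m) / 2 - n) *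
        invFactorial ((((N : ℤ) - 1) - 2 * l + -((N : ℤ) - 1 - 2 * i)) / 2 + n) *
        invFactorial ((((N : ℤ) - 1) - (N - 1) - 2 * m) / 2 + n)) =
      racahSum l (N - 1 - i) i m := by
  have h1 : (((N : ℤ) - 1) + 2 * l - (N - 1)) / 2 = l := by omega
  have h2 : (((N : ℤ) - 1) - -((N : ℤ) - 1 - 2 * i)) / 2 = N - 1 - i := by omega
  have h3 : (2 * l + 2 * m) / 2 = l + m := by omega
  have h4 : (((N : ℤ) - 1) - 2 * l + -((N : ℤ) - 1 - 2 * i)) / 2 = i - l := by omega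
  have h5 : (((N : ℤ) - 1) - (N - 1) - 2 * m) / 2 = -m := by omega
  rw [h1, h2, h3, h4, h5, racahSum, Int.toNat_natCast]
  refine Finset.sum_congr rfl fun n _ => ?_
  rw [show (-m + n : ℤ) = n - m by ring]

/-- Since the index `i` stands for the weight `(N-1)/2 - i`, the rule `-m₁ + m + m₂ = 0` puts the
support on the `m`-th diagonal. There `l < N` is the triangle condition, and the sign `(-1)^i
(-1)^(k-l)` no longer depends on the row. -/
lemma matrixHarmonic_apply {N l : ℕ} (hl : l < N) (m : ℤ) (i k : Fin N) :
    matrixHarmonic N l m i k =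
      if ((k : ℕ) : ℤ) = (i : ℕ) + m then
        ((harmonicFactor N l * (-1) ^ (m - l) * harmonicEntry N l m (i : ℕ) : ℝ) : ℂ) else 0 := by
  obtain ⟨i, hi⟩ := i
  obtain ⟨k, hk⟩ := k
  simp only [matrixHarmonic, Matrix.of_apply]
  by_cases hm : (l : ℤ) < |m|
  · rw [harmonicEntry_eq_zero (by omega), wigner3j, if_neg]
    · simp
    · rintro ⟨-, h, -⟩
      rw [abs_mul] at h
      norm_num at h
      omega
  by_cases hik : (k : ℤ) = i + m
  · have hm1 : -(l : ℤ) ≤ m ∧ m ≤ l := abs_le.mp (not_lt.mp hm)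
    rw [if_pos hik, wigner3j, if_pos]
    · rw [racahSum_eq_wigner_sum]
      have e1 : (((N : ℤ) - 1) - 2 * l - ((N : ℤ) - 1 - 2 * k)) / 2 = k - l := by omega
      have f1 : halfFactorial (((N : ℤ) - 1) + 2 * l - (N - 1)) = l.factorial := by
        rw [halfFactorial]; congr 3; omega
      have f2 : halfFactorial (((N : ℤ) - 1) - 2 * l + (N - 1)) =
          ((N : ℤ) - 1 - l).toNat.factorial := by
        rw [halfFactorial]; congr 3; omega
      have f3 : halfFactorial (-((N : ℤ) - 1) + 2 * l + (N - 1)) = l.factorial := by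
        rw [halfFactorial]; congr 3; omega
      have f4 : halfFactorial (((N : ℤ) - 1) + 2 * l + (N - 1) + 2) = (N + l).factorial := by
        rw [halfFactorial]; congr 3; omega
      have g1 : halfFactorial (((N : ℤ) - 1) - -((N : ℤ) - 1 - 2 * i)) =
          sqrtFactorial (N - 1 - i) ^ 2 := by
        rw [sqrtFactorial_sq, halfFactorial]; congr 3; omega
      have g2 : halfFactorial (((N : ℤ) - 1) + -((N : ℤ) - 1 - 2 * i)) = sqrtFactorial i ^ 2 := by
        rw [sqrtFactorial_sq, halfFactorial]; congr 3; omega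
      have g3 : halfFactorial (2 * l - 2 * m) = sqrtFactorial (l - m) ^ 2 := by
        rw [sqrtFactorial_sq, halfFactorial]; congr 3; omega
      have g4 : halfFactorial (2 * l + 2 * m) = sqrtFactorial (l + m) ^ 2 := by
        rw [sqrtFactorial_sq, halfFactorial]; congr 3; omega
      have g5 : halfFactorial (((N : ℤ) - 1) - ((N : ℤ) - 1 - 2 * k)) =
          sqrtFactorial (i + m) ^ 2 := by
        rw [sqrtFactorial_sq, halfFactorial]; congr 3; omega
      have g6 : halfFactorial (((N : ℤ) - 1) + ((N : ℤ) - 1 - 2 * k)) =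
          sqrtFactorial (N - 1 - i - m) ^ 2 := by
        rw [sqrtFactorial_sq, halfFactorial]; congr 3; omega
      have hs : (-1 : ℝ) ^ i * (-1 : ℝ) ^ ((k : ℤ) - l) = (-1) ^ (m - l) := by
        rw [← zpow_natCast, ← zpow_add₀ (by norm_num)]
        exact neg_one_zpow_congr (by omega)
      rw [e1, f1, f2, f3, f4, g1, g2, g3, g4, g5, g6, ← hs]
      rw [show sqrtFactorial (N - 1 - i) ^ 2 * sqrtFactorial i ^ 2 * sqrtFactorial (l - m) ^ 2 *
        sqrtFactorial (l + m) ^ 2 * sqrtFactorial (i + m) ^ 2 * sqrtFactorial (N - 1 - i - m) ^ 2 =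
        (sqrtFactorial (N - 1 - i) * sqrtFactorial i * sqrtFactorial (l - m) *
        sqrtFactorial (l + m) * sqrtFactorial (i + m) * sqrtFactorial (N - 1 - i - m)) ^ 2 by ring,
        Real.sqrt_sq (by unfold sqrtFactorial; positivity), harmonicFactor, harmonicEntry,
        show (l.factorial : ℝ) * ((N : ℤ) - 1 - l).toNat.factorial * l.factorial =
          (l.factorial : ℝ) ^ 2 * ((N : ℤ) - 1 - l).toNat.factorial by ring]
      congr 1
      ring
    · refine ⟨?_, ?_, ?_, ?_, ?_, ?_, ?_, ?_, ?_⟩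
      · rw [abs_le]; omega
      · rw [abs_le]; omega
      · rw [abs_le]; omega
      · omega
      · omega
      · omega
      · omega
      · rw [abs_le]; omega
      · omega
  · rw [if_neg hik, wigner3j, if_neg]
    · simp
    · rintro ⟨-, -, -, -, -, -, h, -⟩
      omega

lemma spinRaising_conjTranspose_apply (N : ℕ) (i k : Fin N) :
    (spinRaising N)ᴴ i k =
      if (k : ℕ) + 1 = i then (√((i : ℕ) * ((N : ℝ) - (i : ℕ))) : ℂ) else 0 := by
  rw [Matrix.conjTranspose_apply, spinRaising, Matrix.of_apply]
  split_ifs <;> simp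

/-- The matrix harmonics form a spherical tensor operator. Each product with `spinRaising N` has at
most one nonzero term per entry, so the claim is `harmonicEntry_raise`; its minus sign is absorbed
by the sign change of `(-1)^(m-l)` under `m ↦ m + 1`. -/
lemma lie_spinRaising_matrixHarmonic {N l : ℕ} (hl : l < N) (m : ℤ) :
    ⁅spinRaising N, matrixHarmonic N l m⁆ =
      ((√((l - m) * (l + m + 1)) : ℝ) : ℂ) • matrixHarmonic N l (m + 1) := by
  ext i k
  have hi := i.2
  have hk := k.2
  rw [Ring.lie_def, Matrix.sub_apply, Matrix.mul_apply, Matrix.mul_apply, Matrix.smul_apply,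
    matrixHarmonic_apply hl]
  have A1 : ∑ p, spinRaising N i p * matrixHarmonic N l m p k =
      if ((k : ℕ) : ℤ) = (i : ℕ) + (m + 1) then ((√(((i : ℕ) + 1) * (N - 1 - (i : ℕ))) *
        (harmonicFactor N l * (-1) ^ (m - l) * harmonicEntry N l m ((i : ℕ) + 1)) : ℝ) : ℂ)
      else 0 := by
    by_cases h : (i : ℕ) + 1 < N
    · rw [Finset.sum_eq_single ⟨(i : ℕ) + 1, h⟩]
      · rw [matrixHarmonic_apply hl, spinRaising, Matrix.of_apply, if_pos rfl]
        have : ((k : ℕ) : ℤ) = ((i : ℕ) + 1 : ℕ) + m ↔ ((k : ℕ) : ℤ) = (i : ℕ) + (m + 1) := by omega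
        simp only [this]
        split_ifs
        · push_cast
          rw [show ((N : ℝ) - ((i : ℕ) + 1)) = N - 1 - (i : ℕ) by ring]
        · simp
      · intro p _ hp
        rw [spinRaising, Matrix.of_apply, if_neg, zero_mul]
        intro h'
        exact hp (Fin.ext h'.symm)
      · simp
    · rw [Finset.sum_eq_zero, harmonicEntry_eq_zero (by omega)]
      · simp
      · intro p _
        rw [spinRaising, Matrix.of_apply, if_neg (by omega), zero_mul]
  have A2 : ∑ p, matrixHarmonic N l m i p * spinRaising N p k =
      if ((k : ℕ) : ℤ) = (i : ℕ) + (m + 1) then ((harmonicFactor N l * (-1) ^ (m - l) *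
        harmonicEntry N l m (i : ℕ) * √(((i : ℕ) + m + 1) * (N - 1 - (i : ℕ) - m)) : ℝ) : ℂ)
      else 0 := by
    by_cases h : 1 ≤ (k : ℕ)
    · rw [Finset.sum_eq_single ⟨(k : ℕ) - 1, by omega⟩]
      · have hS : spinRaising N ⟨(k : ℕ) - 1, by omega⟩ k =
            (√((k : ℕ) * ((N : ℝ) - (k : ℕ))) : ℂ) := by
          rw [spinRaising, Matrix.of_apply, if_pos (by simp; omega)]
        rw [matrixHarmonic_apply hl, hS]
        have : (((k : ℕ) - 1 : ℕ) : ℤ) = (i : ℕ) + m ↔ ((k : ℕ) : ℤ) = (i : ℕ) + (m + 1) := by omega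
        simp only [this]
        split_ifs with h'
        · have h2 : ((k : ℕ) : ℝ) = (i : ℕ) + m + 1 := by
            have : (((k : ℕ) : ℤ) : ℝ) = (((i : ℕ) + (m + 1) : ℤ) : ℝ) := by rw [h']
            push_cast at this
            linarith
          rw [h2, show ((N : ℝ) - ((i : ℕ) + m + 1)) = N - 1 - (i : ℕ) - m by ring]
          push_cast
          rfl
        · simp
      · intro p _ hp
        rw [spinRaising, Matrix.of_apply, if_neg, mul_zero]
        intro h'
        exact hp (Fin.ext (by simp; omega))
      · simp
    · rw [Finset.sum_eq_zero]
      · split_ifs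
        · rw [harmonicEntry_eq_zero (by omega)]; simp
        · rfl
      · intro p _
        rw [spinRaising, Matrix.of_apply, if_neg (by omega), mul_zero]
  rw [A1, A2]
  split_ifs with h
  · have key := harmonicEntry_raise N l m (i : ℕ) (by omega) (by omega) (by omega) (by omega)
    have hs : (-1 : ℝ) ^ (m + 1 - l) = -(-1) ^ (m - l) := by
      rw [show m + 1 - (l : ℤ) = (m - l) + 1 by ring, zpow_add_one₀ (by norm_num)]; ring
    rw [smul_eq_mul, ← Complex.ofReal_sub, ← Complex.ofReal_mul, hs]
    push_cast at key
    congr 1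
    linear_combination (harmonicFactor N l * (-1) ^ (m - l)) * key
  · simp

lemma lie_spinLowering_matrixHarmonic {N l : ℕ} (hl : l < N) (m : ℤ) :
    ⁅(spinRaising N)ᴴ, matrixHarmonic N l m⁆ =
      ((√((l + m) * (l - m + 1)) : ℝ) : ℂ) • matrixHarmonic N l (m - 1) := by
  ext i k
  have hi := i.2
  have hk := k.2
  rw [Ring.lie_def, Matrix.sub_apply, Matrix.mul_apply, Matrix.mul_apply, Matrix.smul_apply,
    matrixHarmonic_apply hl]
  have A1 : ∑ p, (spinRaising N)ᴴ i p * matrixHarmonic N l m p k =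
      if ((k : ℕ) : ℤ) = (i : ℕ) + (m - 1) then ((√((i : ℕ) * (N - (i : ℕ))) *
        (harmonicFactor N l * (-1) ^ (m - l) * harmonicEntry N l m ((i : ℕ) - 1)) : ℝ) : ℂ)
      else 0 := by
    by_cases h : 1 ≤ (i : ℕ)
    · rw [Finset.sum_eq_single ⟨(i : ℕ) - 1, by omega⟩]
      · rw [matrixHarmonic_apply hl, spinRaising_conjTranspose_apply, if_pos (by simp; omega)]
        have : ((k : ℕ) : ℤ) = ((i : ℕ) - 1 : ℕ) + m ↔ ((k : ℕ) : ℤ) = (i : ℕ) + (m - 1) := by omega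
        simp only [this]
        split_ifs
        · push_cast [h]
          rfl
        · simp
      · intro p _ hp
        rw [spinRaising_conjTranspose_apply, if_neg, zero_mul]
        intro h'
        exact hp (Fin.ext (by simp; omega))
      · simp
    · rw [Finset.sum_eq_zero, harmonicEntry_eq_zero (by omega)]
      · simp
      · intro p _
        rw [spinRaising_conjTranspose_apply, if_neg (by omega), zero_mul]
  have A2 : ∑ p, matrixHarmonic N l m i p * (spinRaising N)ᴴ p k =
      if ((k : ℕ) : ℤ) = (i : ℕ) + (m - 1) then ((harmonicFactor N l * (-1) ^ (m - l) *
        harmonicEntry N l m (i : ℕ) * √(((i : ℕ) + m) * (N - (i : ℕ) - m)) : ℝ) : ℂ)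
      else 0 := by
    by_cases h : (k : ℕ) + 1 < N
    · rw [Finset.sum_eq_single ⟨(k : ℕ) + 1, h⟩]
      · rw [matrixHarmonic_apply hl, spinRaising_conjTranspose_apply, if_pos rfl]
        have : (((k : ℕ) + 1 : ℕ) : ℤ) = (i : ℕ) + m ↔ ((k : ℕ) : ℤ) = (i : ℕ) + (m - 1) := by omega
        simp only [this]
        split_ifs with h'
        · have h2 : (((k : ℕ) + 1 : ℕ) : ℝ) = (i : ℕ) + m := by
            have : (((k : ℕ) : ℤ) : ℝ) = (((i : ℕ) + (m - 1) : ℤ) : ℝ) := by rw [h']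
            push_cast at this ⊢
            linarith
          rw [h2, show ((N : ℝ) - ((i : ℕ) + m)) = N - (i : ℕ) - m by ring]
          push_cast
          rfl
        · simp
      · intro p _ hp
        rw [spinRaising_conjTranspose_apply, if_neg, mul_zero]
        intro h'
        exact hp (Fin.ext h'.symm)
      · simp
    · rw [Finset.sum_eq_zero]
      · split_ifs
        · rw [harmonicEntry_eq_zero (by omega)]; simp
        · rfl
      · intro p _
        rw [spinRaising_conjTranspose_apply, if_neg (by omega), mul_zero]
  rw [A1, A2]
  split_ifs with h
  · have key := harmonicEntry_lower N l m (i : ℕ) (by omega) (by omega) (by omega) (by omega)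
    have hs : (-1 : ℝ) ^ (m - 1 - l) = -(-1) ^ (m - l) := by
      rw [show m - 1 - (l : ℤ) = (m - l) - 1 by ring, zpow_sub_one₀ (by norm_num)]; ring
    rw [smul_eq_mul, ← Complex.ofReal_sub, ← Complex.ofReal_mul, hs]
    push_cast at key
    congr 1
    linear_combination (harmonicFactor N l * (-1) ^ (m - l)) * key
  · simp

/-! ### Orthonormality of the matrix harmonics and the Hoppe–Yau Laplacian -/

lemma trace_conjTranspose_mul {n : Type*} [Fintype n] (A B : Matrix n n ℂ) :
    (Aᴴ * B).trace = ∑ i, ∑ k, (starRingEnd ℂ) (A i k) * B i k := by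
  rw [Matrix.trace, Finset.sum_comm]
  simp [Matrix.mul_apply]

/-- The adjoint of `ad X` for the Hilbert–Schmidt product is `ad Xᴴ`, by cyclicity of the trace. -/
lemma trace_conjTranspose_mul_lie {n : Type*} [Fintype n] [DecidableEq n] (A B X : Matrix n n ℂ) :
    (Aᴴ * ⁅X, B⁆).trace = (⁅Xᴴ, A⁆ᴴ * B).trace := by
  simp only [Ring.lie_def, Matrix.conjTranspose_sub, Matrix.conjTranspose_mul,
    Matrix.conjTranspose_conjTranspose, Matrix.mul_sub, Matrix.sub_mul, Matrix.trace_sub]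
  rw [Matrix.mul_assoc, ← Matrix.mul_assoc Aᴴ B X, Matrix.trace_mul_comm (Aᴴ * B) X,
    Matrix.mul_assoc]

/-- Raising on the right factor is moved to lowering on the left one. This ties the inner products
at `m` and `m + 1` together. -/
lemma trace_matrixHarmonic_raise {N l l' : ℕ} (hl : l < N) (hl' : l' < N) (m : ℤ) :
    ((√((l' - m) * (l' + m + 1)) : ℝ) : ℂ) *
        ((matrixHarmonic N l (m + 1))ᴴ * matrixHarmonic N l' (m + 1)).trace =
      ((√((l - m) * (l + m + 1)) : ℝ) : ℂ) *
        ((matrixHarmonic N l m)ᴴ * matrixHarmonic N l' m).trace := by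
  have h := trace_conjTranspose_mul_lie (matrixHarmonic N l (m + 1)) (matrixHarmonic N l' m)
    (spinRaising N)
  rw [lie_spinRaising_matrixHarmonic hl', lie_spinLowering_matrixHarmonic hl,
    Matrix.conjTranspose_smul, Matrix.mul_smul, Matrix.smul_mul, Matrix.trace_smul,
    Matrix.trace_smul, smul_eq_mul, smul_eq_mul] at h
  rw [h, add_sub_cancel_right]
  congr 1
  rw [RCLike.star_def, Complex.conj_ofReal]
  congr 2
  push_cast
  ring

lemma trace_matrixHarmonic_of_ne {N l l' : ℕ} (hl : l < N) (hl' : l' < N) {m m' : ℤ}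
    (hm : m ≠ m') : ((matrixHarmonic N l m)ᴴ * matrixHarmonic N l' m').trace = 0 := by
  rw [trace_conjTranspose_mul]
  refine Finset.sum_eq_zero fun i _ => Finset.sum_eq_zero fun k _ => ?_
  rw [matrixHarmonic_apply hl, matrixHarmonic_apply hl']
  by_cases h : ((k : ℕ) : ℤ) = (i : ℕ) + m
  · rw [if_neg (c := ((k : ℕ) : ℤ) = (i : ℕ) + m') (by omega), mul_zero]
  · rw [if_neg h, map_zero, zero_mul]

lemma trace_matrixHarmonic_of_degree_ne {N l l' : ℕ} (hl : l < N) (hl' : l' < N) {m : ℤ}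
    (hm : |m| ≤ l) (hm' : |m| ≤ l') (hne : l ≠ l') :
    ((matrixHarmonic N l m)ᴴ * matrixHarmonic N l' m).trace = 0 := by
  have h1 := trace_matrixHarmonic_raise hl hl' m
  have h2 := congrArg (starRingEnd ℂ) (trace_matrixHarmonic_raise hl' hl m)
  have hc : ∀ m : ℤ, (starRingEnd ℂ) ((matrixHarmonic N l' m)ᴴ * matrixHarmonic N l m).trace =
      ((matrixHarmonic N l m)ᴴ * matrixHarmonic N l' m).trace := by
    intro m
    rw [starRingEnd_apply, ← Matrix.trace_conjTranspose, Matrix.conjTranspose_mul,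
      Matrix.conjTranspose_conjTranspose]
  rw [map_mul, map_mul, Complex.conj_ofReal, Complex.conj_ofReal, hc, hc] at h2
  have sq : ∀ l : ℕ, |m| ≤ l → ((√((l - m) * (l + m + 1)) : ℝ) : ℂ) ^ 2 =
      ((l - m) * (l + m + 1) : ℂ) := by
    intro l h
    have h' := abs_le.mp h
    have p1 : (0 : ℝ) ≤ l - m := by exact_mod_cast (by omega : 0 ≤ (l : ℤ) - m)
    have p2 : (0 : ℝ) ≤ l + m + 1 := by exact_mod_cast (by omega : 0 ≤ (l : ℤ) + m + 1)
    rw [← Complex.ofReal_pow, Real.sq_sqrt (mul_nonneg p1 p2)]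
    push_cast
    ring
  have s1 := sq l hm
  have s2 := sq l' hm'
  set a := ((√((l - m) * (l + m + 1)) : ℝ) : ℂ)
  set b := ((√((l' - m) * (l' + m + 1)) : ℝ) : ℂ)
  set y := ((matrixHarmonic N l m)ᴴ * matrixHarmonic N l' m).trace
  -- With `x` the product at `m + 1`, the relations read `b x = a y` and, with `l` and `l'`
  -- exchanged and conjugated, `a x = b y`. Hence `a² y = b² y`, where `a² - b² = l(l+1) -
  -- l'(l'+1)`.
  have h3 : (((l : ℂ) - l') * (l + l' + 1)) * y = 0 := by
    linear_combination b * h2 - a * h1 - y * s1 + y * s2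
  have hne1 : ((l : ℂ) - l') ≠ 0 := sub_ne_zero.mpr (by exact_mod_cast hne)
  have hne2 : ((l : ℂ) + l' + 1) ≠ 0 := by exact_mod_cast Nat.succ_ne_zero (l + l')
  exact (mul_eq_zero.mp h3).resolve_left (mul_ne_zero hne1 hne2)

/-- The coefficient of `xⁿ` in the square of `(1 - x)^(-(l+1))`. -/
lemma sum_choose_mul_choose (l n : ℕ) :
    ∑ i ∈ Finset.range (n + 1), (l + (n - i)).choose l * (l + i).choose l =
      (2 * l + 1 + n).choose (2 * l + 1) := by
  have h := congrArg (PowerSeries.coeff n) (show (PowerSeries.mk 1 : PowerSeries ℤ) ^ (l + 1) *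
    (PowerSeries.mk 1) ^ (l + 1) = (PowerSeries.mk 1) ^ (2 * l + 1 + 1) by rw [← pow_add]; congr 1; ring)
  rw [PowerSeries.mk_one_pow_eq_mk_choose_add, PowerSeries.mk_one_pow_eq_mk_choose_add,
    PowerSeries.coeff_mul, Finset.Nat.sum_antidiagonal_eq_sum_range_succ_mk] at h
  simp only [PowerSeries.coeff_mk] at h
  have h' : ∑ i ∈ Finset.range (n + 1), (l + i).choose l * (l + (n - i)).choose l =
      (2 * l + 1 + n).choose (2 * l + 1) := by exact_mod_cast h
  rw [← h']
  exact Finset.sum_congr rfl fun i _ => mul_comm _ _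

/-- For `N = l + n + 1` the `l`-th diagonal has `n + 1` entries, and the one-term formula
`racahSum_top` makes their squares products of two binomials, ready for `sum_choose_mul_choose`. -/
lemma harmonicEntry_top_sq (l n i : ℕ) (hi : i ≤ n) :
    harmonicEntry (l + n + 1) l l i ^ 2 =
      (2 * l).factorial / (l.factorial : ℝ) ^ 2 *
        (((l + (n - i)).choose l * (l + i).choose l : ℕ) : ℝ) := by
  obtain ⟨j, rfl⟩ := Nat.exists_eq_add_of_le hi
  rw [harmonicEntry, racahSum_top]
  simp only [mul_pow, sqrtFactorial_sq]
  have e1 : (((l + (i + j) + 1 : ℕ) : ℤ) - 1 - i).toNat = l + j := by omega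
  have e3 : ((l : ℤ) - l).toNat = 0 := by omega
  have e4 : ((l : ℤ) + l).toNat = 2 * l := by omega
  have e5 : ((i : ℤ) + l).toNat = l + i := by omega
  have e6 : (((l + (i + j) + 1 : ℕ) : ℤ) - 1 - i - l) = j := by push_cast; ring
  rw [e1, e3, e4, e5, e6, Int.toNat_natCast, Int.toNat_natCast, invFactorial_natCast,
    invFactorial_natCast, invFactorial_natCast, ← pow_mul, mul_comm l 2, pow_mul, add_tsub_cancel_left,
    Nat.cast_mul, Nat.cast_add_choose, Nat.cast_add_choose]
  have := Nat.factorial_ne_zero l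
  have := Nat.factorial_ne_zero j
  have := Nat.factorial_ne_zero i
  simp only [Nat.factorial_zero, Nat.cast_one]
  field_simp
  norm_num

lemma trace_matrixHarmonic_top {N l : ℕ} (hl : l < N) :
    (4 * Real.pi / N : ℂ) * ((matrixHarmonic N l l)ᴴ * matrixHarmonic N l l).trace = 1 := by
  have hrow : ∀ i : Fin N, ∑ k : Fin N, (starRingEnd ℂ) (matrixHarmonic N l l i k) *
      matrixHarmonic N l l i k =
      ((harmonicFactor N l ^ 2 * harmonicEntry N l l (i : ℕ) ^ 2 : ℝ) : ℂ) := by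
    intro i
    by_cases h : (i : ℕ) + l < N
    · rw [Finset.sum_eq_single ⟨(i : ℕ) + l, h⟩]
      · rw [matrixHarmonic_apply hl, if_pos (by simp), Complex.conj_ofReal, ← Complex.ofReal_mul,
          sub_self, zpow_zero]
        congr 1
        ring
      · intro k _ hk
        rw [matrixHarmonic_apply hl, if_neg, mul_zero]
        intro h'
        exact hk (Fin.ext (by simp; omega))
      · simp
    · rw [harmonicEntry_eq_zero (by omega), Finset.sum_eq_zero]
      · simp
      · intro k _
        have := k.2
        rw [matrixHarmonic_apply hl, if_neg (by omega), mul_zero]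
  obtain ⟨n, rfl⟩ : ∃ n, N = l + n + 1 := ⟨N - l - 1, by omega⟩
  have hsum : ∑ i ∈ Finset.range (l + n + 1), harmonicEntry (l + n + 1) l l i ^ 2 =
      (2 * l).factorial / (l.factorial : ℝ) ^ 2 * ((2 * l + 1 + n).choose (2 * l + 1) : ℕ) := by
    rw [← sum_choose_mul_choose, Nat.cast_sum, Finset.mul_sum]
    have hsub : Finset.range (n + 1) ⊆ Finset.range (l + n + 1) :=
      Finset.range_subset_range.mpr (by omega)
    rw [← Finset.sum_subset hsub]
    · refine Finset.sum_congr rfl fun i hi => ?_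
      exact harmonicEntry_top_sq l n i (by simpa [Nat.lt_succ_iff] using hi)
    · intro i hi hi'
      simp at hi hi'
      rw [harmonicEntry_eq_zero]
      · simp
      · omega
  rw [trace_conjTranspose_mul]
  simp only [hrow]
  rw [← Complex.ofReal_sum, ← Finset.mul_sum,
    Fin.sum_univ_eq_sum_range (fun i : ℕ => harmonicEntry (l + n + 1) l l i ^ 2) (l + n + 1), hsum]
  have hK : harmonicFactor (l + n + 1) l ^ 2 = ((l + n + 1 : ℕ) : ℝ) / (4 * Real.pi) * (2 * l + 1) *
      ((l.factorial : ℝ) ^ 2 * n.factorial / (2 * l + 1 + n).factorial) := by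
    have e1 : (((l + n + 1 : ℕ) : ℤ) - 1 - l).toNat = n := by omega
    have e2 : l + n + 1 + l = 2 * l + 1 + n := by ring
    have := Real.pi_pos
    rw [harmonicFactor, mul_pow, mul_pow, Real.sq_sqrt (by positivity), Real.sq_sqrt (by positivity),
      Real.sq_sqrt (by positivity), e1, e2]
  rw [hK, Nat.cast_add_choose, Nat.factorial_succ (2 * l)]
  have h1 := Nat.factorial_ne_zero l
  have h2 := Nat.factorial_ne_zero n
  have h3 := Nat.factorial_ne_zero (2 * l)
  have h4 := Nat.factorial_ne_zero (2 * l + 1 + n)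
  have h5 := Real.pi_ne_zero
  have h6 : ((2 * l + 1 : ℕ) : ℝ) ≠ 0 := by positivity
  have h7 : ((l + n + 1 : ℕ) : ℝ) ≠ 0 := by positivity
  have : (4 * Real.pi / (l + n + 1 : ℕ) : ℝ) * (((l + n + 1 : ℕ) : ℝ) / (4 * Real.pi) * (2 * l + 1) *
      ((l.factorial : ℝ) ^ 2 * n.factorial / (2 * l + 1 + n).factorial) *
      ((2 * l).factorial / (l.factorial : ℝ) ^ 2 * ((2 * l + 1 + n).factorial /
        (((2 * l + 1) * (2 * l).factorial : ℕ) * n.factorial)))) = 1 := by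
    push_cast at *
    field_simp
  exact_mod_cast congrArg Complex.ofReal this

lemma trace_matrixHarmonic_self {N l : ℕ} (hl : l < N) {m : ℤ} (hm : |m| ≤ l) :
    (4 * Real.pi / N : ℂ) * ((matrixHarmonic N l m)ᴴ * matrixHarmonic N l m).trace = 1 := by
  -- Descent from `m = l`: for equal degrees the two coefficients in `trace_matrixHarmonic_raise`
  -- coincide, and they are positive for `-l ≤ m < l`, so the norm does not depend on `m`.
  have key : ∀ j : ℕ, j ≤ 2 * l →
      (4 * Real.pi / N : ℂ) * ((matrixHarmonic N l (l - j))ᴴ * matrixHarmonic N l (l - j)).trace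
        = 1 := by
    intro j
    induction j with
    | zero => intro _; simpa using trace_matrixHarmonic_top hl
    | succ j ih =>
      intro hj
      have h := trace_matrixHarmonic_raise hl hl ((l : ℤ) - (j + 1 : ℕ))
      have hpos : 0 < (((l : ℝ) - ((l : ℤ) - (j + 1 : ℕ) : ℤ)) *
          (l + ((l : ℤ) - (j + 1 : ℕ) : ℤ) + 1)) := by
        have : (j : ℝ) + 1 ≤ 2 * l := by exact_mod_cast hj
        push_cast
        apply mul_pos <;> linarith [(Nat.cast_nonneg j : (0 : ℝ) ≤ j)]
      have hne : ((√(((l : ℝ) - ((l : ℤ) - (j + 1 : ℕ) : ℤ)) *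
          (l + ((l : ℤ) - (j + 1 : ℕ) : ℤ) + 1)) : ℝ) : ℂ) ≠ 0 :=
        Complex.ofReal_ne_zero.mpr (Real.sqrt_pos.mpr hpos).ne'
      have h' := mul_left_cancel₀ hne h
      rw [show ((l : ℤ) - (j + 1 : ℕ) + 1) = l - j by push_cast; ring] at h'
      rw [← h']
      exact ih (by omega)
  have hm' := abs_le.mp hm
  have := key (l - m).toNat (by omega)
  rwa [show ((l : ℤ) - ((l - m).toNat : ℤ)) = m by omega] at this

lemma hbar_pos {N : ℕ} (hN : 2 ≤ N) : 0 < hbar N := by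
  have : (2 : ℝ) ≤ N := by exact_mod_cast hN
  exact div_pos two_pos (Real.sqrt_pos.mpr (by nlinarith))

lemma matrix_lie_smul {n : Type*} [Fintype n] [DecidableEq n] (c : ℂ) (X W : Matrix n n ℂ) :
    ⁅X, c • W⁆ = c • ⁅X, W⁆ := by
  simp only [Ring.lie_def, Matrix.mul_smul, Matrix.smul_mul, smul_sub]

lemma lie_smul_lie_smul {n : Type*} [Fintype n] [DecidableEq n] (c : ℂ) (X W : Matrix n n ℂ) :
    ⁅c • X, ⁅c • X, W⁆⁆ = (c * c) • ⁅X, ⁅X, W⁆⁆ := by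
  simp only [Ring.lie_def, Matrix.mul_smul, Matrix.smul_mul, smul_sub, Matrix.mul_sub,
    Matrix.sub_mul, smul_smul]

lemma lie_smul_add_lie_smul_add {n : Type*} [Fintype n] [DecidableEq n] (c : ℂ)
    (X Y W : Matrix n n ℂ) :
    ⁅c • (X + Y), ⁅c • (X + Y), W⁆⁆ =
      (c * c) • (⁅X, ⁅X, W⁆⁆ + ⁅X, ⁅Y, W⁆⁆ + ⁅Y, ⁅X, W⁆⁆ + ⁅Y, ⁅Y, W⁆⁆) := by
  rw [lie_smul_lie_smul]
  congr 1
  simp only [Ring.lie_def]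
  noncomm_ring

lemma lie_smul_sub_lie_smul_sub {n : Type*} [Fintype n] [DecidableEq n] (c : ℂ)
    (X Y W : Matrix n n ℂ) :
    ⁅c • (X - Y), ⁅c • (X - Y), W⁆⁆ =
      (c * c) • (⁅X, ⁅X, W⁆⁆ - ⁅X, ⁅Y, W⁆⁆ - ⁅Y, ⁅X, W⁆⁆ + ⁅Y, ⁅Y, W⁆⁆) := by
  rw [lie_smul_lie_smul]
  congr 1
  simp only [Ring.lie_def]
  noncomm_ring

/-- The Casimir operator in ladder form: the terms with two raisings or two lowerings cancel between
the first two generators, and `ħ²` cancels the prefactor. -/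
lemma hoppeYau_eq {N : ℕ} (hN : 2 ≤ N) (W : Matrix (Fin N) (Fin N) ℂ) :
    hoppeYau N W = -((1 / 2 : ℂ) • (⁅spinRaising N, ⁅(spinRaising N)ᴴ, W⁆⁆ +
      ⁅(spinRaising N)ᴴ, ⁅spinRaising N, W⁆⁆) +
      ⁅(Matrix.diagonal fun i : Fin N => (((N : ℝ) - 1) / 2 - (i : ℕ) : ℂ)),
        ⁅(Matrix.diagonal fun i : Fin N => (((N : ℝ) - 1) / 2 - (i : ℕ) : ℂ)), W⁆⁆) := by
  have hne : (hbar N : ℂ) ≠ 0 := Complex.ofReal_ne_zero.mpr (hbar_pos hN).ne'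
  set D := Matrix.diagonal fun i : Fin N => (((N : ℝ) - 1) / 2 - (i : ℕ) : ℂ) with hD
  have hsum : ∑ a : Fin 3, ⁅spinGenerator N a, ⁅spinGenerator N a, W⁆⁆ =
      ((hbar N : ℂ) ^ 2) • ((1 / 2 : ℂ) • (⁅spinRaising N, ⁅(spinRaising N)ᴴ, W⁆⁆ +
      ⁅(spinRaising N)ᴴ, ⁅spinRaising N, W⁆⁆) + ⁅D, ⁅D, W⁆⁆) := by
    rw [Fin.sum_univ_three]
    simp only [spinGenerator, Matrix.cons_val_zero, Matrix.cons_val_one, Matrix.cons_val, ← hD]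
    rw [lie_smul_add_lie_smul_add, lie_smul_sub_lie_smul_sub, lie_smul_lie_smul]
    have hI : ((hbar N / 2 : ℝ) : ℂ) * -Complex.I * (((hbar N / 2 : ℝ) : ℂ) * -Complex.I) =
        -((hbar N : ℂ) ^ 2 / 4) := by
      push_cast
      linear_combination ((hbar N : ℂ) ^ 2 / 4) * Complex.I_mul_I
    rw [hI]
    push_cast
    module
  rw [hoppeYau, hsum, smul_smul]
  have : ((1 / hbar N ^ 2 : ℝ) : ℂ) * (hbar N : ℂ) ^ 2 = 1 := by
    push_cast
    field_simp
  rw [this, one_smul]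

/-- The eigenvalue arises as `½((l+m)(l-m+1) + (l-m)(l+m+1)) + m² = l(l+1)`. -/
lemma hoppeYau_matrixHarmonic {N l : ℕ} (hN : 2 ≤ N) (hl : l < N) {m : ℤ} (hm : |m| ≤ l) :
    hoppeYau N (matrixHarmonic N l m) = (-(l * (l + 1)) : ℂ) • matrixHarmonic N l m := by
  have hm' := abs_le.mp hm
  have hD : ⁅(Matrix.diagonal fun i : Fin N => (((N : ℝ) - 1) / 2 - (i : ℕ) : ℂ)),
      matrixHarmonic N l m⁆ = (m : ℂ) • matrixHarmonic N l m := by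
    ext i k
    rw [Ring.lie_def, Matrix.sub_apply, Matrix.diagonal_mul, Matrix.mul_diagonal, Matrix.smul_apply,
      smul_eq_mul, matrixHarmonic_apply hl]
    split_ifs with h
    · have : (((k : ℕ) : ℤ) : ℂ) = (((i : ℕ) + m : ℤ) : ℂ) := by rw [h]
      push_cast at this
      rw [this]
      ring
    · simp
  have c1 : ((√((l + m) * (l - m + 1)) : ℝ) : ℂ) *
      ((√((l - (m - 1 : ℤ)) * (l + (m - 1 : ℤ) + 1)) : ℝ) : ℂ) = (l + m) * (l - m + 1) := by
    have p1 : (0 : ℝ) ≤ l + m := by exact_mod_cast (by omega : 0 ≤ (l : ℤ) + m)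
    have p2 : (0 : ℝ) ≤ l - m + 1 := by exact_mod_cast (by omega : 0 ≤ (l : ℤ) - m + 1)
    rw [← Complex.ofReal_mul, show (((l : ℝ) - (m - 1 : ℤ)) * (l + (m - 1 : ℤ) + 1)) =
      (l + m) * (l - m + 1) by push_cast; ring, Real.mul_self_sqrt (mul_nonneg p1 p2)]
    push_cast
    ring
  have c2 : ((√((l - m) * (l + m + 1)) : ℝ) : ℂ) *
      ((√((l + (m + 1 : ℤ)) * (l - (m + 1 : ℤ) + 1)) : ℝ) : ℂ) = (l - m) * (l + m + 1) := by
    have p1 : (0 : ℝ) ≤ l - m := by exact_mod_cast (by omega : 0 ≤ (l : ℤ) - m)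
    have p2 : (0 : ℝ) ≤ l + m + 1 := by exact_mod_cast (by omega : 0 ≤ (l : ℤ) + m + 1)
    rw [← Complex.ofReal_mul, show (((l : ℝ) + (m + 1 : ℤ)) * (l - (m + 1 : ℤ) + 1)) =
      (l - m) * (l + m + 1) by push_cast; ring, Real.mul_self_sqrt (mul_nonneg p1 p2)]
    push_cast
    ring
  rw [hoppeYau_eq hN, lie_spinLowering_matrixHarmonic hl, lie_spinRaising_matrixHarmonic hl,
    matrix_lie_smul, matrix_lie_smul, lie_spinLowering_matrixHarmonic hl,
    lie_spinRaising_matrixHarmonic hl, hD, matrix_lie_smul, hD, smul_smul, smul_smul, smul_smul, c1, c2, sub_add_cancel, add_sub_cancel_right]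
  module

/-! ### Traces of quantized functions -/

/-- The contribution of degree `l` to the `L²` inner product of `f` and `g`. -/
def coeffPair (f g : S2 → ℝ) (l : ℕ) : ℂ :=
  ∑ m ∈ Finset.Icc (-(l : ℤ)) l, (starRingEnd ℂ) (sphericalCoeff f l m) * sphericalCoeff g l m

/-- The quantization of the function with coefficients `c l * f^{lm}`. -/
def weightedQuantize (N : ℕ) (c : ℕ → ℂ) (f : S2 → ℝ) : Matrix (Fin N) (Fin N) ℂ :=
  ∑ l ∈ Finset.range N, ∑ m ∈ Finset.Icc (-(l : ℤ)) l,
    (c l * (Complex.I * sphericalCoeff f l m)) • matrixHarmonic N l m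

lemma weightedQuantize_one (N : ℕ) (f : S2 → ℝ) :
    weightedQuantize N (fun _ => 1) f = quantize N f := by
  simp [weightedQuantize, quantize]

lemma trace_matrixHarmonic_weightedQuantize {N l : ℕ} (hl : l < N) {m : ℤ} (hm : |m| ≤ l)
    (c : ℕ → ℂ) (f : S2 → ℝ) :
    (4 * Real.pi / N : ℂ) * ((matrixHarmonic N l m)ᴴ * weightedQuantize N c f).trace =
      c l * (Complex.I * sphericalCoeff f l m) := by
  have hterm : ∀ l' ∈ Finset.range N, ∀ m' ∈ Finset.Icc (-(l' : ℤ)) l', ¬(l' = l ∧ m' = m) →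
      (4 * Real.pi / N : ℂ) * ((c l' * (Complex.I * sphericalCoeff f l' m')) *
        ((matrixHarmonic N l m)ᴴ * matrixHarmonic N l' m').trace) = 0 := by
    intro l' hl' m' hm' hne
    rw [Finset.mem_range] at hl'
    rw [Finset.mem_Icc, ← abs_le] at hm'
    by_cases h : m = m'
    · subst h
      rw [trace_matrixHarmonic_of_degree_ne hl hl' hm hm' (fun h => hne ⟨h.symm, rfl⟩)]
      simp
    · rw [trace_matrixHarmonic_of_ne hl hl' h]
      simp
  simp only [weightedQuantize, Matrix.trace_sum, Matrix.mul_smul,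
    Matrix.trace_smul, smul_eq_mul, Finset.mul_sum]
  rw [Finset.sum_eq_single_of_mem l (Finset.mem_range.mpr hl), Finset.sum_eq_single_of_mem m]
  · rw [mul_left_comm, trace_matrixHarmonic_self hl hm, mul_one]
  · rwa [Finset.mem_Icc, ← abs_le]
  · intro m' hm' hne
    exact hterm l (Finset.mem_range.mpr hl) m' hm' (fun h => hne h.2)
  · intro l' hl' hne
    exact Finset.sum_eq_zero fun m' hm' => hterm l' hl' m' hm' (fun h => hne h.1)

/-- Orthonormality turns the trace into a truncated Parseval sum; the factors `i` of the
quantization drop out as `conj(i) i = 1`. The weights `c` accommodate the Laplacian. -/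
lemma trace_quantize_weightedQuantize (N : ℕ) (c : ℕ → ℂ) (f g : S2 → ℝ) :
    (4 * Real.pi / N : ℂ) * ((quantize N f)ᴴ * weightedQuantize N c g).trace =
      ∑ l ∈ Finset.range N, c l * coeffPair f g l := by
  simp only [quantize, Matrix.conjTranspose_sum, Matrix.conjTranspose_smul, Matrix.sum_mul,
    Matrix.smul_mul, Matrix.trace_sum, Matrix.trace_smul, smul_eq_mul, Finset.mul_sum, coeffPair]
  refine Finset.sum_congr rfl fun l hl => Finset.sum_congr rfl fun m hm => ?_
  rw [Finset.mem_range] at hl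
  rw [Finset.mem_Icc, ← abs_le] at hm
  rw [mul_left_comm, trace_matrixHarmonic_weightedQuantize hl hm, RCLike.star_def, map_mul,
    Complex.conj_I]
  linear_combination (-(starRingEnd ℂ) (sphericalCoeff f l m) * c l * sphericalCoeff g l m) *
    Complex.I_mul_I

/-- The Hoppe–Yau Laplacian as a linear map. -/
def hoppeYauLinear (N : ℕ) : Matrix (Fin N) (Fin N) ℂ →ₗ[ℂ] Matrix (Fin N) (Fin N) ℂ where
  toFun := hoppeYau N
  map_add' A B := by
    have h : ∀ X : Matrix (Fin N) (Fin N) ℂ, ⁅X, ⁅X, A + B⁆⁆ = ⁅X, ⁅X, A⁆⁆ + ⁅X, ⁅X, B⁆⁆ := by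
      intro X
      simp only [Ring.lie_def]
      noncomm_ring
    simp only [hoppeYau, h, Finset.sum_add_distrib, smul_add, neg_add]
  map_smul' c A := by
    simp only [hoppeYau, matrix_lie_smul, ← Finset.smul_sum, RingHom.id_apply]
    rw [smul_comm, smul_neg]

lemma hoppeYau_quantize {N : ℕ} (hN : 2 ≤ N) (f : S2 → ℝ) :
    hoppeYau N (quantize N f) = weightedQuantize N (fun l => -(l * (l + 1))) f := by
  change hoppeYauLinear N (quantize N f) = _
  simp only [quantize, weightedQuantize, map_sum, map_smul]
  refine Finset.sum_congr rfl fun l hl => Finset.sum_congr rfl fun m hm => ?_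
  rw [Finset.mem_range] at hl
  rw [Finset.mem_Icc, ← abs_le] at hm
  change _ • hoppeYau N _ = _
  rw [hoppeYau_matrixHarmonic hN hl hm, smul_smul, mul_comm]

lemma quantizedCrossHelicity_eq {N : ℕ} (hN : 2 ≤ N) (ρ q ξ ψ : S2 → ℝ) :
    quantizedCrossHelicity N ρ q ξ ψ =
      ∑ l ∈ Finset.range N, -(l * (l + 1) : ℂ) * coeffPair ξ ψ l -
        ∑ l ∈ Finset.range N, coeffPair ρ q l := by
  rw [quantizedCrossHelicity, Matrix.trace_sub, mul_sub, hoppeYau_quantize hN,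
    trace_quantize_weightedQuantize, ← weightedQuantize_one N q, trace_quantize_weightedQuantize]
  simp

/-- The energy is `-½` times the sum of the cross-helicities of `(q, q, ψ, ψ)` and `(ρ, ρ, ξ, ξ)`.
-/
lemma quantizedHamiltonian_eq {N : ℕ} (hN : 2 ≤ N) (ρ q ξ ψ : S2 → ℝ) :
    quantizedHamiltonian N ρ q ξ ψ =
      -(1 / 2) * (∑ l ∈ Finset.range N, -(l * (l + 1) : ℂ) * coeffPair ψ ψ l -
        ∑ l ∈ Finset.range N, coeffPair q q l) -
      (1 / 2) * (∑ l ∈ Finset.range N, -(l * (l + 1) : ℂ) * coeffPair ξ ξ l -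
        ∑ l ∈ Finset.range N, coeffPair ρ ρ l) := by
  rw [← quantizedCrossHelicity_eq hN, ← quantizedCrossHelicity_eq hN, quantizedHamiltonian,
    quantizedCrossHelicity, quantizedCrossHelicity]
  ring

/-! ### Rotations of the sphere -/

/-- The infinitesimal rotation in the plane of the coordinates `a` and `a + 1`. -/
def rotGen (a : Fin 3) : EuclideanSpace ℝ (Fin 3) →ₗ[ℝ] EuclideanSpace ℝ (Fin 3) where
  toFun x := WithLp.toLp 2 fun k => if k = a then -x (a + 1) else if k = a + 1 then x a else 0
  map_add' x y := by
    ext k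
    simp only [PiLp.add_apply]
    split_ifs <;> ring
  map_smul' c x := by
    ext k
    simp only [PiLp.smul_apply, smul_eq_mul, RingHom.id_apply]
    split_ifs <;> ring

lemma rotGen_apply (a : Fin 3) (x : EuclideanSpace ℝ (Fin 3)) (k : Fin 3) :
    rotGen a x k = if k = a then -x (a + 1) else if k = a + 1 then x a else 0 := rfl

/-- The relation behind Rodrigues' formula: it makes `rotLin a t` the exponential of `t • rotGen a`,
and is what `hasDerivAt_rotLin` needs. -/
lemma rotGen_cube (a : Fin 3) (x : EuclideanSpace ℝ (Fin 3)) :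
    rotGen a (rotGen a (rotGen a x)) = -rotGen a x := by
  ext k
  fin_cases a <;> fin_cases k <;> simp [rotGen_apply]

/-- The rotation by the angle `t` in the plane of the coordinates `a` and `a + 1`. -/
def rotLin (a : Fin 3) (t : ℝ) : EuclideanSpace ℝ (Fin 3) →ₗ[ℝ] EuclideanSpace ℝ (Fin 3) :=
  LinearMap.id + Real.sin t • rotGen a + (1 - Real.cos t) • rotGen a ∘ₗ rotGen a

lemma rotLin_apply (a : Fin 3) (t : ℝ) (x : EuclideanSpace ℝ (Fin 3)) :
    rotLin a t x = x + Real.sin t • rotGen a x + (1 - Real.cos t) • rotGen a (rotGen a x) := rfl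

lemma norm_rotLin (a : Fin 3) (t : ℝ) (x : EuclideanSpace ℝ (Fin 3)) : ‖rotLin a t x‖ = ‖x‖ := by
  rw [EuclideanSpace.norm_eq, EuclideanSpace.norm_eq]
  congr 1
  have h := Real.sin_sq_add_cos_sq t
  simp only [Fin.sum_univ_three, rotLin_apply, PiLp.add_apply, PiLp.smul_apply, rotGen_apply,
    smul_eq_mul, Real.norm_eq_abs, sq_abs]
  fin_cases a <;> simp
  · linear_combination (x 0 ^ 2 + x 1 ^ 2) * h
  · linear_combination (x 1 ^ 2 + x 2 ^ 2) * h
  · linear_combination (x 0 ^ 2 + x 2 ^ 2) * h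

lemma hasDerivAt_rotLin (a : Fin 3) (x : EuclideanSpace ℝ (Fin 3)) (t : ℝ) :
    HasDerivAt (fun t => rotLin a t x) (rotGen a (rotLin a t x)) t := by
  have h : HasDerivAt (fun t => rotLin a t x)
      (Real.cos t • rotGen a x + -(-Real.sin t) • rotGen a (rotGen a x)) t := by
    simp only [rotLin_apply]
    exact (((Real.hasDerivAt_sin t).smul_const _).const_add x).add
      (((Real.hasDerivAt_cos t).const_sub 1).smul_const _)
  convert h using 1
  simp only [rotLin_apply, map_add, map_smul, rotGen_cube]
  module

/-- The rotation as a linear isometry. -/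
def rotIso (a : Fin 3) (t : ℝ) : EuclideanSpace ℝ (Fin 3) ≃ₗᵢ[ℝ] EuclideanSpace ℝ (Fin 3) :=
  LinearIsometry.toLinearIsometryEquiv ⟨rotLin a t, norm_rotLin a t⟩ rfl

lemma rotIso_apply (a : Fin 3) (t : ℝ) (x : EuclideanSpace ℝ (Fin 3)) :
    rotIso a t x = rotLin a t x := rfl

/-- The rotation as a map of the sphere. -/
def rot (a : Fin 3) (t : ℝ) (x : S2) : S2 :=
  ⟨rotLin a t x.1, by rw [mem_sphere_zero_iff_norm, norm_rotLin]; exact mem_sphere_zero_iff_norm.mp x.2⟩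

lemma rot_zero (a : Fin 3) (x : S2) : rot a 0 x = x := by
  apply Subtype.ext
  simp [rot, rotLin_apply]

lemma continuous_rot (a : Fin 3) (t : ℝ) : Continuous (rot a t) :=
  ((rotIso a t).continuous.comp continuous_subtype_val).subtype_mk _

instance : IsFiniteMeasure area := inferInstanceAs (IsFiniteMeasure (Measure.toSphere _))

open scoped Pointwise in
-- The area of a set is, up to a constant, the volume of the cone over it, and linear isometries
-- preserve volume and commute with taking cones.
lemma measurePreserving_rot (a : Fin 3) (t : ℝ) : MeasurePreserving (rot a t) area area := by
  refine ⟨(continuous_rot a t).measurable, ?_⟩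
  ext s hs
  have hs' : MeasurableSet (rot a t ⁻¹' s) := (continuous_rot a t).measurable hs
  rw [Measure.map_apply (continuous_rot a t).measurable hs, area, Measure.toSphere_apply' _ hs,
    Measure.toSphere_apply' _ hs']
  congr 1
  rw [← (rotIso a t).measurePreserving.measure_preimage_emb
    (rotIso a t).toHomeomorph.measurableEmbedding (Set.Ioo (0 : ℝ) 1 • (Subtype.val '' s))]
  congr 1
  ext y
  simp only [Set.mem_smul, Set.mem_image, Set.mem_preimage]
  constructor
  · rintro ⟨r, hr, _, ⟨x, hx, rfl⟩, rfl⟩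
    exact ⟨r, hr, _, ⟨_, hx, rfl⟩, by rw [rotIso_apply, map_smul]; rfl⟩
  · rintro ⟨r, hr, _, ⟨x, hx, rfl⟩, h⟩
    refine ⟨r, hr, (rotIso a t).symm x.1, ⟨⟨(rotIso a t).symm x.1, ?_⟩, ?_, rfl⟩, ?_⟩
    · rw [mem_sphere_zero_iff_norm, LinearIsometryEquiv.norm_map]
      exact mem_sphere_zero_iff_norm.mp x.2
    · convert hx
      apply Subtype.ext
      exact (rotIso a t).apply_symm_apply x.1
    · rw [← map_smul, h, LinearIsometryEquiv.symm_apply_apply]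

section RotDeriv

lemma integrable_of_continuous {F : Type*} [NormedAddCommGroup F] {f : S2 → F}
    (hf : Continuous f) : Integrable f area := by
  obtain ⟨C, hC⟩ := isCompact_univ.exists_bound_of_continuousOn hf.continuousOn
  exact Integrable.of_bound hf.aestronglyMeasurable C (ae_of_all _ fun x => hC x (Set.mem_univ x))

variable {F : Type*} [NormedAddCommGroup F] [NormedSpace ℝ F]

lemma integral_comp_rot (a : Fin 3) (t : ℝ) {f : S2 → F} (hf : Continuous f) :
    ∫ x, f (rot a t x) ∂area = ∫ x, f x ∂area := by
  have h := measurePreserving_rot a t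
  rw [← integral_map h.measurable.aemeasurable hf.aestronglyMeasurable, h.map_eq]

/-- `g` is the derivative of `f` along the rotations in the plane of `a` and `a + 1`. -/
def IsRotDeriv (a : Fin 3) (f g : S2 → F) : Prop :=
  ∀ x t, HasDerivAt (fun t => f (rot a t x)) (g (rot a t x)) t

/-- The integral of `f ∘ rot a t` does not depend on `t`; differentiate it under the integral sign
at `t = 0`. -/
lemma IsRotDeriv.integral_eq_zero {a : Fin 3} {f g : S2 → F} (h : IsRotDeriv a f g)
    (hf : Continuous f) (hg : Continuous g) : ∫ x, g x ∂area = 0 := by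
  obtain ⟨C, hC⟩ := isCompact_univ.exists_bound_of_continuousOn hg.continuousOn
  have key := (hasDerivAt_integral_of_dominated_loc_of_deriv_le (μ := area) (s := Set.univ)
    (F := fun t x => f (rot a t x)) (F' := fun t x => g (rot a t x)) (x₀ := 0)
    (bound := fun _ => C) univ_mem
    (Eventually.of_forall fun t => (hf.comp (continuous_rot a t)).aestronglyMeasurable)
    (integrable_of_continuous (hf.comp (continuous_rot a 0)))
    (hg.comp (continuous_rot a 0)).aestronglyMeasurable
    (ae_of_all _ fun x t _ => hC _ (Set.mem_univ _)) (integrable_const C)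
    (ae_of_all _ fun x t _ => h x t)).2
  simp only [integral_comp_rot a _ hf, integral_comp_rot a _ hg] at key
  exact key.unique (hasDerivAt_const _ _)

lemma IsRotDeriv.add {a : Fin 3} {f f' g g' : S2 → F} (hf : IsRotDeriv a f f')
    (hg : IsRotDeriv a g g') : IsRotDeriv a (fun x => f x + g x) (fun x => f' x + g' x) :=
  fun x t => (hf x t).add (hg x t)

lemma isRotDeriv_const (a : Fin 3) (c : F) : IsRotDeriv a (fun _ => c) (fun _ => 0) :=
  fun _ t => hasDerivAt_const t c

lemma IsRotDeriv.unique {a : Fin 3} {f g h : S2 → F} (hg : IsRotDeriv a f g)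
    (hh : IsRotDeriv a f h) : g = h := by
  funext x
  have := (hg x 0).unique (hh x 0)
  rwa [rot_zero] at this

lemma IsRotDeriv.clm_comp {G : Type*} [NormedAddCommGroup G] [NormedSpace ℝ G] {a : Fin 3}
    {f g : S2 → F} (h : IsRotDeriv a f g) (L : F →L[ℝ] G) :
    IsRotDeriv a (fun x => L (f x)) (fun x => L (g x)) :=
  fun x t => L.hasFDerivAt.comp_hasDerivAt t (h x t)

end RotDeriv

section RotDerivMul

variable {R : Type*} [NormedCommRing R] [NormedAlgebra ℝ R]

lemma IsRotDeriv.mul {a : Fin 3} {f f' g g' : S2 → R} (hf : IsRotDeriv a f f')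
    (hg : IsRotDeriv a g g') :
    IsRotDeriv a (fun x => f x * g x) (fun x => f' x * g x + f x * g' x) :=
  fun x t => (hf x t).mul (hg x t)

lemma IsRotDeriv.const_mul {a : Fin 3} {f f' : S2 → R} (hf : IsRotDeriv a f f') (c : R) :
    IsRotDeriv a (fun x => c * f x) (fun x => c * f' x) :=
  fun x t => (hf x t).const_mul c

lemma IsRotDeriv.pow {a : Fin 3} {f f' : S2 → R} (hf : IsRotDeriv a f f') (n : ℕ) :
    IsRotDeriv a (fun x => f x ^ n) (fun x => n * f x ^ (n - 1) * f' x) :=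
  fun x t => (hf x t).fun_pow n

/-- Rotational derivatives are skew-adjoint. This replaces Green's formula on the sphere. -/
lemma IsRotDeriv.integral_mul {a : Fin 3} {f f' g g' : S2 → R} (hf : IsRotDeriv a f f')
    (hg : IsRotDeriv a g g') (cf : Continuous f) (cf' : Continuous f') (cg : Continuous g)
    (cg' : Continuous g') :
    ∫ x, f' x * g x ∂area = -∫ x, f x * g' x ∂area := by
  have h := (hf.mul hg).integral_eq_zero (cf.mul cg) ((cf'.mul cg).add (cf.mul cg'))
  rw [integral_add (f := fun x => f' x * g x) (g := fun x => f x * g' x)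
    (integrable_of_continuous (cf'.mul cg)) (integrable_of_continuous (cf.mul cg'))] at h
  exact eq_neg_of_add_eq_zero_left h

end RotDerivMul

lemma isRotDeriv_coord (a k : Fin 3) :
    IsRotDeriv a (fun x : S2 => x.1 k) (fun x => rotGen a x.1 k) := by
  intro x t
  exact ((EuclideanSpace.proj k : EuclideanSpace ℝ (Fin 3) →L[ℝ] ℝ).hasFDerivAt).comp_hasDerivAt t
    (hasDerivAt_rotLin a x.1 t)

/-! ### The Laplacian of a smooth function through rotational derivatives -/

lemma finrank_three : Fact (Module.finrank ℝ (EuclideanSpace ℝ (Fin 3)) = 2 + 1) :=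
  ⟨finrank_euclideanSpace_fin⟩

/-- The extension of a function on the sphere that is constant along rays. -/
def radialExtension (φ : S2 → ℝ) (y : EuclideanSpace ℝ (Fin 3)) : ℝ :=
  if h : y = 0 then (0 : ℝ)
  else φ ⟨‖y‖⁻¹ • y, by simp [norm_smul, norm_ne_zero_iff.mpr h]⟩

lemma smoothLaplacian_eq (φ : S2 → ℝ) (x : S2) :
    smoothLaplacian φ x = Laplacian.laplacian (radialExtension φ) x.1 := rfl

lemma radialExtension_coe (φ : S2 → ℝ) (x : S2) : radialExtension φ x.1 = φ x := by
  have hx : ‖x.1‖ = 1 := mem_sphere_zero_iff_norm.mp x.2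
  have hx0 : x.1 ≠ 0 := by
    intro h
    rw [h, norm_zero] at hx
    exact zero_ne_one hx
  rw [radialExtension, dif_neg hx0]
  congr 1
  apply Subtype.ext
  simp [hx]

lemma coe_ne_zero (x : S2) : x.1 ≠ 0 := by
  intro h
  have hx : ‖x.1‖ = 1 := mem_sphere_zero_iff_norm.mp x.2
  rw [h, norm_zero] at hx
  exact zero_ne_one hx

lemma radialExtension_smul (φ : S2 → ℝ) {c : ℝ} (hc : 0 < c) (y : EuclideanSpace ℝ (Fin 3)) :
    radialExtension φ (c • y) = radialExtension φ y := by
  by_cases hy : y = 0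
  · rw [hy, smul_zero]
  · rw [radialExtension, radialExtension, dif_neg hy, dif_neg (smul_ne_zero hc.ne' hy)]
    congr 1
    apply Subtype.ext
    simp only [norm_smul, Real.norm_eq_abs, abs_of_pos hc, smul_smul, mul_inv]
    congr 1
    field_simp

/-- Away from the origin the extension is `φ` composed with `y ↦ y/‖y‖`, which is smooth from the
open submanifold `{0}ᶜ` into the sphere. -/
lemma contDiffAt_radialExtension {φ : S2 → ℝ} (hφ : ContMDiff (𝓡 2) 𝓘(ℝ, ℝ) ∞ φ)
    {y : EuclideanSpace ℝ (Fin 3)} (hy : y ≠ 0) : ContDiffAt ℝ ∞ (radialExtension φ) y := by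
  have := finrank_three
  let U : TopologicalSpace.Opens (EuclideanSpace ℝ (Fin 3)) := ⟨{0}ᶜ, isOpen_compl_singleton⟩
  have hmem : ∀ z : U, z.1 ≠ 0 := fun z => z.2
  have hn : ∀ z : U, ‖z.1‖⁻¹ • z.1 ∈ Metric.sphere (0 : EuclideanSpace ℝ (Fin 3)) 1 := by
    intro z
    simp [norm_smul, norm_ne_zero_iff.mpr (hmem z)]
  have hsm : ContMDiff 𝓘(ℝ, EuclideanSpace ℝ (Fin 3)) 𝓘(ℝ, EuclideanSpace ℝ (Fin 3)) ∞
      (fun z : U => ‖z.1‖⁻¹ • z.1) := by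
    intro z
    refine (contMDiffAt_subtype_iff (f := fun w : EuclideanSpace ℝ (Fin 3) => ‖w‖⁻¹ • w)).mpr ?_
    rw [contMDiffAt_iff_contDiffAt]
    exact ((contDiffAt_norm ℝ (hmem z)).inv (norm_ne_zero_iff.mpr (hmem z))).smul contDiffAt_id
  have hcomp := hφ.comp (hsm.codRestrict_sphere (n := 2) hn)
  rw [← contMDiffAt_iff_contDiffAt]
  refine (contMDiffAt_subtype_iff (U := U) (x := ⟨y, hy⟩)).mp ?_
  convert hcomp.contMDiffAt using 1
  funext z
  rw [radialExtension, dif_neg (hmem z)]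
  rfl

lemma hasFDerivAt_radialExtension {φ : S2 → ℝ} (hφ : ContMDiff (𝓡 2) 𝓘(ℝ, ℝ) ∞ φ)
    {y : EuclideanSpace ℝ (Fin 3)} (hy : y ≠ 0) :
    HasFDerivAt (radialExtension φ) (fderiv ℝ (radialExtension φ) y) y :=
  ((contDiffAt_radialExtension hφ hy).differentiableAt (by simp)).hasFDerivAt

lemma contDiffAt_fderiv_radialExtension {φ : S2 → ℝ} (hφ : ContMDiff (𝓡 2) 𝓘(ℝ, ℝ) ∞ φ)
    {y : EuclideanSpace ℝ (Fin 3)} (hy : y ≠ 0) :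
    ContDiffAt ℝ ∞ (fderiv ℝ (radialExtension φ)) y :=
  (contDiffAt_radialExtension hφ hy).fderiv_right (by simp)

lemma hasFDerivAt_fderiv_radialExtension {φ : S2 → ℝ} (hφ : ContMDiff (𝓡 2) 𝓘(ℝ, ℝ) ∞ φ)
    {y : EuclideanSpace ℝ (Fin 3)} (hy : y ≠ 0) :
    HasFDerivAt (fderiv ℝ (radialExtension φ)) (fderiv ℝ (fderiv ℝ (radialExtension φ)) y) y :=
  ((contDiffAt_fderiv_radialExtension hφ hy).differentiableAt (by simp)).hasFDerivAt

/-- Euler's identity for a function that is homogeneous of degree `0`. -/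
lemma fderiv_radialExtension_self {φ : S2 → ℝ} (hφ : ContMDiff (𝓡 2) 𝓘(ℝ, ℝ) ∞ φ)
    {y : EuclideanSpace ℝ (Fin 3)} (hy : y ≠ 0) : fderiv ℝ (radialExtension φ) y y = 0 := by
  have h1 : HasDerivAt (fun c : ℝ => radialExtension φ (c • y))
      (fderiv ℝ (radialExtension φ) y y) 1 := by
    have hc : HasDerivAt (fun c : ℝ => c • y) ((1 : ℝ) • y) 1 := (hasDerivAt_id (1 : ℝ)).smul_const y
    rw [one_smul] at hc
    have hF : HasFDerivAt (radialExtension φ) (fderiv ℝ (radialExtension φ) y) ((1 : ℝ) • y) := by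
      rw [one_smul]
      exact hasFDerivAt_radialExtension hφ hy
    exact hF.comp_hasDerivAt 1 hc
  have h2 : HasDerivAt (fun c : ℝ => radialExtension φ (c • y)) 0 1 := by
    refine (hasDerivAt_const (1 : ℝ) (radialExtension φ y)).congr_of_eventuallyEq ?_
    filter_upwards [lt_mem_nhds (zero_lt_one : (0 : ℝ) < 1)] with c hc
    exact radialExtension_smul φ hc y
  exact h1.unique h2

/-- Differentiating `DF(z) z = 0` at `y` in the direction `y` gives `D²F(y)(y, y) + DF(y) y = 0`. -/
lemma fderiv_fderiv_radialExtension_self {φ : S2 → ℝ} (hφ : ContMDiff (𝓡 2) 𝓘(ℝ, ℝ) ∞ φ)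
    {y : EuclideanSpace ℝ (Fin 3)} (hy : y ≠ 0) :
    fderiv ℝ (fderiv ℝ (radialExtension φ)) y y y = 0 := by
  have h1 := (hasFDerivAt_fderiv_radialExtension hφ hy).clm_apply (hasFDerivAt_id y)
  have h2 : HasFDerivAt (fun z => fderiv ℝ (radialExtension φ) z (id z))
      (0 : EuclideanSpace ℝ (Fin 3) →L[ℝ] ℝ) y := by
    refine (hasFDerivAt_const (0 : ℝ) y).congr_of_eventuallyEq ?_
    filter_upwards [isOpen_ne.mem_nhds hy] with z hz
    exact fderiv_radialExtension_self hφ hz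
  have h3 := DFunLike.congr_fun (h1.unique h2) y
  simpa [fderiv_radialExtension_self hφ hy] using h3

/-- The rotational derivative of a smooth function. -/
def rotDeriv (a : Fin 3) (φ : S2 → ℝ) (x : S2) : ℝ :=
  fderiv ℝ (radialExtension φ) x.1 (rotGen a x.1)

/-- The second rotational derivative of a smooth function. -/
def rotDeriv₂ (a : Fin 3) (φ : S2 → ℝ) (x : S2) : ℝ :=
  fderiv ℝ (fderiv ℝ (radialExtension φ)) x.1 (rotGen a x.1) (rotGen a x.1) +
    fderiv ℝ (radialExtension φ) x.1 (rotGen a (rotGen a x.1))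

lemma isRotDeriv_rotDeriv {φ : S2 → ℝ} (hφ : ContMDiff (𝓡 2) 𝓘(ℝ, ℝ) ∞ φ) (a : Fin 3) :
    IsRotDeriv a φ (rotDeriv a φ) := by
  intro x t
  have h := (hasFDerivAt_radialExtension hφ (coe_ne_zero (rot a t x))).comp_hasDerivAt t
    (hasDerivAt_rotLin a x.1 t)
  have e : (fun u => φ (rot a u x)) = radialExtension φ ∘ fun u => rotLin a u x.1 :=
    funext fun u => (radialExtension_coe φ (rot a u x)).symm
  rw [e]
  exact h

lemma isRotDeriv_rotDeriv₂ {φ : S2 → ℝ} (hφ : ContMDiff (𝓡 2) 𝓘(ℝ, ℝ) ∞ φ) (a : Fin 3) :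
    IsRotDeriv a (rotDeriv a φ) (rotDeriv₂ a φ) := by
  intro x t
  have h1 := (hasFDerivAt_fderiv_radialExtension hφ (coe_ne_zero (rot a t x))).comp_hasDerivAt t
    (hasDerivAt_rotLin a x.1 t)
  have h2 := (LinearMap.toContinuousLinearMap (rotGen a)).hasFDerivAt.comp_hasDerivAt t
    (hasDerivAt_rotLin a x.1 t)
  exact h1.clm_apply h2

lemma continuous_rotGen (a : Fin 3) : Continuous (rotGen a) :=
  LinearMap.continuous_of_finiteDimensional _

lemma continuous_fderiv_radialExtension {φ : S2 → ℝ} (hφ : ContMDiff (𝓡 2) 𝓘(ℝ, ℝ) ∞ φ) :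
    Continuous fun x : S2 => fderiv ℝ (radialExtension φ) x.1 :=
  continuous_iff_continuousAt.mpr fun x =>
    (contDiffAt_fderiv_radialExtension hφ (coe_ne_zero x)).continuousAt.comp
      continuous_subtype_val.continuousAt

lemma continuous_fderiv_fderiv_radialExtension {φ : S2 → ℝ}
    (hφ : ContMDiff (𝓡 2) 𝓘(ℝ, ℝ) ∞ φ) :
    Continuous fun x : S2 => fderiv ℝ (fderiv ℝ (radialExtension φ)) x.1 :=
  continuous_iff_continuousAt.mpr fun x =>
    ((contDiffAt_fderiv_radialExtension hφ (coe_ne_zero x)).fderiv_right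
      (m := ∞) (by simp)).continuousAt.comp continuous_subtype_val.continuousAt

lemma continuous_rotDeriv {φ : S2 → ℝ} (hφ : ContMDiff (𝓡 2) 𝓘(ℝ, ℝ) ∞ φ) (a : Fin 3) :
    Continuous (rotDeriv a φ) :=
  (continuous_fderiv_radialExtension hφ).clm_apply
    ((continuous_rotGen a).comp continuous_subtype_val)

lemma continuous_rotDeriv₂ {φ : S2 → ℝ} (hφ : ContMDiff (𝓡 2) 𝓘(ℝ, ℝ) ∞ φ) (a : Fin 3) :
    Continuous (rotDeriv₂ a φ) := by
  have h := (continuous_rotGen a).comp 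
    (continuous_subtype_val (p := fun x : EuclideanSpace ℝ (Fin 3) => x ∈ Metric.sphere 0 1))
  exact (((continuous_fderiv_fderiv_radialExtension hφ).clm_apply h).clm_apply h).add
    ((continuous_fderiv_radialExtension hφ).clm_apply ((continuous_rotGen a).comp h))

/-- Writing `A_a` for `rotGen a`, on the unit sphere `∑ A_a x ⊗ A_a x = I - x ⊗ x` and `∑ A_a² x =
-2x`. So the right side is the Euclidean Laplacian minus the radial terms `D²F(x, x)` and `2 DF(x)
x`, which vanish. -/
lemma smoothLaplacian_eq_sum_rotDeriv₂ {φ : S2 → ℝ} (hφ : ContMDiff (𝓡 2) 𝓘(ℝ, ℝ) ∞ φ) (x : S2) :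
    smoothLaplacian φ x = ∑ a, rotDeriv₂ a φ x := by
  have hL := fderiv_radialExtension_self hφ (coe_ne_zero x)
  have hB := fderiv_fderiv_radialExtension_self hφ (coe_ne_zero x)
  have hn : x.1 0 ^ 2 + x.1 1 ^ 2 + x.1 2 ^ 2 = 1 := by
    have h := EuclideanSpace.norm_sq_eq x.1
    rw [mem_sphere_zero_iff_norm.mp x.2] at h
    simp only [Fin.sum_univ_three, Real.norm_eq_abs, sq_abs] at h
    linarith
  rw [smoothLaplacian_eq, InnerProductSpace.laplacian_eq_iteratedFDeriv_orthonormalBasis _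
    (EuclideanSpace.basisFun (Fin 3) ℝ)]
  simp only [iteratedFDeriv_two_apply, EuclideanSpace.basisFun_apply, Matrix.cons_val_zero,
    Matrix.cons_val_one, rotDeriv₂, Fin.sum_univ_three]
  generalize fderiv ℝ (fderiv ℝ (radialExtension φ)) x.1 = B at *
  generalize fderiv ℝ (radialExtension φ) x.1 = L at *
  set e : Fin 3 → EuclideanSpace ℝ (Fin 3) := fun i => EuclideanSpace.single i (1 : ℝ) with he
  have hx : x.1 = x.1 0 • e 0 + x.1 1 • e 1 + x.1 2 • e 2 := by
    ext k; fin_cases k <;> simp [he]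
  have h0 : rotGen 0 x.1 = -x.1 1 • e 0 + x.1 0 • e 1 := by
    ext k; fin_cases k <;> simp [he, rotGen_apply]
  have h1 : rotGen 1 x.1 = -x.1 2 • e 1 + x.1 1 • e 2 := by
    ext k; fin_cases k <;> simp [he, rotGen_apply]
  have h2 : rotGen 2 x.1 = -x.1 0 • e 2 + x.1 2 • e 0 := by
    ext k; fin_cases k <;> simp [he, rotGen_apply]
  have h00 : rotGen 0 (rotGen 0 x.1) = -x.1 0 • e 0 - x.1 1 • e 1 := by
    ext k; fin_cases k <;> simp [he, rotGen_apply]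
  have h11 : rotGen 1 (rotGen 1 x.1) = -x.1 1 • e 1 - x.1 2 • e 2 := by
    ext k; fin_cases k <;> simp [he, rotGen_apply]
  have h22 : rotGen 2 (rotGen 2 x.1) = -x.1 2 • e 2 - x.1 0 • e 0 := by
    ext k; fin_cases k <;> simp [he, rotGen_apply]
  change B (e 0) (e 0) + B (e 1) (e 1) + B (e 2) (e 2) = _
  rw [h00, h11, h22, h0, h1, h2]
  rw [hx] at hB hL
  simp only [map_add, map_sub, map_smul, add_apply, smul_apply,
    smul_eq_mul] at hB hL ⊢
  simp [he] at hB hL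
  simp only [he]
  linear_combination hB + 2 * hL - (B (EuclideanSpace.single 0 1) (EuclideanSpace.single 0 1) +
    B (EuclideanSpace.single 1 1) (EuclideanSpace.single 1 1) +
    B (EuclideanSpace.single 2 1) (EuclideanSpace.single 2 1)) * hn

/-- Rotational derivatives are unique, so explicitly computed ones may be used in place of those of
the radial extension. -/
lemma smoothLaplacian_eq_sum {φ : S2 → ℝ} (hφ : ContMDiff (𝓡 2) 𝓘(ℝ, ℝ) ∞ φ)
    {f g : Fin 3 → S2 → ℝ} (hf : ∀ a, IsRotDeriv a φ (f a)) (hg : ∀ a, IsRotDeriv a (f a) (g a))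
    (x : S2) : smoothLaplacian φ x = ∑ a, g a x := by
  rw [smoothLaplacian_eq_sum_rotDeriv₂ hφ]
  refine Finset.sum_congr rfl fun a _ => ?_
  have h1 := (isRotDeriv_rotDeriv hφ a).unique (hf a)
  have h2 := isRotDeriv_rotDeriv₂ hφ a
  rw [h1] at h2
  rw [h2.unique (hg a)]

/-! ### Legendre polynomials -/

open Polynomial in
-- The function `u = (x² - 1)^l` satisfies `(x² - 1) u' = 2 l x u`; this is the `(k+1)`-st
-- derivative of that equation.
lemma iterate_derivative_sq_sub_one_pow (l k : ℕ) :
    (X ^ 2 - 1 : ℝ[X]) * derivative^[k + 2] ((X ^ 2 - 1) ^ l) +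
      C (2 * ((k : ℝ) + 1 - l)) * X * derivative^[k + 1] ((X ^ 2 - 1) ^ l) +
      C (((k : ℝ) + 1) * (k - 2 * l)) * derivative^[k] ((X ^ 2 - 1) ^ l) = 0 := by
  induction k with
  | zero =>
    have h1 : (X ^ 2 - 1 : ℝ[X]) * derivative ((X ^ 2 - 1) ^ l) =
        C (2 * (l : ℝ)) * X * (X ^ 2 - 1) ^ l := by
      rcases l with _ | l
      · simp
      · rw [derivative_pow_succ]
        simp only [derivative_sub, derivative_X_pow, derivative_one, map_mul, map_add, map_natCast,
          Nat.cast_add, Nat.cast_one, map_one, map_ofNat]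
        simp
        ring
    have h2 := congrArg derivative h1
    simp only [derivative_mul, derivative_sub, derivative_X_pow, derivative_one, derivative_X,
      map_mul, map_ofNat, map_natCast] at h2
    simp only [Function.iterate_succ, Function.iterate_zero, Function.comp, id, Nat.cast_zero,
      map_mul, map_sub, map_add, map_zero, map_one, map_ofNat, map_natCast]
    simp at h2 ⊢
    linear_combination h2
  | succ k ih =>
    have h2 := congrArg derivative ih
    simp only [derivative_mul, derivative_add, derivative_sub, derivative_X_pow, derivative_one,
      derivative_C, derivative_X, derivative_zero, ← Function.iterate_succ_apply'] at h2
    simp only [map_mul, map_sub, map_add, map_one, map_ofNat, map_natCast, Nat.cast_add,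
      Nat.cast_one] at h2 ⊢
    simp at h2 ⊢
    linear_combination h2

open Polynomial in
/-- The differential equation of the derivatives of the Legendre polynomials. -/
lemma legendrePoly_ode (l m : ℕ) :
    (1 - X ^ 2 : ℝ[X]) * derivative^[m + 2] (legendrePoly l) -
      C (2 * ((m : ℝ) + 1)) * X * derivative^[m + 1] (legendrePoly l) +
      C (((l : ℝ) - m) * (l + m + 1)) * derivative^[m] (legendrePoly l) = 0 := by
  have h := iterate_derivative_sq_sub_one_pow l (m + l)
  simp only [legendrePoly, iterate_derivative_C_mul, ← Function.iterate_add_apply]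
  rw [show m + 2 + l = m + l + 2 by ring, show m + 1 + l = m + l + 1 by ring]
  simp only [map_mul, map_sub, map_add, map_one, map_ofNat, map_natCast, Nat.cast_add] at h ⊢
  linear_combination (-C (1 / (2 ^ l * (l.factorial : ℝ)))) * h

open Polynomial in
lemma coeff_iterate_derivative_legendrePoly (m i : ℕ) :
    (derivative^[m] (legendrePoly (m + i))).coeff i =
      (2 * (m + i)).factorial / (2 ^ (m + i) * (m + i).factorial * i.factorial : ℝ) := by
  have hmonic : (X ^ 2 - 1 : ℝ[X]).Monic := by
    have := monic_X_pow_sub_C (1 : ℝ) (two_ne_zero)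
    simpa using this
  have hdeg : (X ^ 2 - 1 : ℝ[X]).natDegree = 2 := by
    have := natDegree_X_pow_sub_C (n := 2) (r := (1 : ℝ))
    simpa using this
  have hlead : ((X ^ 2 - 1 : ℝ[X]) ^ (m + i)).coeff (2 * (m + i)) = 1 := by
    have h := (hmonic.pow (m + i)).coeff_natDegree
    rwa [hmonic.natDegree_pow, hdeg, mul_comm] at h
  rw [legendrePoly, iterate_derivative_C_mul, ← Function.iterate_add_apply, coeff_C_mul,
    coeff_iterate_derivative, show i + (m + (m + i)) = 2 * (m + i) by ring, hlead, nsmul_eq_mul,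
    mul_one, Nat.descFactorial_eq_div (by omega), show 2 * (m + i) - (m + (m + i)) = i by omega,
    Nat.cast_div (Nat.factorial_dvd_factorial (by omega)) (by positivity)]
  field_simp

open Polynomial in
lemma natDegree_iterate_derivative_legendrePoly_le (m i : ℕ) :
    (derivative^[m] (legendrePoly (m + i))).natDegree ≤ i := by
  have hdeg : (X ^ 2 - 1 : ℝ[X]).natDegree = 2 := by
    have := natDegree_X_pow_sub_C (n := 2) (r := (1 : ℝ))
    simpa using this
  rw [legendrePoly, iterate_derivative_C_mul, ← Function.iterate_add_apply]
  refine (natDegree_C_mul_le _ _).trans ((natDegree_iterate_derivative _ _).trans ?_)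
  have := natDegree_pow_le (p := (X ^ 2 - 1 : ℝ[X])) (n := m + i)
  rw [hdeg] at this
  omega

open Polynomial in
lemma degree_iterate_derivative_legendrePoly (m i : ℕ) :
    (derivative^[m] (legendrePoly (m + i))).degree = i := by
  refine degree_eq_of_le_of_coeff_ne_zero
    (natDegree_le_iff_degree_le.mp (natDegree_iterate_derivative_legendrePoly_le m i)) ?_
  rw [coeff_iterate_derivative_legendrePoly]
  positivity

open Polynomial in
lemma iterate_derivative_legendrePoly_self (l : ℕ) :
    derivative^[l] (legendrePoly l) = C ((2 * l).factorial / (2 ^ l * l.factorial : ℝ)) := by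
  have h1 := eq_C_of_natDegree_le_zero (natDegree_iterate_derivative_legendrePoly_le l 0)
  rw [coeff_iterate_derivative_legendrePoly] at h1
  simpa using h1

open Polynomial in
/-- The `m`-th derivatives of the Legendre polynomials form a sequence of polynomials with one
element in each degree. -/
def legendreSequence (m : ℕ) : Polynomial.Sequence ℝ where
  elems' i := derivative^[m] (legendrePoly (m + i))
  degree_eq' i := degree_iterate_derivative_legendrePoly m i

open Polynomial in
-- One polynomial in each degree. For completeness this means that, at fixed order `m`, the
-- harmonics reach every polynomial in `x₃`.
lemma span_iterate_derivative_legendrePoly (m : ℕ) :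
    Submodule.span ℝ (Set.range fun i => derivative^[m] (legendrePoly (m + i))) = ⊤ := by
  refine (legendreSequence m).span fun i => ?_
  exact (leadingCoeff_ne_zero.mpr ((legendreSequence m).ne_zero i)).isUnit

/-! ### Integrals of functions of the third coordinate -/

open Polynomial in
lemma continuous_eval_coord (p : ℝ[X]) (k : Fin 3) : Continuous fun x : S2 => p.eval (x.1 k) :=
  p.continuous.comp ((EuclideanSpace.proj k : EuclideanSpace ℝ (Fin 3) →L[ℝ] ℝ).continuous.comp
    continuous_subtype_val)

lemma continuous_coord (k : Fin 3) : Continuous fun x : S2 => x.1 k :=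
  (EuclideanSpace.proj k : EuclideanSpace ℝ (Fin 3) →L[ℝ] ℝ).continuous.comp continuous_subtype_val

lemma sum_sq_coord (x : S2) : x.1 0 ^ 2 + x.1 1 ^ 2 + x.1 2 ^ 2 = 1 := by
  have h := EuclideanSpace.norm_sq_eq x.1
  rw [mem_sphere_zero_iff_norm.mp x.2] at h
  simp only [Fin.sum_univ_three, Real.norm_eq_abs, sq_abs] at h
  linarith

open Polynomial in
/-- The integral of `p(x₃)` over the sphere. -/
def zonalIntegral (p : ℝ[X]) : ℝ := ∫ x : S2, p.eval (x.1 2) ∂area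

open Polynomial in
lemma zonalIntegral_add (p q : ℝ[X]) :
    zonalIntegral (p + q) = zonalIntegral p + zonalIntegral q := by
  simp only [zonalIntegral, eval_add]
  exact integral_add (integrable_of_continuous (continuous_eval_coord p 2))
    (integrable_of_continuous (continuous_eval_coord q 2))

open Polynomial in
lemma zonalIntegral_C_mul (c : ℝ) (p : ℝ[X]) : zonalIntegral (C c * p) = c * zonalIntegral p := by
  simp only [zonalIntegral, eval_mul, eval_C]
  exact integral_const_mul c _

open Polynomial in
lemma isRotDeriv_eval_coord (p : ℝ[X]) (a k : Fin 3) :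
    IsRotDeriv a (fun x : S2 => p.eval (x.1 k))
      (fun x => (derivative p).eval (x.1 k) * rotGen a x.1 k) := by
  intro x t
  exact (p.hasDerivAt _).comp t (isRotDeriv_coord a k x t)

open Polynomial in
-- A substitute for Archimedes' formula, with no change of variables. The integrand is the
-- derivative of `x₂ q(x₃)` along rotation `1` minus that of `x₁ q(x₃)` along rotation `2`
-- (coordinates counted from one), by `x₁² + x₂² = 1 - x₃²`.
lemma zonalIntegral_derivative (q : ℝ[X]) : zonalIntegral (derivative ((1 - X ^ 2) * q)) = 0 := by
  have d1 : IsRotDeriv 1 (fun x : S2 => x.1 1 * q.eval (x.1 2))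
      (fun x => -x.1 2 * q.eval (x.1 2) + x.1 1 * ((derivative q).eval (x.1 2) * x.1 1)) := by
    have h := (isRotDeriv_coord 1 1).mul (isRotDeriv_eval_coord q 1 2)
    simpa [rotGen_apply] using h
  have d2 : IsRotDeriv 2 (fun x : S2 => x.1 0 * q.eval (x.1 2))
      (fun x => x.1 2 * q.eval (x.1 2) + x.1 0 * ((derivative q).eval (x.1 2) * -x.1 0)) := by
    have h := (isRotDeriv_coord 2 0).mul (isRotDeriv_eval_coord q 2 2)
    simpa [rotGen_apply] using h
  have c0 := continuous_coord 0
  have c1 := continuous_coord 1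
  have c2 := continuous_coord 2
  have cq := continuous_eval_coord q 2
  have cq' := continuous_eval_coord (derivative q) 2
  have k1 : Continuous fun x : S2 =>
      -x.1 2 * q.eval (x.1 2) + x.1 1 * ((derivative q).eval (x.1 2) * x.1 1) :=
    (c2.neg.mul cq).add (c1.mul (cq'.mul c1))
  have k2 : Continuous fun x : S2 =>
      x.1 2 * q.eval (x.1 2) + x.1 0 * ((derivative q).eval (x.1 2) * -x.1 0) :=
    (c2.mul cq).add (c0.mul (cq'.mul c0.neg))
  have i1 := d1.integral_eq_zero (c1.mul cq) k1
  have i2 := d2.integral_eq_zero (c0.mul cq) k2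
  have h := integral_sub (integrable_of_continuous k1) (integrable_of_continuous k2)
  rw [i1, i2, sub_zero] at h
  rw [zonalIntegral, ← h]
  refine integral_congr_ae (ae_of_all _ fun x => ?_)
  simp only [derivative_mul, derivative_sub, derivative_one, derivative_X_pow, eval_add, eval_mul,
    eval_sub, eval_zero, eval_one, eval_pow, eval_X, eval_C, Nat.cast_ofNat]
  norm_num
  linear_combination (-(derivative q).eval (x.1 2)) * sum_sq_coord x

lemma area_real_univ : area.real Set.univ = 4 * Real.pi := by
  rw [area, Measure.toSphere_real_apply_univ, finrank_euclideanSpace_fin, Measure.real,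
    EuclideanSpace.volume_ball_fin_three]
  rw [ENNReal.toReal_mul, ENNReal.toReal_ofReal (by positivity)]
  simp
  ring

open Polynomial in
lemma zonalIntegral_one : zonalIntegral 1 = 4 * Real.pi := by
  simp only [zonalIntegral, eval_one, integral_const, smul_eq_mul, mul_one]
  exact area_real_univ

open Polynomial in
lemma zonalIntegral_one_sub_sq_pow (l : ℕ) :
    zonalIntegral ((1 - X ^ 2) ^ l) =
      4 * Real.pi * (2 ^ l * l.factorial : ℝ) ^ 2 / (2 * l + 1).factorial := by
  induction l with
  | zero => simp [zonalIntegral_one]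
  | succ l ih =>
    -- This choice gives the Beta-type recursion `(2l+3) J_(l+1) = 2(l+1) J_l`.
    have h := zonalIntegral_derivative (X * (1 - X ^ 2) ^ l)
    have e : derivative ((1 - X ^ 2) * (X * (1 - X ^ 2) ^ l) : ℝ[X]) =
        C (2 * (l : ℝ) + 3) * (1 - X ^ 2) ^ (l + 1) + C (-(2 * ((l : ℝ) + 1))) * (1 - X ^ 2) ^ l := by
      rw [show ((1 - X ^ 2) * (X * (1 - X ^ 2) ^ l) : ℝ[X]) = X * (1 - X ^ 2) ^ (l + 1) by ring,
        derivative_mul, derivative_pow_succ]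
      simp only [derivative_sub, derivative_X_pow, derivative_one, derivative_X, map_mul, map_add,
        map_natCast, map_neg, map_one, map_ofNat]
      simp
      ring
    rw [e, zonalIntegral_add, zonalIntegral_C_mul, zonalIntegral_C_mul, ih] at h
    have h3 : (2 * (l : ℝ) + 3) ≠ 0 := by positivity
    apply mul_left_cancel₀ h3
    rw [eq_neg_of_add_eq_zero_left h, show 2 * (l + 1) + 1 = 2 * l + 1 + 1 + 1 by ring,
      Nat.factorial_succ (2 * l + 1 + 1), Nat.factorial_succ (2 * l + 1), Nat.factorial_succ l]
    push_cast
    field_simp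
    ring

open Polynomial in
-- Integration by parts; the Legendre equation says `((1-x²)^(m+1) p')' = -(l-m)(l+m+1) (1-x²)^m p`
-- for the `m`-th derivative `p` of the Legendre polynomial.
lemma zonalIntegral_legendre_succ (l m : ℕ) (r : ℝ[X]) :
    zonalIntegral ((1 - X ^ 2) ^ (m + 1) * (derivative^[m + 1] (legendrePoly l) *
        derivative^[m + 1] r)) =
      (l - m) * (l + m + 1) *
        zonalIntegral ((1 - X ^ 2) ^ m * (derivative^[m] (legendrePoly l) * derivative^[m] r)) := by
  have h := zonalIntegral_derivative ((1 - X ^ 2) ^ m *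
    (derivative^[m + 1] (legendrePoly l) * derivative^[m] r))
  have e : derivative ((1 - X ^ 2) * ((1 - X ^ 2) ^ m *
      (derivative^[m + 1] (legendrePoly l) * derivative^[m] r))) =
      (1 - X ^ 2) ^ (m + 1) * (derivative^[m + 1] (legendrePoly l) * derivative^[m + 1] r) +
      C (-(((l : ℝ) - m) * (l + m + 1))) *
        ((1 - X ^ 2) ^ m * (derivative^[m] (legendrePoly l) * derivative^[m] r)) := by
    have ode := legendrePoly_ode l m
    have s1 : derivative (derivative^[m + 1] (legendrePoly l)) =
      derivative^[m + 2] (legendrePoly l) := (Function.iterate_succ_apply' _ _ _).symm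
    have s2 : derivative (derivative^[m] r) = derivative^[m + 1] r :=
      (Function.iterate_succ_apply' _ _ _).symm
    rw [← mul_assoc, ← pow_succ', derivative_mul, derivative_mul, derivative_pow_succ, s1, s2]
    clear h s1 s2
    generalize derivative^[m + 2] (legendrePoly l) = p2 at ode ⊢
    generalize derivative^[m + 1] (legendrePoly l) = p1 at ode ⊢
    generalize derivative^[m] (legendrePoly l) = p0 at ode ⊢
    generalize derivative^[m + 1] r = r1
    generalize derivative^[m] r = r0
    simp only [map_mul, map_add, map_natCast, map_neg, map_one, map_ofNat, map_sub] at ode ⊢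
    simp
    linear_combination ((1 - X ^ 2) ^ m * r0) * ode
  rw [e, zonalIntegral_add, zonalIntegral_C_mul] at h
  linarith

open Polynomial in
-- The integral is symmetric in `l` and `l'`, while the factors `(l-m)(l+m+1)` and `(l'-m)(l'+m+1)`
-- differ.
lemma zonalIntegral_legendre_of_ne {l l' : ℕ} (h : l ≠ l') (m : ℕ) :
    zonalIntegral ((1 - X ^ 2) ^ m * (derivative^[m] (legendrePoly l) *
      derivative^[m] (legendrePoly l'))) = 0 := by
  have h1 := zonalIntegral_legendre_succ l m (legendrePoly l')
  have h2 := zonalIntegral_legendre_succ l' m (legendrePoly l)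
  rw [mul_comm (derivative^[m + 1] (legendrePoly l')), mul_comm (derivative^[m] (legendrePoly l')),
    h1] at h2
  have h3 : (((l : ℝ) - l') * (l + l' + 1)) * zonalIntegral ((1 - X ^ 2) ^ m *
      (derivative^[m] (legendrePoly l) * derivative^[m] (legendrePoly l'))) = 0 := by
    linear_combination h2
  refine (mul_eq_zero.mp h3).resolve_left (mul_ne_zero ?_ ?_)
  · exact sub_ne_zero.mpr (by exact_mod_cast h)
  · positivity

open Polynomial in
-- Induction on `j = l - m` at fixed degree: the order is raised until it equals the degree, where
-- the derivative is constant and `zonalIntegral_one_sub_sq_pow` applies.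
lemma zonalIntegral_legendre_self (m j : ℕ) :
    zonalIntegral ((1 - X ^ 2) ^ m * (derivative^[m] (legendrePoly (m + j)) *
      derivative^[m] (legendrePoly (m + j)))) =
      4 * Real.pi / (2 * (m + j) + 1) * ((m + j + m).factorial / j.factorial) := by
  induction j generalizing m with
  | zero =>
    rw [add_zero, iterate_derivative_legendrePoly_self, ← C_mul, mul_comm, zonalIntegral_C_mul,
      zonalIntegral_one_sub_sq_pow, Nat.factorial_succ (2 * m), ← two_mul]
    push_cast
    field_simp
    simp
  | succ j ih =>
    have h := zonalIntegral_legendre_succ (m + 1 + j) m (legendrePoly (m + 1 + j))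
    rw [ih (m + 1)] at h
    rw [show m + (j + 1) = m + 1 + j by ring]
    have hne : (((m + 1 + j : ℕ) : ℝ) - m) * ((m + 1 + j : ℕ) + m + 1) ≠ 0 := by
      apply mul_ne_zero
      · push_cast; ring_nf; positivity
      · positivity
    apply mul_left_cancel₀ hne
    rw [← h, show m + 1 + j + (m + 1) = m + 1 + j + m + 1 by ring,
      Nat.factorial_succ (m + 1 + j + m), Nat.factorial_succ j]
    push_cast
    field_simp
    ring

/-! ### Spherical harmonics as eigenfunctions -/

/-- The function `x₁ + i x₂` on the sphere. -/
def azimuth (x : S2) : ℂ := (x.1 0 : ℂ) + Complex.I * (x.1 1 : ℂ)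

/-- The function `p(x₃)` on the sphere. -/
def zonal (p : Polynomial ℝ) (x : S2) : ℂ := ((p.eval (x.1 2) : ℝ) : ℂ)

lemma continuous_azimuth : Continuous azimuth :=
  (Complex.continuous_ofReal.comp (continuous_coord 0)).add
    (continuous_const.mul (Complex.continuous_ofReal.comp (continuous_coord 1)))

lemma continuous_zonal (p : Polynomial ℝ) : Continuous (zonal p) :=
  Complex.continuous_ofReal.comp (continuous_eval_coord p 2)

lemma sum_sq_coord_complex (x : S2) :
    ((x.1 0 : ℂ)) ^ 2 + (x.1 1 : ℂ) ^ 2 + (x.1 2 : ℂ) ^ 2 = 1 := by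
  have h := congrArg Complex.ofReal (sum_sq_coord x)
  push_cast at h
  exact h

lemma azimuth_mul_conj (x : S2) :
    azimuth x * (starRingEnd ℂ) (azimuth x) = 1 - (x.1 2 : ℂ) ^ 2 := by
  have h : ((x.1 0 : ℂ)) ^ 2 + (x.1 1 : ℂ) ^ 2 + (x.1 2 : ℂ) ^ 2 = 1 := sum_sq_coord_complex x
  simp only [azimuth, map_add, map_mul, Complex.conj_ofReal, Complex.conj_I]
  linear_combination h - (x.1 1 : ℂ) ^ 2 * Complex.I_sq

lemma IsRotDeriv.congr {F : Type*} [NormedAddCommGroup F] [NormedSpace ℝ F] {a : Fin 3}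
    {f g g' : S2 → F} (h : IsRotDeriv a f g) (e : ∀ x, g x = g' x) : IsRotDeriv a f g' := by
  rwa [show g' = g from funext fun x => (e x).symm]

lemma isRotDeriv_azimuth (a : Fin 3) :
    IsRotDeriv a azimuth (fun x => (rotGen a x.1 0 : ℂ) + Complex.I * (rotGen a x.1 1 : ℂ)) :=
  ((isRotDeriv_coord a 0).clm_comp Complex.ofRealCLM).add
    (((isRotDeriv_coord a 1).clm_comp Complex.ofRealCLM).const_mul Complex.I)

lemma isRotDeriv_zonal (a : Fin 3) (p : Polynomial ℝ) :
    IsRotDeriv a (zonal p)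
      (fun x => zonal (Polynomial.derivative p) x * (rotGen a x.1 2 : ℂ)) :=
  ((isRotDeriv_eval_coord p a 2).clm_comp Complex.ofRealCLM).congr fun x => by simp [zonal]

/-- An eigenfunction of the sum of the squares of the infinitesimal rotations. -/
def IsRotEigen {F : Type*} [NormedAddCommGroup F] [NormedSpace ℝ F] (c : ℝ) (Y : S2 → F) : Prop :=
  ∃ f g : Fin 3 → S2 → F, Continuous Y ∧ (∀ a, Continuous (f a)) ∧ (∀ a, Continuous (g a)) ∧
    (∀ a, IsRotDeriv a Y (f a)) ∧ (∀ a, IsRotDeriv a (f a) (g a)) ∧ ∀ x, ∑ a, g a x = c • Y x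

lemma IsRotEigen.clm_comp {F G : Type*} [NormedAddCommGroup F] [NormedSpace ℝ F]
    [NormedAddCommGroup G] [NormedSpace ℝ G] {c : ℝ} {Y : S2 → F} (h : IsRotEigen c Y)
    (L : F →L[ℝ] G) : IsRotEigen c (fun x => L (Y x)) := by
  obtain ⟨f, g, hY, hf, hg, hYf, hfg, hs⟩ := h
  refine ⟨fun a x => L (f a x), fun a x => L (g a x), L.continuous.comp hY,
    fun a => L.continuous.comp (hf a), fun a => L.continuous.comp (hg a),
    fun a => (hYf a).clm_comp L, fun a => (hfg a).clm_comp L, fun x => ?_⟩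
  rw [← map_sum, hs, map_smul]

open Polynomial in
-- With `w = x₁ + i x₂`, `z = x₃`, and `u`, `v` the derivatives of `w`, `z` along a rotation,
-- summing over the rotations gives `∑ u² = -w²`, `∑ u' = -2w`, `∑ u v = -z w`, `∑ v² = 1 - z²`, `∑
-- v' = -2z`. The second derivatives of `w^m p(z)` then add up to `w^m` times the left side of `hp`.
lemma isRotEigen_azimuth_pow_mul_zonal (m : ℕ) (p : ℝ[X]) (c : ℝ)
    (hp : (1 - X ^ 2) * derivative (derivative p) - C (2 * ((m : ℝ) + 1)) * X * derivative p -
      C ((m : ℝ) * (m + 1)) * p = C c * p) :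
    IsRotEigen c (fun x => azimuth x ^ m * zonal p x) := by
  set f0 : S2 → ℂ := fun x => azimuth x ^ m
  set f1 : S2 → ℂ := fun x => m * azimuth x ^ (m - 1) with hf1
  set f2 : S2 → ℂ := fun x => m * (((m - 1 : ℕ) : ℂ) * azimuth x ^ (m - 1 - 1))
  set p0 := zonal p
  set p1 := zonal (derivative p)
  set p2 := zonal (derivative (derivative p))
  have cw := continuous_azimuth
  have c0 : Continuous f0 := cw.pow m
  have c1 : Continuous f1 := continuous_const.mul (cw.pow _)
  have c2 : Continuous f2 := continuous_const.mul (continuous_const.mul (cw.pow _))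
  have cp0 : Continuous p0 := continuous_zonal _
  have cp1 : Continuous p1 := continuous_zonal _
  have cp2 : Continuous p2 := continuous_zonal _
  have cx : ∀ k : Fin 3, Continuous fun x : S2 => (x.1 k : ℂ) :=
    fun k => Complex.continuous_ofReal.comp (continuous_coord k)
  have dx : ∀ a k : Fin 3, IsRotDeriv a (fun x : S2 => (x.1 k : ℂ))
      (fun x => (rotGen a x.1 k : ℂ)) :=
    fun a k => (isRotDeriv_coord a k).clm_comp Complex.ofRealCLM
  have key : ∀ (a : Fin 3) (u v u' v' : S2 → ℂ), Continuous u → Continuous v → Continuous u' →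
      Continuous v' →
      (∀ x, (rotGen a x.1 0 : ℂ) + Complex.I * (rotGen a x.1 1 : ℂ) = u x) →
      (∀ x, (rotGen a x.1 2 : ℂ) = v x) → IsRotDeriv a u u' → IsRotDeriv a v v' →
      ∃ f g : S2 → ℂ, Continuous f ∧ Continuous g ∧ IsRotDeriv a (fun x => f0 x * p0 x) f ∧
        IsRotDeriv a f g ∧ ∀ x, g x = f2 x * u x ^ 2 * p0 x + f1 x * u' x * p0 x +
        2 * (f1 x * u x * p1 x * v x) + f0 x * p2 x * v x ^ 2 + f0 x * p1 x * v' x := by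
    intro a u v u' v' cu cv cu' cv' hu hv du dv
    have dw : IsRotDeriv a azimuth u := (isRotDeriv_azimuth a).congr hu
    have d0 : IsRotDeriv a f0 (fun x => f1 x * u x) := dw.pow m
    have d1 : IsRotDeriv a f1 (fun x => f2 x * u x) :=
      ((dw.pow (m - 1)).const_mul (m : ℂ)).congr fun x => by simp only [f2]; ring
    have e0 : IsRotDeriv a p0 (fun x => p1 x * v x) :=
      (isRotDeriv_zonal a p).congr fun x => by rw [hv x]
    have e1 : IsRotDeriv a p1 (fun x => p2 x * v x) :=
      (isRotDeriv_zonal a (derivative p)).congr fun x => by rw [hv x]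
    refine ⟨fun x => f1 x * u x * p0 x + f0 x * (p1 x * v x), fun x => f2 x * u x ^ 2 * p0 x + f1 x * u' x * p0 x +
        2 * (f1 x * u x * p1 x * v x) + f0 x * p2 x * v x ^ 2 + f0 x * p1 x * v' x,
      by fun_prop, by fun_prop, d0.mul e0, ?_, fun x => rfl⟩
    exact (((d1.mul du).mul e0).add (d0.mul (e1.mul dv))).congr fun x => by ring
  obtain ⟨F0, G0, cF0, cG0, hF0, hG0, e0⟩ := key 0 (fun x => Complex.I * azimuth x) (fun _ => 0)
    (fun x => -azimuth x) (fun _ => 0) (by fun_prop) (by fun_prop) (by fun_prop) (by fun_prop)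
    (fun x => by simp [rotGen_apply, azimuth]; linear_combination -(x.1 1 : ℂ) * Complex.I_sq)
    (fun x => by simp [rotGen_apply])
    (((isRotDeriv_azimuth 0).const_mul Complex.I).congr fun x => by
      simp [rotGen_apply, azimuth]; linear_combination (x.1 0 : ℂ) * Complex.I_sq)
    (isRotDeriv_const 0 0)
  obtain ⟨F1, G1, cF1, cG1, hF1, hG1, e1⟩ := key 1 (fun x => -Complex.I * (x.1 2 : ℂ))
    (fun x => (x.1 1 : ℂ)) (fun x => -Complex.I * (x.1 1 : ℂ)) (fun x => -(x.1 2 : ℂ))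
    (by fun_prop) (by fun_prop) (by fun_prop) (by fun_prop)
    (fun x => by simp [rotGen_apply]) (fun x => by simp [rotGen_apply])
    (((dx 1 2).const_mul (-Complex.I)).congr fun x => by simp [rotGen_apply])
    ((dx 1 1).congr fun x => by simp [rotGen_apply])
  obtain ⟨F2, G2, cF2, cG2, hF2, hG2, e2⟩ := key 2 (fun x => (x.1 2 : ℂ))
    (fun x => -(x.1 0 : ℂ)) (fun x => -(x.1 0 : ℂ)) (fun x => -(x.1 2 : ℂ))
    (by fun_prop) (by fun_prop) (by fun_prop) (by fun_prop)
    (fun x => by simp [rotGen_apply]) (fun x => by simp [rotGen_apply])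
    ((dx 2 2).congr fun x => by simp [rotGen_apply])
    (((dx 2 0).const_mul (-1)).congr (fun x => by simp [rotGen_apply]) |> fun h => by
      simpa using h)
  refine ⟨![F0, F1, F2], ![G0, G1, G2], c0.mul cp0, ?_, ?_, ?_, ?_, ?_⟩
  · exact Fin.forall_fin_succ.mpr ⟨cF0, Fin.forall_fin_succ.mpr ⟨cF1, Fin.forall_fin_one.mpr cF2⟩⟩
  · exact Fin.forall_fin_succ.mpr ⟨cG0, Fin.forall_fin_succ.mpr ⟨cG1, Fin.forall_fin_one.mpr cG2⟩⟩
  · exact Fin.forall_fin_succ.mpr ⟨hF0, Fin.forall_fin_succ.mpr ⟨hF1, Fin.forall_fin_one.mpr hF2⟩⟩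
  · exact Fin.forall_fin_succ.mpr ⟨hG0, Fin.forall_fin_succ.mpr ⟨hG1, Fin.forall_fin_one.mpr hG2⟩⟩
  · intro x
    have hs : ((x.1 0 : ℂ)) ^ 2 + (x.1 1 : ℂ) ^ 2 + (x.1 2 : ℂ) ^ 2 = 1 := sum_sq_coord_complex x
    have ode : (1 - (x.1 2 : ℂ) ^ 2) * p2 x - 2 * ((m : ℂ) + 1) * (x.1 2 : ℂ) * p1 x -
        (m : ℂ) * (m + 1) * p0 x = c * p0 x := by
      have h := congrArg (fun q => ((q.eval (x.1 2) : ℝ) : ℂ)) hp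
      simp only [eval_sub, eval_mul, eval_one, eval_pow, eval_X, eval_C] at h
      push_cast at h
      exact h
    -- The truncated exponents `m - 1` and `m - 1 - 1` are harmless, because their coefficients
    -- vanish for small `m`.
    have h1 : f1 x * azimuth x = m * f0 x := by
      rcases m with _ | m
      · simp [hf1]
      · simp only [f1, f0, Nat.add_sub_cancel]; ring
    have h2 : f2 x * azimuth x ^ 2 = m * (m - 1) * f0 x := by
      rcases m with _ | _ | m
      · simp [f2]
      · simp [f2]
      · simp only [f2, f0, Nat.add_sub_cancel]; push_cast; ring
    have hw : azimuth x = (x.1 0 : ℂ) + Complex.I * (x.1 1 : ℂ) := rfl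
    rw [Fin.sum_univ_three, Complex.real_smul]
    simp only [Matrix.cons_val_zero, Matrix.cons_val_one, Matrix.cons_val, e0, e1, e2]
    change _ = (c : ℂ) * (f0 x * p0 x)
    linear_combination (f0 x) * ode + (f0 x * p2 x) * hs - p0 x * h2 +
      (f2 x * azimuth x ^ 2 * p0 x + f2 x * (x.1 2 : ℂ) ^ 2 * p0 x) * Complex.I_sq -
      2 * p0 x * h1 - 2 * (x.1 2 : ℂ) * p1 x * h1 +
      (f1 x * p0 x + 2 * f1 x * (x.1 2 : ℂ) * p1 x) * hw

/-! ### Regularity and eigenvalue equation of the spherical harmonics -/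

/-- The normalization factor of the spherical harmonics, including the Condon–Shortley phase. -/
def sphericalFactor (l m : ℕ) : ℝ :=
  (-1) ^ m * √((2 * l + 1) / (4 * Real.pi) *
      (((l - m).factorial : ℝ) / ((l + m).factorial : ℝ)))

lemma sphericalHarmonicNonneg_eq (l m : ℕ) (x : S2) :
    sphericalHarmonicNonneg l m x = (sphericalFactor l m : ℂ) *
      (azimuth x ^ m * zonal (Polynomial.derivative^[m] (legendrePoly l)) x) := by
  rw [sphericalHarmonicNonneg, sphericalFactor, azimuth, zonal]
  push_cast
  ring

lemma sphericalFactor_ne_zero (l m : ℕ) : sphericalFactor l m ≠ 0 := by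
  have := Real.pi_pos
  have h : 0 < √((2 * l + 1) / (4 * Real.pi) *
      (((l - m).factorial : ℝ) / ((l + m).factorial : ℝ))) := Real.sqrt_pos.mpr (by positivity)
  exact mul_ne_zero (pow_ne_zero _ (by norm_num)) h.ne'

lemma sphericalFactor_sq (m j : ℕ) : sphericalFactor (m + j) m ^ 2 =
    (2 * (m + j) + 1) / (4 * Real.pi) * ((j.factorial : ℝ) / ((m + j + m).factorial : ℝ)) := by
  have := Real.pi_pos
  rw [sphericalFactor, mul_pow, ← pow_mul, mul_comm m 2, pow_mul, Real.sq_sqrt (by positivity),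
    Nat.add_sub_cancel_left]
  push_cast
  norm_num

lemma sphericalHarmonic_natCast (l m : ℕ) (x : S2) :
    sphericalHarmonic l m x = sphericalHarmonicNonneg l m x := by
  rw [sphericalHarmonic, if_pos (by omega), Int.natAbs_natCast]

lemma sphericalHarmonic_neg_natCast (l : ℕ) {m : ℕ} (hm : m ≠ 0) (x : S2) :
    sphericalHarmonic l (-m) x =
      (-1) ^ m * (starRingEnd ℂ) (sphericalHarmonicNonneg l m x) := by
  rw [sphericalHarmonic, if_neg (by omega), Int.natAbs_neg, Int.natAbs_natCast]

lemma int_cases_neg (m : ℤ) : (∃ n : ℕ, m = n) ∨ ∃ n : ℕ, n ≠ 0 ∧ m = -n := by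
  rcases le_or_gt 0 m with h | h
  · exact Or.inl ⟨m.toNat, by omega⟩
  · exact Or.inr ⟨(-m).toNat, by omega, by omega⟩

open Polynomial in
lemma isRotEigen_sphericalHarmonicNonneg (l m : ℕ) :
    IsRotEigen (-(l * (l + 1))) (sphericalHarmonicNonneg l m) := by
  have h := isRotEigen_azimuth_pow_mul_zonal m (derivative^[m] (legendrePoly l)) (-(l * (l + 1))) (by
    have ode := legendrePoly_ode l m
    rw [Function.iterate_succ_apply', Function.iterate_succ_apply'] at ode
    simp only [map_mul, map_add, map_sub, map_neg, map_one, map_ofNat, map_natCast] at ode ⊢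
    linear_combination ode)
  have h' := h.clm_comp (ContinuousLinearMap.mul ℝ ℂ (sphericalFactor l m : ℂ))
  rwa [show sphericalHarmonicNonneg l m = _ from funext (sphericalHarmonicNonneg_eq l m)]

lemma isRotEigen_sphericalHarmonic (l : ℕ) (m : ℤ) :
    IsRotEigen (-(l * (l + 1))) (sphericalHarmonic l m) := by
  rcases int_cases_neg m with ⟨n, rfl⟩ | ⟨n, hn, rfl⟩
  · rw [show sphericalHarmonic l n = _ from funext (sphericalHarmonic_natCast l n)]
    exact isRotEigen_sphericalHarmonicNonneg l n
  · rw [show sphericalHarmonic l (-n) = _ from funext (sphericalHarmonic_neg_natCast l hn)]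
    exact ((isRotEigen_sphericalHarmonicNonneg l n).clm_comp
      (Complex.conjCLE : ℂ →L[ℝ] ℂ)).clm_comp (ContinuousLinearMap.mul ℝ ℂ ((-1) ^ n))

lemma continuous_sphericalHarmonic (l : ℕ) (m : ℤ) : Continuous (sphericalHarmonic l m) := by
  obtain ⟨_, _, h, _⟩ := isRotEigen_sphericalHarmonic l m
  exact h

lemma contMDiff_of_contDiff {F : Type*} [NormedAddCommGroup F] [NormedSpace ℝ F]
    {f : EuclideanSpace ℝ (Fin 3) → F} (hf : ContDiff ℝ ∞ f) :
    ContMDiff (𝓡 2) 𝓘(ℝ, F) ∞ (fun x : S2 => f x.1) := by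
  have := finrank_three
  exact hf.contMDiff.comp (contMDiff_coe_sphere (n := 2))

lemma contMDiff_sphericalHarmonicNonneg (l m : ℕ) :
    ContMDiff (𝓡 2) 𝓘(ℝ, ℂ) ∞ (sphericalHarmonicNonneg l m) := by
  have hc : ∀ k : Fin 3, ContDiff ℝ ∞ fun y : EuclideanSpace ℝ (Fin 3) => y k := fun k =>
    (EuclideanSpace.proj k : EuclideanSpace ℝ (Fin 3) →L[ℝ] ℝ).contDiff
  have hcc : ∀ k : Fin 3, ContDiff ℝ ∞ fun y : EuclideanSpace ℝ (Fin 3) => (y k : ℂ) := fun k =>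
    Complex.ofRealCLM.contDiff.comp (hc k)
  have hp : ∀ p : Polynomial ℝ, ContDiff ℝ ∞
      fun y : EuclideanSpace ℝ (Fin 3) => ((p.eval (y 2) : ℝ) : ℂ) := fun p =>
    by
    have h : ContDiff ℝ ∞ fun x : ℝ => p.eval x := by simpa using p.contDiff_aeval (𝕜 := ℝ) ∞
    exact Complex.ofRealCLM.contDiff.comp (h.comp (hc 2))
  exact contMDiff_of_contDiff ((contDiff_const.mul
    (((hcc 0).add (contDiff_const.mul (hcc 1))).pow m)).mul (hp _))

lemma contMDiff_sphericalHarmonic (l : ℕ) (m : ℤ) :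
    ContMDiff (𝓡 2) 𝓘(ℝ, ℂ) ∞ (sphericalHarmonic l m) := by
  rcases int_cases_neg m with ⟨n, rfl⟩ | ⟨n, hn, rfl⟩
  · rw [show sphericalHarmonic l n = _ from funext (sphericalHarmonic_natCast l n)]
    exact contMDiff_sphericalHarmonicNonneg l n
  · rw [show sphericalHarmonic l (-n) = _ from funext (sphericalHarmonic_neg_natCast l hn)]
    exact (ContinuousLinearMap.mul ℝ ℂ ((-1) ^ n)).contDiff.contMDiff.comp
      ((Complex.conjCLE : ℂ →L[ℝ] ℂ).contDiff.contMDiff.comp (contMDiff_sphericalHarmonicNonneg l n))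

lemma contMDiff_clm_sphericalHarmonic (L : ℂ →L[ℝ] ℝ) (l : ℕ) (m : ℤ) :
    ContMDiff (𝓡 2) 𝓘(ℝ, ℝ) ∞ (fun x => L (sphericalHarmonic l m x)) :=
  L.contDiff.contMDiff.comp (contMDiff_sphericalHarmonic l m)

/-- Test functions for the weak Laplacian are real; `L` will be the real or the imaginary part. -/
lemma smoothLaplacian_clm_sphericalHarmonic (L : ℂ →L[ℝ] ℝ) (l : ℕ) (m : ℤ) (x : S2) :
    smoothLaplacian (fun x => L (sphericalHarmonic l m x)) x =
      -(l * (l + 1)) * L (sphericalHarmonic l m x) := by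
  obtain ⟨f, g, _, _, _, hf, hg, hs⟩ := (isRotEigen_sphericalHarmonic l m).clm_comp L
  rw [smoothLaplacian_eq_sum (contMDiff_clm_sphericalHarmonic L l m) hf hg, hs, smul_eq_mul]

lemma continuous_smoothLaplacian {φ : S2 → ℝ} (hφ : ContMDiff (𝓡 2) 𝓘(ℝ, ℝ) ∞ φ) :
    Continuous (smoothLaplacian φ) := by
  rw [show smoothLaplacian φ = _ from funext (smoothLaplacian_eq_sum_rotDeriv₂ hφ)]
  exact continuous_finsetSum _ fun a _ => continuous_rotDeriv₂ hφ a

lemma integral_smoothLaplacian_mul {φ : S2 → ℝ} (hφ : ContMDiff (𝓡 2) 𝓘(ℝ, ℝ) ∞ φ) {c : ℝ}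
    {Y : S2 → ℂ} (hY : IsRotEigen c Y) :
    ∫ x, (smoothLaplacian φ x : ℂ) * Y x ∂area = c * ∫ x, (φ x : ℂ) * Y x ∂area := by
  obtain ⟨f, g, cY, cf, cg, hf, hg, hs⟩ := hY
  have cφ : Continuous fun x => (φ x : ℂ) := Complex.continuous_ofReal.comp hφ.continuous
  have c1 : ∀ a, Continuous fun x => (rotDeriv a φ x : ℂ) :=
    fun a => Complex.continuous_ofReal.comp (continuous_rotDeriv hφ a)
  have c2 : ∀ a, Continuous fun x => (rotDeriv₂ a φ x : ℂ) :=
    fun a => Complex.continuous_ofReal.comp (continuous_rotDeriv₂ hφ a)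
  have h1 : ∀ a, IsRotDeriv a (fun x => (φ x : ℂ)) (fun x => (rotDeriv a φ x : ℂ)) :=
    fun a => (isRotDeriv_rotDeriv hφ a).clm_comp Complex.ofRealCLM
  have h2 : ∀ a, IsRotDeriv a (fun x => (rotDeriv a φ x : ℂ)) (fun x => (rotDeriv₂ a φ x : ℂ)) :=
    fun a => (isRotDeriv_rotDeriv₂ hφ a).clm_comp Complex.ofRealCLM
  have key : ∀ a, ∫ x, (rotDeriv₂ a φ x : ℂ) * Y x ∂area = ∫ x, (φ x : ℂ) * g a x ∂area := by
    intro a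
    rw [(h2 a).integral_mul (hf a) (c1 a) (c2 a) cY (cf a),
      (h1 a).integral_mul (hg a) cφ (c1 a) (cf a) (cg a), neg_neg]
  calc ∫ x, (smoothLaplacian φ x : ℂ) * Y x ∂area
      = ∫ x, ∑ a, (rotDeriv₂ a φ x : ℂ) * Y x ∂area := by
        refine integral_congr_ae (ae_of_all _ fun x => ?_)
        simp only [smoothLaplacian_eq_sum_rotDeriv₂ hφ, Complex.ofReal_sum, Finset.sum_mul]
    _ = ∑ a, ∫ x, (φ x : ℂ) * g a x ∂area := by
        have hi : ∀ a ∈ (Finset.univ : Finset (Fin 3)),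
            Integrable (fun x => (rotDeriv₂ a φ x : ℂ) * Y x) area :=
          fun a _ => integrable_of_continuous ((c2 a).mul cY)
        rw [integral_finsetSum _ hi]
        exact Finset.sum_congr rfl fun a _ => key a
    _ = ∫ x, (c : ℂ) * ((φ x : ℂ) * Y x) ∂area := by
        have hi : ∀ a ∈ (Finset.univ : Finset (Fin 3)),
            Integrable (fun x => (φ x : ℂ) * g a x) area :=
          fun a _ => integrable_of_continuous (cφ.mul (cg a))
        rw [← integral_finsetSum _ hi]
        refine integral_congr_ae (ae_of_all _ fun x => ?_)
        simp only [← Finset.mul_sum, hs, Complex.real_smul]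
        ring
    _ = _ := integral_const_mul _ _

/-! ### Orthonormality of the spherical harmonics -/

lemma isRotDeriv_zero_sphericalHarmonicNonneg (l m : ℕ) :
    IsRotDeriv 0 (sphericalHarmonicNonneg l m)
      (fun x => (m * Complex.I) * sphericalHarmonicNonneg l m x) := by
  rw [show sphericalHarmonicNonneg l m = _ from funext (sphericalHarmonicNonneg_eq l m)]
  have dw : IsRotDeriv 0 azimuth (fun x => Complex.I * azimuth x) :=
    (isRotDeriv_azimuth 0).congr fun x => by
      simp [rotGen_apply, azimuth]; linear_combination -(x.1 1 : ℂ) * Complex.I_sq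
  refine (((dw.pow m).mul (isRotDeriv_zonal 0 _)).const_mul _).congr fun x => ?_
  rcases m with _ | m
  · simp [rotGen_apply]
  · simp [rotGen_apply]
    ring

lemma isRotDeriv_zero_sphericalHarmonic (l : ℕ) (m : ℤ) :
    IsRotDeriv 0 (sphericalHarmonic l m)
      (fun x => (m * Complex.I) * sphericalHarmonic l m x) := by
  rcases int_cases_neg m with ⟨n, rfl⟩ | ⟨n, hn, rfl⟩
  · rw [show sphericalHarmonic l n = _ from funext (sphericalHarmonic_natCast l n)]
    exact isRotDeriv_zero_sphericalHarmonicNonneg l n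
  · rw [show sphericalHarmonic l (-n) = _ from funext (sphericalHarmonic_neg_natCast l hn)]
    refine (((isRotDeriv_zero_sphericalHarmonicNonneg l n).clm_comp
      (Complex.conjCLE : ℂ →L[ℝ] ℂ)).const_mul ((-1) ^ n)).congr fun x => ?_
    simp
    ring

/-- Rotation about the third axis multiplies the integrand infinitesimally by `i(m - m')`, and
rotational derivatives integrate to zero. -/
lemma integral_sphericalHarmonic_of_ne (l l' : ℕ) {m m' : ℤ} (h : m ≠ m') :
    ∫ x, sphericalHarmonic l m x * (starRingEnd ℂ) (sphericalHarmonic l' m' x) ∂area = 0 := by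
  have d := (isRotDeriv_zero_sphericalHarmonic l m).mul
    ((isRotDeriv_zero_sphericalHarmonic l' m').clm_comp (Complex.conjCLE : ℂ →L[ℝ] ℂ))
  have c1 := continuous_sphericalHarmonic l m
  have c2 : Continuous fun x => (Complex.conjCLE : ℂ →L[ℝ] ℂ) (sphericalHarmonic l' m' x) :=
    (Complex.conjCLE : ℂ →L[ℝ] ℂ).continuous.comp (continuous_sphericalHarmonic l' m')
  have d' := d.congr (g' := fun x => (((m : ℂ) - m') * Complex.I) *
    (sphericalHarmonic l m x * (starRingEnd ℂ) (sphericalHarmonic l' m' x))) fun x => by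
      simp
      ring
  have hz := d'.integral_eq_zero (c1.mul c2) (continuous_const.mul (c1.mul c2))
  rw [integral_const_mul] at hz
  refine (mul_eq_zero.mp hz).resolve_left (mul_ne_zero ?_ Complex.I_ne_zero)
  exact sub_ne_zero.mpr (by exact_mod_cast h)

open Polynomial in
lemma integral_sphericalHarmonicNonneg (l l' m : ℕ) :
    ∫ x, sphericalHarmonicNonneg l m x * (starRingEnd ℂ) (sphericalHarmonicNonneg l' m x) ∂area =
      ((sphericalFactor l m * sphericalFactor l' m * zonalIntegral ((1 - X ^ 2) ^ m *
        (derivative^[m] (legendrePoly l) * derivative^[m] (legendrePoly l'))) : ℝ) : ℂ) := by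
  rw [zonalIntegral, ← integral_const_mul, ← integral_complex_ofReal]
  refine integral_congr_ae (ae_of_all _ fun x => ?_)
  have h := azimuth_mul_conj x
  simp only [sphericalHarmonicNonneg_eq, map_mul, map_pow, Complex.conj_ofReal, zonal, eval_mul,
    eval_pow, eval_sub, eval_one, eval_X]
  push_cast
  rw [← h, mul_pow]
  ring

lemma integral_sphericalHarmonicNonneg_eq_ite (l l' : ℕ) {m : ℕ} (hm : m ≤ l) :
    ∫ x, sphericalHarmonicNonneg l m x * (starRingEnd ℂ) (sphericalHarmonicNonneg l' m x) ∂area =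
      if l = l' then 1 else 0 := by
  rw [integral_sphericalHarmonicNonneg]
  split_ifs with h
  · subst h
    obtain ⟨j, rfl⟩ := Nat.exists_eq_add_of_le hm
    rw [zonalIntegral_legendre_self, ← sq, sphericalFactor_sq, ← Complex.ofReal_one]
    congr 1
    have := Real.pi_ne_zero
    have h1 : (2 * ((m : ℝ) + j) + 1) ≠ 0 := by positivity
    have h2 := Nat.factorial_ne_zero j
    have h3 := Nat.factorial_ne_zero (m + j + m)
    field_simp
  · rw [zonalIntegral_legendre_of_ne h, mul_zero, Complex.ofReal_zero]

lemma integral_sphericalHarmonic (l l' : ℕ) {m m' : ℤ} (hm : |m| ≤ l) :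
    ∫ x, sphericalHarmonic l m x * (starRingEnd ℂ) (sphericalHarmonic l' m' x) ∂area =
      if l = l' ∧ m = m' then 1 else 0 := by
  by_cases h : m = m'
  · subst h
    simp only [and_true]
    rcases int_cases_neg m with ⟨n, rfl⟩ | ⟨n, hn, rfl⟩
    · simp only [sphericalHarmonic_natCast]
      exact integral_sphericalHarmonicNonneg_eq_ite l l' (by rw [abs_of_nonneg] at hm <;> omega)
    · simp only [sphericalHarmonic_neg_natCast _ hn]
      have hn' : n ≤ l := by rw [abs_neg, abs_of_nonneg] at hm <;> omega
      have h := congrArg (starRingEnd ℂ) (integral_sphericalHarmonicNonneg_eq_ite l l' hn')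
      rw [← integral_conj, apply_ite (starRingEnd ℂ), map_one, map_zero] at h
      rw [← h]
      refine integral_congr_ae (ae_of_all _ fun x => ?_)
      have hs : ((-1 : ℂ) ^ n) * (-1) ^ n = 1 := by rw [← mul_pow]; norm_num
      simp only [map_mul, map_pow, map_neg, map_one, Complex.conj_conj]
      linear_combination ((starRingEnd ℂ) (sphericalHarmonicNonneg l n x) *
        sphericalHarmonicNonneg l' n x) * hs
  · rw [integral_sphericalHarmonic_of_ne l l' h, if_neg (fun h' => h h'.2)]

/-! ### Completeness of the spherical harmonics -/

/-- The index set of the spherical harmonics. -/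
abbrev HarmonicIndex : Type := Σ l : ℕ, Finset.Icc (-(l : ℤ)) l

/-- The spherical harmonics as continuous functions. -/
def harmonicMap (i : HarmonicIndex) : C(S2, ℂ) :=
  ⟨sphericalHarmonic i.1 i.2, continuous_sphericalHarmonic i.1 i.2⟩

/-- The function `x₁ + i x₂` as a continuous function. -/
def azimuthMap : C(S2, ℂ) := ⟨azimuth, continuous_azimuth⟩

/-- The function `p(x₃)` as a continuous function. -/
def zonalMap (p : Polynomial ℝ) : C(S2, ℂ) := ⟨zonal p, continuous_zonal p⟩

lemma zonalMap_mul (p q : Polynomial ℝ) : zonalMap (p * q) = zonalMap p * zonalMap q := by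
  ext x
  simp [zonalMap, zonal]

lemma zonalMap_one : zonalMap 1 = 1 := by
  ext x
  simp [zonalMap, zonal]

lemma star_zonalMap (p : Polynomial ℝ) : star (zonalMap p) = zonalMap p := by
  ext x
  simp [zonalMap, zonal]

open Polynomial in
lemma zonalMap_pow_one_sub_sq (n : ℕ) :
    zonalMap ((1 - X ^ 2) ^ n) = azimuthMap ^ n * star azimuthMap ^ n := by
  ext x
  have h := azimuth_mul_conj x
  simp only [zonalMap, zonal, azimuthMap, eval_pow, eval_sub, eval_one, eval_X,
    ContinuousMap.coe_mk, ContinuousMap.mul_apply, ContinuousMap.pow_apply,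
    ContinuousMap.star_apply, RCLike.star_def, ← mul_pow, h]
  push_cast
  rfl

/-- The products of powers of `x₁ + i x₂` or its conjugate with polynomials in `x₃`. -/
def azimuthZonal : Set C(S2, ℂ) :=
  {f | ∃ (n : ℕ) (p : Polynomial ℝ), f = azimuthMap ^ n * zonalMap p ∨
    f = star azimuthMap ^ n * zonalMap p}

/-- Mixed powers are removed by `|x₁ + i x₂|² = 1 - x₃²`. Hence `azimuthZonal` is closed under
products and conjugation, and its linear span is already a star subalgebra. -/
lemma azimuthMap_mul_mem (a b : ℕ) (p : Polynomial ℝ) :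
    azimuthMap ^ a * star azimuthMap ^ b * zonalMap p ∈ azimuthZonal := by
  rcases le_total b a with h | h
  · obtain ⟨k, rfl⟩ := Nat.exists_eq_add_of_le h
    refine ⟨k, (1 - Polynomial.X ^ 2) ^ b * p, Or.inl ?_⟩
    rw [zonalMap_mul, zonalMap_pow_one_sub_sq, pow_add]
    ring
  · obtain ⟨k, rfl⟩ := Nat.exists_eq_add_of_le h
    refine ⟨k, (1 - Polynomial.X ^ 2) ^ a * p, Or.inr ?_⟩
    rw [zonalMap_mul, zonalMap_pow_one_sub_sq, pow_add]
    ring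

lemma mem_azimuthZonal_iff {f : C(S2, ℂ)} : f ∈ azimuthZonal ↔
    ∃ (a b : ℕ) (p : Polynomial ℝ), f = azimuthMap ^ a * star azimuthMap ^ b * zonalMap p := by
  constructor
  · rintro ⟨n, p, rfl | rfl⟩
    · exact ⟨n, 0, p, by simp⟩
    · exact ⟨0, n, p, by simp⟩
  · rintro ⟨a, b, p, rfl⟩
    exact azimuthMap_mul_mem a b p

/-- The star subalgebra generated by `x₁ + i x₂` and polynomials in `x₃`. -/
def azimuthZonalSubalgebra : StarSubalgebra ℂ C(S2, ℂ) where
  toSubalgebra := Algebra.adjoin ℂ azimuthZonal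
  star_mem' := by
    change Algebra.adjoin ℂ azimuthZonal ≤ star (Algebra.adjoin ℂ azimuthZonal)
    refine Algebra.adjoin_le fun f hf => ?_
    obtain ⟨a, b, p, rfl⟩ := mem_azimuthZonal_iff.mp hf
    refine Algebra.subset_adjoin (mem_azimuthZonal_iff.mpr ⟨b, a, p, ?_⟩)
    simp only [star_mul', star_pow, star_star, star_zonalMap]
    ring

lemma azimuthZonalSubalgebra_coe :
    Subalgebra.toSubmodule azimuthZonalSubalgebra.toSubalgebra =
      Submodule.span ℂ azimuthZonal := by
  apply Algebra.adjoin_eq_span_of_subset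
  refine Set.Subset.trans ?_ Submodule.subset_span
  intro f hf
  refine Submonoid.closure_induction (fun _ h _ => h) (fun _ => ?_) (fun f g _ _ hf hg _ => ?_) hf
    trivial
  · exact ⟨0, 1, Or.inl (by rw [pow_zero, one_mul, zonalMap_one])⟩
  · obtain ⟨a, b, p, rfl⟩ := mem_azimuthZonal_iff.mp (hf trivial)
    obtain ⟨c, d, q, rfl⟩ := mem_azimuthZonal_iff.mp (hg trivial)
    refine mem_azimuthZonal_iff.mpr ⟨a + c, b + d, p * q, ?_⟩
    rw [zonalMap_mul, pow_add, pow_add]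
    ring

lemma azimuthZonalSubalgebra_separatesPoints : azimuthZonalSubalgebra.SeparatesPoints := by
  intro x y hxy
  by_contra hcon
  push Not at hcon
  have hw : azimuth x = azimuth y := by
    have h := hcon _ ⟨azimuthMap ^ 1 * zonalMap 1,
      Algebra.subset_adjoin ⟨1, 1, Or.inl rfl⟩, rfl⟩
    simpa [zonalMap_one, azimuthMap] using h
  have hz : (x.1 2 : ℂ) = y.1 2 := by
    have h := hcon _ ⟨azimuthMap ^ 0 * zonalMap Polynomial.X,
      Algebra.subset_adjoin ⟨0, Polynomial.X, Or.inl rfl⟩, rfl⟩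
    simpa [zonalMap, zonal] using h
  refine hxy (Subtype.ext ?_)
  have h0 := congrArg Complex.re hw
  have h1 := congrArg Complex.im hw
  simp [azimuth] at h0 h1
  ext k
  fin_cases k
  · exact h0
  · exact h1
  · exact Complex.ofReal_injective hz

lemma span_azimuthZonal_topologicalClosure :
    (Submodule.span ℂ azimuthZonal).topologicalClosure = ⊤ := by
  rw [← azimuthZonalSubalgebra_coe]
  exact congr_arg (Subalgebra.toSubmodule <| StarSubalgebra.toSubalgebra ·)
    (ContinuousMap.starSubalgebra_topologicalClosure_eq_top_of_separatesPoints
      azimuthZonalSubalgebra azimuthZonalSubalgebra_separatesPoints)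

open Polynomial in
lemma mul_zonalMap_mem_of_forall {V : Submodule ℂ C(S2, ℂ)} {u : C(S2, ℂ)} {m : ℕ}
    (h : ∀ i, u * zonalMap (derivative^[m] (legendrePoly (m + i))) ∈ V) (p : ℝ[X]) :
    u * zonalMap p ∈ V := by
  have hp : p ∈ Submodule.span ℝ (Set.range fun i => derivative^[m] (legendrePoly (m + i))) := by
    rw [span_iterate_derivative_legendrePoly]
    trivial
  induction hp using Submodule.span_induction with
  | mem p hp =>
    obtain ⟨i, rfl⟩ := hp
    exact h i
  | zero =>
    rw [show zonalMap 0 = 0 by ext x; simp [zonalMap, zonal], mul_zero]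
    exact V.zero_mem
  | add p q _ _ hp hq =>
    rw [show zonalMap (p + q) = zonalMap p + zonalMap q by ext x; simp [zonalMap, zonal], mul_add]
    exact V.add_mem hp hq
  | smul c p _ hp =>
    rw [show zonalMap (c • p) = (c : ℂ) • zonalMap p by ext x; simp [zonalMap, zonal],
      mul_smul_comm]
    exact V.smul_mem _ hp

open Polynomial in
-- At fixed order `n` the harmonics of degrees `n + i` are nonzero multiples of `(x₁ + i x₂)^n`
-- times the `n`-th derivatives of Legendre polynomials, which span all polynomials in `x₃`.
-- Conjugate powers use the order `-n`; `n = 0` is separate, having no negative counterpart.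
lemma azimuthZonal_subset_span : azimuthZonal ⊆ Submodule.span ℂ (Set.range harmonicMap) := by
  have h1 : ∀ n p, azimuthMap ^ n * zonalMap p ∈ Submodule.span ℂ (Set.range harmonicMap) := by
    intro n p
    refine mul_zonalMap_mem_of_forall (m := n) (fun i => ?_) p
    have hne : (sphericalFactor (n + i) n : ℂ) ≠ 0 :=
      Complex.ofReal_ne_zero.mpr (sphericalFactor_ne_zero _ _)
    have e : azimuthMap ^ n * zonalMap (derivative^[n] (legendrePoly (n + i))) =
        (sphericalFactor (n + i) n : ℂ)⁻¹ • harmonicMap ⟨n + i, n, by simp; omega⟩ := by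
      ext x
      simp only [harmonicMap, ContinuousMap.smul_apply, ContinuousMap.coe_mk,
        sphericalHarmonic_natCast, sphericalHarmonicNonneg_eq, smul_eq_mul,
        inv_mul_cancel_left₀ hne]
      rfl
    rw [e]
    exact Submodule.smul_mem _ _ (Submodule.subset_span ⟨_, rfl⟩)
  have h2 : ∀ n p, star azimuthMap ^ n * zonalMap p ∈
      Submodule.span ℂ (Set.range harmonicMap) := by
    intro n p
    rcases eq_or_ne n 0 with rfl | hn
    · simpa using h1 0 p
    refine mul_zonalMap_mem_of_forall (m := n) (fun i => ?_) p
    have hne : ((-1) ^ n * sphericalFactor (n + i) n : ℂ) ≠ 0 :=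
      mul_ne_zero (pow_ne_zero _ (by norm_num))
        (Complex.ofReal_ne_zero.mpr (sphericalFactor_ne_zero _ _))
    have e : star azimuthMap ^ n * zonalMap (derivative^[n] (legendrePoly (n + i))) =
        ((-1) ^ n * sphericalFactor (n + i) n : ℂ)⁻¹ •
          harmonicMap ⟨n + i, -n, by simp; omega⟩ := by
      ext x
      simp only [harmonicMap, ContinuousMap.smul_apply, ContinuousMap.coe_mk,
        sphericalHarmonic_neg_natCast _ hn, sphericalHarmonicNonneg_eq, smul_eq_mul, map_mul,
        Complex.conj_ofReal, ← mul_assoc, inv_mul_cancel₀ hne, one_mul, map_pow]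
      simp [azimuthMap, zonalMap, zonal]
    rw [e]
    exact Submodule.smul_mem _ _ (Submodule.subset_span ⟨_, rfl⟩)
  rintro f ⟨n, p, rfl | rfl⟩
  · exact h1 n p
  · exact h2 n p

lemma span_harmonicMap_topologicalClosure :
    (Submodule.span ℂ (Set.range harmonicMap)).topologicalClosure = ⊤ := by
  rw [eq_top_iff, ← span_azimuthZonal_topologicalClosure]
  exact Submodule.topologicalClosure_mono (Submodule.span_le.mpr azimuthZonal_subset_span)

/-- The spherical harmonics as elements of `L²`. -/
def harmonicLp (i : HarmonicIndex) : Lp ℂ 2 area := ContinuousMap.toLp 2 area ℂ (harmonicMap i)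

lemma span_harmonicLp_topologicalClosure :
    (Submodule.span ℂ (Set.range harmonicLp)).topologicalClosure = ⊤ := by
  convert! (ContinuousMap.toLp_denseRange ℂ area ℂ
    (ENNReal.ofNat_ne_top (n := 2))).topologicalClosure_map_submodule
      span_harmonicMap_topologicalClosure
  rw [Submodule.map_span]
  unfold harmonicLp
  rw [Set.range_comp']
  simp only [ContinuousLinearMap.coe_coe]

lemma orthonormal_harmonicLp : Orthonormal ℂ harmonicLp := by
  classical
  rw [orthonormal_iff_ite]
  rintro ⟨l, m, hm⟩ ⟨l', m', hm'⟩
  rw [harmonicLp, harmonicLp, ContinuousMap.inner_toLp]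
  change ∫ x, sphericalHarmonic l' m' x * (starRingEnd ℂ) (sphericalHarmonic l m x) ∂area = _
  rw [integral_sphericalHarmonic l' l (by rwa [Finset.mem_Icc, ← abs_le] at hm')]
  refine if_congr ?_ rfl rfl
  constructor
  · rintro ⟨rfl, rfl⟩; rfl
  · intro h
    cases h
    exact ⟨rfl, rfl⟩

/-- The spherical harmonics as a Hilbert basis of `L²`. -/
def harmonicBasis : HilbertBasis HarmonicIndex ℂ (Lp ℂ 2 area) :=
  HilbertBasis.mk orthonormal_harmonicLp span_harmonicLp_topologicalClosure.ge

lemma harmonicBasis_apply (i : HarmonicIndex) : harmonicBasis i = harmonicLp i := by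
  rw [harmonicBasis, HilbertBasis.coe_mk]

/-! ### Parseval's identity -/

/-- The class in `L²` of a real square-integrable function. -/
def toComplexLp {f : S2 → ℝ} (hf : MemLp f 2 area) : Lp ℂ 2 area := hf.ofReal.toLp _

lemma coeFn_toComplexLp {f : S2 → ℝ} (hf : MemLp f 2 area) :
    toComplexLp hf =ᵐ[area] fun x => (f x : ℂ) := MemLp.coeFn_toLp _

lemma inner_harmonicLp (i : HarmonicIndex) (F : Lp ℂ 2 area) :
    inner ℂ (harmonicLp i) F = ∫ x, F x * (starRingEnd ℂ) (sphericalHarmonic i.1 i.2 x) ∂area := by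
  rw [L2.inner_def]
  refine integral_congr_ae ?_
  have h := ContinuousMap.coeFn_toLp (p := 2) (𝕜 := ℂ) area (harmonicMap i)
  filter_upwards [h] with x hx
  rw [harmonicLp, hx]
  simp [harmonicMap]

lemma inner_harmonicLp_toComplexLp (i : HarmonicIndex) {f : S2 → ℝ} (hf : MemLp f 2 area) :
    inner ℂ (harmonicLp i) (toComplexLp hf) = sphericalCoeff f i.1 i.2 := by
  rw [inner_harmonicLp, sphericalCoeff]
  refine integral_congr_ae ?_
  filter_upwards [coeFn_toComplexLp hf] with x hx
  rw [hx]

lemma hasSum_sum_of_hasSum_harmonicIndex {u : ℕ → ℤ → ℂ} {a : ℂ}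
    (h : HasSum (fun i : HarmonicIndex => u i.1 i.2) a) :
    HasSum (fun l : ℕ => ∑ m ∈ Finset.Icc (-(l : ℤ)) l, u l m) a := by
  refine h.sigma fun l => ?_
  rw [← Finset.sum_coe_sort]
  exact hasSum_fintype _

lemma hasSum_inner_toComplexLp {f : S2 → ℝ} (hf : MemLp f 2 area) (G : Lp ℂ 2 area) :
    HasSum (fun i : HarmonicIndex => (starRingEnd ℂ) (sphericalCoeff f i.1 i.2) *
      inner ℂ (harmonicLp i) G) (inner ℂ (toComplexLp hf) G) := by
  have h := harmonicBasis.hasSum_inner_mul_inner (toComplexLp hf) G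
  refine h.congr_fun ?_
  intro i
  rw [harmonicBasis_apply, ← inner_harmonicLp_toComplexLp i hf, inner_conj_symm]

lemma inner_toComplexLp {f g : S2 → ℝ} (hf : MemLp f 2 area) (hg : MemLp g 2 area) :
    inner ℂ (toComplexLp hf) (toComplexLp hg) = ((∫ x, f x * g x ∂area : ℝ) : ℂ) := by
  rw [L2.inner_def, ← integral_complex_ofReal]
  refine integral_congr_ae ?_
  filter_upwards [coeFn_toComplexLp hf, coeFn_toComplexLp hg] with x hx hy
  rw [hx, hy]
  simp [mul_comm]

lemma hasSum_coeffPair {f g : S2 → ℝ} (hf : MemLp f 2 area) (hg : MemLp g 2 area) :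
    HasSum (coeffPair f g) ((∫ x, f x * g x ∂area : ℝ) : ℂ) := by
  rw [← inner_toComplexLp hf hg]
  refine hasSum_sum_of_hasSum_harmonicIndex
    (u := fun l m => (starRingEnd ℂ) (sphericalCoeff f l m) * sphericalCoeff g l m) ?_
  have h := hasSum_inner_toComplexLp hf (toComplexLp hg)
  simpa only [inner_harmonicLp_toComplexLp] using h

/-! ### The weak Laplacian -/

lemma summable_harmonicIndex_of_nonneg {u : ℕ → ℤ → ℝ} (hu : ∀ l m, 0 ≤ u l m)
    (h : Summable fun l : ℕ => ∑ m ∈ Finset.Icc (-(l : ℤ)) l, u l m) :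
    Summable fun i : HarmonicIndex => u i.1 i.2 := by
  refine (summable_sigma_of_nonneg fun i => hu _ _).mpr ⟨fun l => Summable.of_finite, ?_⟩
  convert h using 2 with l
  rw [tsum_fintype]
  exact Finset.sum_coe_sort (Finset.Icc (-(l : ℤ)) l) (u l)

/-- Since `(l(l+1))² ≤ (1 + l(l+1))^(s+2)`, the would-be coefficients of `Δf` are square-summable.
-/
lemma MemSobolev.summable_eigenvalue_sq {s : ℝ} (hs : 0 ≤ s) {f : S2 → ℝ}
    (hf : MemSobolev (s + 2) f) :
    Summable fun l : ℕ => ∑ m ∈ Finset.Icc (-(l : ℤ)) l,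
      ‖-((l : ℂ) * (l + 1)) * sphericalCoeff f l m‖ ^ 2 := by
  refine hf.2.of_nonneg_of_le (fun l => by positivity) fun l => ?_
  rw [sobolevTerm, Finset.mul_sum]
  refine Finset.sum_le_sum fun m _ => ?_
  rw [norm_mul, mul_pow, norm_neg]
  have e : ‖(l : ℂ) * (l + 1)‖ = (l : ℝ) * (l + 1) := by
    rw [norm_mul, ← Nat.cast_succ, Complex.norm_natCast, Complex.norm_natCast]
    push_cast; rfl
  rw [e]
  have h0 : (0 : ℝ) ≤ (l : ℝ) * (l + 1) := by positivity
  have h1 : (1 + (l : ℝ) * (l + 1)) ^ (2 : ℝ) ≤ (1 + (l : ℝ) * (l + 1)) ^ (s + 2) :=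
    Real.rpow_le_rpow_of_exponent_le (by linarith) (by linarith)
  rw [Real.rpow_two] at h1
  gcongr
  nlinarith

/-- The element of `L²` with the coefficients of `Δf`. -/
lemma MemSobolev.exists_lp {s : ℝ} (hs : 0 ≤ s) {f : S2 → ℝ} (hf : MemSobolev (s + 2) f) :
    ∃ G : Lp ℂ 2 area, ∀ i : HarmonicIndex,
      inner ℂ (harmonicLp i) G = -((i.1 : ℂ) * (i.1 + 1)) * sphericalCoeff f i.1 i.2 := by
  have h := summable_harmonicIndex_of_nonneg
    (u := fun l m => ‖-((l : ℂ) * (l + 1)) * sphericalCoeff f l m‖ ^ 2)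
    (fun l m => by positivity) (hf.summable_eigenvalue_sq hs)
  have hm : Memℓp (fun i : HarmonicIndex =>
      -((i.1 : ℂ) * (i.1 + 1)) * sphericalCoeff f i.1 i.2) 2 := by
    refine memℓp_gen ?_
    simpa using h
  refine ⟨harmonicBasis.repr.symm ⟨_, hm⟩, fun i => ?_⟩
  rw [← harmonicBasis_apply, ← HilbertBasis.repr_apply_apply, LinearIsometryEquiv.apply_symm_apply]

lemma memLp_smoothLaplacian {φ : S2 → ℝ} (hφ : ContMDiff (𝓡 2) 𝓘(ℝ, ℝ) ∞ φ) :
    MemLp (smoothLaplacian φ) 2 area :=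
  (continuous_smoothLaplacian hφ).memLp_of_hasCompactSupport (HasCompactSupport.of_compactSpace _)

lemma memLp_of_contMDiff {φ : S2 → ℝ} (hφ : ContMDiff (𝓡 2) 𝓘(ℝ, ℝ) ∞ φ) : MemLp φ 2 area :=
  hφ.continuous.memLp_of_hasCompactSupport (HasCompactSupport.of_compactSpace _)

lemma sphericalCoeff_smoothLaplacian {φ : S2 → ℝ} (hφ : ContMDiff (𝓡 2) 𝓘(ℝ, ℝ) ∞ φ)
    (l : ℕ) (m : ℤ) :
    sphericalCoeff (smoothLaplacian φ) l m = -((l : ℂ) * (l + 1)) * sphericalCoeff φ l m := by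
  have h := integral_smoothLaplacian_mul hφ
    ((isRotEigen_sphericalHarmonic l m).clm_comp Complex.conjCLE.toContinuousLinearMap)
  simpa [sphericalCoeff] using h

lemma MemSobolev.exists_isWeakLaplacian {s : ℝ} (hs : 0 ≤ s) {f : S2 → ℝ}
    (hf : MemSobolev (s + 2) f) : ∃ g, IsWeakLaplacian f g := by
  obtain ⟨G, hG⟩ := hf.exists_lp hs
  -- `G` is only known as a complex function. Its real part suffices, because `φ` is real and the
  -- pairing of `φ` with `G` equals the real number `∫ f Δφ`.
  refine ⟨fun x => (G x).re, (Lp.memLp G).re, fun φ hφ => ?_⟩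
  have hφ2 := memLp_of_contMDiff hφ
  have h1 := hasSum_inner_toComplexLp hφ2 G
  have h2 := hasSum_inner_toComplexLp (memLp_smoothLaplacian hφ) (toComplexLp hf.1)
  have h3 : (inner ℂ (toComplexLp hφ2) G : ℂ) =
      inner ℂ (toComplexLp (memLp_smoothLaplacian hφ)) (toComplexLp hf.1) := by
    -- The two Parseval series agree term by term: the eigenvalue sits on `f` in one and on `φ` in
    -- the other.
    refine h1.unique (h2.congr_fun fun i => ?_)
    rw [hG, inner_harmonicLp_toComplexLp, sphericalCoeff_smoothLaplacian hφ]
    simp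
    ring
  rw [inner_toComplexLp] at h3
  have h4 := congrArg Complex.re h3
  rw [Complex.ofReal_re, L2.inner_def] at h4
  have h5 := integral_re (L2.integrable_inner (𝕜 := ℂ) (toComplexLp hφ2) G)
  simp only [RCLike.re_eq_complex_re] at h5
  rw [← h5] at h4
  simp only [mul_comm (f _)]
  rw [← h4]
  refine integral_congr_ae ?_
  filter_upwards [coeFn_toComplexLp hφ2] with x hx
  rw [hx]
  simp

lemma MemSobolev.isWeakLaplacian_lapl {s : ℝ} (hs : 0 ≤ s) {f : S2 → ℝ}
    (hf : MemSobolev (s + 2) f) : IsWeakLaplacian f (lapl f) := by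
  have h := hf.exists_isWeakLaplacian hs
  rw [lapl, dif_pos h]
  exact h.choose_spec

lemma integrable_mul_conj_sphericalHarmonic {f : S2 → ℝ} (hf : MemLp f 2 area) (l : ℕ) (m : ℤ) :
    Integrable (fun x => (f x : ℂ) * (starRingEnd ℂ) (sphericalHarmonic l m x)) area := by
  have h1 : Integrable (fun x => (f x : ℂ)) area := (hf.ofReal (K := ℂ)).integrable one_le_two
  have hc : Continuous fun x => (starRingEnd ℂ) (sphericalHarmonic l m x) :=
    Complex.continuous_conj.comp (continuous_sphericalHarmonic l m)
  obtain ⟨C, hC⟩ := isCompact_univ.exists_bound_of_continuousOn hc.continuousOn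
  exact h1.mul_bdd (c := C) hc.aestronglyMeasurable (ae_of_all _ fun x => hC x trivial)

lemma IsWeakLaplacian.integral_mul_clm {f g : S2 → ℝ} (h : IsWeakLaplacian f g)
    (L : ℂ →L[ℝ] ℝ) (l : ℕ) (m : ℤ) :
    ∫ x, g x * L (sphericalHarmonic l m x) ∂area =
      -((l : ℝ) * (l + 1)) * ∫ x, f x * L (sphericalHarmonic l m x) ∂area := by
  rw [h.2 _ (contMDiff_clm_sphericalHarmonic L l m), ← integral_const_mul]
  refine integral_congr_ae (ae_of_all _ fun x => ?_)
  simp only [smoothLaplacian_clm_sphericalHarmonic]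
  ring

lemma sphericalCoeff_eq {f : S2 → ℝ} (hf : MemLp f 2 area) (l : ℕ) (m : ℤ) :
    sphericalCoeff f l m = ((∫ x, f x * Complex.reCLM (sphericalHarmonic l m x) ∂area : ℝ) : ℂ) -
      ((∫ x, f x * Complex.imCLM (sphericalHarmonic l m x) ∂area : ℝ) : ℂ) * Complex.I := by
  have h := integrable_mul_conj_sphericalHarmonic hf l m
  have h1 := integral_re h
  have h2 := integral_im h
  simp only [RCLike.re_eq_complex_re, RCLike.im_eq_complex_im] at h1 h2
  apply Complex.ext
  · rw [sphericalCoeff, ← h1]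
    simp
  · rw [sphericalCoeff, ← h2]
    simp [integral_neg]

/-- Test against the real and imaginary parts of the harmonics. It applies to any weak Laplacian, in
particular to the one chosen in `lapl`. -/
lemma IsWeakLaplacian.sphericalCoeff_eq {f g : S2 → ℝ} (hf : MemLp f 2 area)
    (h : IsWeakLaplacian f g) (l : ℕ) (m : ℤ) :
    sphericalCoeff g l m = -((l : ℂ) * (l + 1)) * sphericalCoeff f l m := by
  rw [SphereMHD.sphericalCoeff_eq h.1, SphereMHD.sphericalCoeff_eq hf, h.integral_mul_clm,
    h.integral_mul_clm]
  push_cast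
  ring

lemma IsWeakLaplacian.coeffPair_right {f g : S2 → ℝ} (hf : MemLp f 2 area)
    (h : IsWeakLaplacian f g) (u : S2 → ℝ) (l : ℕ) :
    coeffPair u g l = -((l : ℂ) * (l + 1)) * coeffPair u f l := by
  simp only [coeffPair, h.sphericalCoeff_eq hf, Finset.mul_sum]
  exact Finset.sum_congr rfl fun m _ => by ring

lemma IsWeakLaplacian.hasSum_coeffPair {f g u : S2 → ℝ} (hu : MemLp u 2 area)
    (hf : MemLp f 2 area) (h : IsWeakLaplacian f g) :
    HasSum (fun l : ℕ => -((l : ℂ) * (l + 1)) * coeffPair u f l)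
      ((∫ x, u x * g x ∂area : ℝ) : ℂ) := by
  simp only [← h.coeffPair_right hf]
  exact SphereMHD.hasSum_coeffPair hu h.1

/-! ### Error estimates -/

lemma sobolevTerm_nonneg (s : ℝ) (f : S2 → ℝ) (l : ℕ) : 0 ≤ sobolevTerm s f l := by
  unfold sobolevTerm
  positivity

lemma norm_coeffPair_le (f g : S2 → ℝ) (l : ℕ) :
    ‖coeffPair f g l‖ ≤ Real.sqrt (∑ m ∈ Finset.Icc (-(l : ℤ)) l, ‖sphericalCoeff f l m‖ ^ 2) *
      Real.sqrt (∑ m ∈ Finset.Icc (-(l : ℤ)) l, ‖sphericalCoeff g l m‖ ^ 2) := by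
  refine (norm_sum_le _ _).trans ?_
  simp only [norm_mul, RCLike.norm_conj]
  exact Real.sum_mul_le_sqrt_mul_sqrt _ _ _

lemma sqrt_sobolevTerm (s : ℝ) (f : S2 → ℝ) (l : ℕ) :
    Real.sqrt (sobolevTerm s f l) = (1 + (l : ℝ) * (l + 1)) ^ (s / 2) *
      Real.sqrt (∑ m ∈ Finset.Icc (-(l : ℤ)) l, ‖sphericalCoeff f l m‖ ^ 2) := by
  have h : (0 : ℝ) ≤ 1 + (l : ℝ) * (l + 1) := by positivity
  rw [sobolevTerm, Real.sqrt_mul (by positivity), Real.sqrt_eq_rpow, ← Real.rpow_mul h]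
  ring_nf

lemma sqrt_sobolevTerm_mul (s t : ℝ) (f g : S2 → ℝ) (l : ℕ) :
    Real.sqrt (sobolevTerm s f l) * Real.sqrt (sobolevTerm t g l) =
      (1 + (l : ℝ) * (l + 1)) ^ ((s + t) / 2) *
      (Real.sqrt (∑ m ∈ Finset.Icc (-(l : ℤ)) l, ‖sphericalCoeff f l m‖ ^ 2) *
      Real.sqrt (∑ m ∈ Finset.Icc (-(l : ℤ)) l, ‖sphericalCoeff g l m‖ ^ 2)) := by
  have h : (0 : ℝ) < 1 + (l : ℝ) * (l + 1) := by positivity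
  rw [sqrt_sobolevTerm, sqrt_sobolevTerm, add_div, Real.rpow_add h]
  ring

/-- A crude comparison suffices: `1/ħ = √(N² - 1)/2 ≤ N/2 ≤ 1 + l(l+1)`. -/
lemma rpow_neg_le_hbar_rpow {s : ℝ} (hs : 0 ≤ s) {N l : ℕ} (hN : 2 ≤ N) (hl : N ≤ l) :
    (1 + (l : ℝ) * (l + 1)) ^ (-s) ≤ hbar N ^ s := by
  have hN' : (2 : ℝ) ≤ N := by exact_mod_cast hN
  have hl' : (N : ℝ) ≤ l := by exact_mod_cast hl
  have h : (0 : ℝ) < 1 + (l : ℝ) * (l + 1) := by positivity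
  rw [Real.rpow_neg h.le, ← Real.inv_rpow h.le]
  refine Real.rpow_le_rpow (by positivity) ?_ hs
  have h1 : 0 < Real.sqrt ((N : ℝ) ^ 2 - 1) := Real.sqrt_pos.mpr (by nlinarith)
  have h2 : Real.sqrt ((N : ℝ) ^ 2 - 1) ≤ N := Real.sqrt_le_iff.mpr ⟨by linarith, by linarith⟩
  rw [hbar, inv_eq_one_div, div_le_div_iff₀ h h1]
  nlinarith

lemma norm_coeffPair_le_of_le {s : ℝ} (hs : 0 ≤ s) {N l : ℕ} (hN : 2 ≤ N) (hl : N ≤ l)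
    (f g : S2 → ℝ) :
    ‖coeffPair f g l‖ ≤
      hbar N ^ s * (Real.sqrt (sobolevTerm s f l) * Real.sqrt (sobolevTerm s g l)) := by
  have h : (0 : ℝ) < 1 + (l : ℝ) * (l + 1) := by positivity
  have h1 := rpow_neg_le_hbar_rpow hs hN hl
  refine (norm_coeffPair_le f g l).trans ?_
  rw [sqrt_sobolevTerm_mul, ← mul_assoc, add_self_div_two]
  refine le_mul_of_one_le_left (by positivity) ?_
  calc (1 : ℝ) = (1 + (l : ℝ) * (l + 1)) ^ (-s) * (1 + (l : ℝ) * (l + 1)) ^ s := by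
        rw [← Real.rpow_add h, neg_add_cancel, Real.rpow_zero]
    _ ≤ _ := by gcongr

/-- The two weights combine to the exponent `(s + (s+2))/2 = s + 1`: one power pays for the
eigenvalue, the other `s` for the decay. -/
lemma norm_eigenvalue_mul_coeffPair_le {s : ℝ} (hs : 0 ≤ s) {N l : ℕ} (hN : 2 ≤ N) (hl : N ≤ l)
    (f g : S2 → ℝ) :
    ‖-((l : ℂ) * (l + 1)) * coeffPair f g l‖ ≤
      hbar N ^ s * (Real.sqrt (sobolevTerm s f l) * Real.sqrt (sobolevTerm (s + 2) g l)) := by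
  have h : (0 : ℝ) < 1 + (l : ℝ) * (l + 1) := by positivity
  have h1 := rpow_neg_le_hbar_rpow hs hN hl
  have e : ‖-((l : ℂ) * (l + 1))‖ = (l : ℝ) * (l + 1) := by
    rw [norm_neg, norm_mul, ← Nat.cast_succ, Complex.norm_natCast, Complex.norm_natCast]
    push_cast; rfl
  rw [norm_mul, e, sqrt_sobolevTerm_mul, ← mul_assoc]
  refine mul_le_mul ?_ (norm_coeffPair_le f g l) (norm_nonneg _) (by
    have := (hbar_pos hN).le; positivity)
  calc (l : ℝ) * (l + 1) ≤ 1 + (l : ℝ) * (l + 1) := by linarith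
    _ = (1 + (l : ℝ) * (l + 1)) ^ (-s) * (1 + (l : ℝ) * (l + 1)) ^ ((s + (s + 2)) / 2) := by
        rw [← Real.rpow_add h, show -s + (s + (s + 2)) / 2 = 1 by ring, Real.rpow_one]
    _ ≤ _ := by gcongr

lemma norm_sum_range_sub_le {u : ℕ → ℂ} {a : ℂ} {A B : ℕ → ℝ} {C : ℝ} {N : ℕ} (hC : 0 ≤ C)
    (hA : ∀ l, 0 ≤ A l) (hB : ∀ l, 0 ≤ B l) (hsA : Summable A) (hsB : Summable B)
    (hu : HasSum u a) (h : ∀ l, N ≤ l → ‖u l‖ ≤ C * (Real.sqrt (A l) * Real.sqrt (B l))) :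
    ‖∑ l ∈ Finset.range N, u l - a‖ ≤ C * (Real.sqrt (∑' l, A l) * Real.sqrt (∑' l, B l)) := by
  rw [norm_sub_rev]
  -- The tail is a limit of finite blocks `N ≤ l < M`, to which Cauchy–Schwarz in `l` applies.
  refine le_of_tendsto (hu.tendsto_sum_nat.sub_const _).norm ?_
  filter_upwards [eventually_ge_atTop N] with M hM
  rw [← Finset.sum_Ico_eq_sub _ hM]
  calc ‖∑ l ∈ Finset.Ico N M, u l‖
      ≤ ∑ l ∈ Finset.Ico N M, C * (Real.sqrt (A l) * Real.sqrt (B l)) :=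
        norm_sum_le_of_le _ fun l hl => h l (Finset.mem_Ico.mp hl).1
    _ = C * ∑ l ∈ Finset.Ico N M, Real.sqrt (A l) * Real.sqrt (B l) := by rw [Finset.mul_sum]
    _ ≤ C * (Real.sqrt (∑ l ∈ Finset.Ico N M, A l) * Real.sqrt (∑ l ∈ Finset.Ico N M, B l)) := by
        gcongr
        exact Real.sum_sqrt_mul_sqrt_le _ hA hB
    _ ≤ _ := by
        gcongr
        · exact hsA.sum_le_tsum _ fun l _ => hA l
        · exact hsB.sum_le_tsum _ fun l _ => hB l

lemma MemSobolev.of_le {s t : ℝ} (hst : s ≤ t) {f : S2 → ℝ} (hf : MemSobolev t f) :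
    MemSobolev s f := by
  refine ⟨hf.1, hf.2.of_nonneg_of_le (sobolevTerm_nonneg s f) fun l => ?_⟩
  have h : (0 : ℝ) ≤ (l : ℝ) * (l + 1) := by positivity
  unfold sobolevTerm
  gcongr
  linarith

lemma norm_sum_coeffPair_sub_le {s : ℝ} (hs : 0 ≤ s) {N : ℕ} (hN : 2 ≤ N) {f g : S2 → ℝ}
    (hf : MemSobolev s f) (hg : MemSobolev s g) :
    ‖∑ l ∈ Finset.range N, coeffPair f g l - ((∫ x, f x * g x ∂area : ℝ) : ℂ)‖ ≤
      hbar N ^ s * (sobolevNorm s f * sobolevNorm s g) :=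
  norm_sum_range_sub_le (Real.rpow_nonneg (hbar_pos hN).le s) (sobolevTerm_nonneg s f)
    (sobolevTerm_nonneg s g) hf.2 hg.2 (hasSum_coeffPair hf.1 hg.1)
    fun _ hl => norm_coeffPair_le_of_le hs hN hl f g

lemma norm_sum_eigenvalue_mul_coeffPair_sub_le {s : ℝ} (hs : 0 ≤ s) {N : ℕ} (hN : 2 ≤ N)
    {f g : S2 → ℝ} (hf : MemSobolev s f) (hg : MemSobolev (s + 2) g) :
    ‖∑ l ∈ Finset.range N, -((l : ℂ) * (l + 1)) * coeffPair f g l -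
        ((∫ x, f x * lapl g x ∂area : ℝ) : ℂ)‖ ≤
      hbar N ^ s * (sobolevNorm s f * sobolevNorm (s + 2) g) :=
  norm_sum_range_sub_le (Real.rpow_nonneg (hbar_pos hN).le s) (sobolevTerm_nonneg s f)
    (sobolevTerm_nonneg (s + 2) g) hf.2 hg.2
    ((hg.isWeakLaplacian_lapl hs).hasSum_coeffPair hf.1 hg.1)
    fun _ hl => norm_eigenvalue_mul_coeffPair_le hs hN hl f g

lemma integral_mul_lapl_sub {s : ℝ} (hs : 0 ≤ s) {f g u v : S2 → ℝ} (hf : MemLp f 2 area)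
    (hg : MemSobolev (s + 2) g) (hu : MemLp u 2 area) (hv : MemLp v 2 area) :
    ∫ x, (f x * lapl g x - u x * v x) ∂area =
      ∫ x, f x * lapl g x ∂area - ∫ x, u x * v x ∂area :=
  integral_sub (hf.integrable_mul (hg.isWeakLaplacian_lapl hs).1) (hu.integrable_mul hv)

/-- The error of the quantized pairing `Ξ, Ψ, P, Q ↦ (4π/N) tr(Ξ† Δ_N Ψ - P† Q)`. -/
lemma norm_pairing_error_le {s : ℝ} (hs : 0 ≤ s) {N : ℕ} (hN : 2 ≤ N) {ρ q ξ ψ : S2 → ℝ}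
    (hρ : MemSobolev s ρ) (hq : MemSobolev s q)
    (hξ : MemSobolev s ξ) (hψ : MemSobolev (s + 2) ψ) :
    ‖(∑ l ∈ Finset.range N, -((l : ℂ) * (l + 1)) * coeffPair ξ ψ l -
        ∑ l ∈ Finset.range N, coeffPair ρ q l) -
      ((∫ x, (ξ x * lapl ψ x - ρ x * q x) ∂area : ℝ) : ℂ)‖ ≤
      hbar N ^ s * (sobolevNorm s ξ * sobolevNorm (s + 2) ψ +
        sobolevNorm s ρ * sobolevNorm s q) := by
  rw [integral_mul_lapl_sub hs hξ.1 hψ hρ.1 hq.1, Complex.ofReal_sub, sub_sub_sub_comm, mul_add]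
  exact (norm_sub_le _ _).trans (add_le_add (norm_sum_eigenvalue_mul_coeffPair_sub_le hs hN hξ hψ)
    (norm_sum_coeffPair_sub_le hs hN hρ hq))

lemma sobolevNorm_nonneg (s : ℝ) (f : S2 → ℝ) : 0 ≤ sobolevNorm s f := Real.sqrt_nonneg _

lemma norm_quantizedCrossHelicity_sub_le {s : ℝ} (hs : 0 ≤ s) {N : ℕ} (hN : 2 ≤ N)
    {ρ q ξ ψ : S2 → ℝ} (hρ : MemSobolev s ρ) (hq : MemSobolev s q)
    (hξ : MemSobolev (s + 2) ξ) (hψ : MemSobolev (s + 2) ψ) :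
    ‖quantizedCrossHelicity N ρ q ξ ψ - (crossHelicity ρ q ξ ψ : ℂ)‖ ≤
      2 * hbar N ^ s * (sobolevNorm s ξ * sobolevNorm (s + 2) ψ +
        sobolevNorm s ρ * sobolevNorm s q) := by
  rw [quantizedCrossHelicity_eq hN, crossHelicity]
  -- The estimate holds with constant `1`; the factor `2` is slack.
  refine (norm_pairing_error_le hs hN hρ hq (hξ.of_le (by linarith)) hψ).trans ?_
  have h1 := Real.rpow_nonneg (hbar_pos hN).le s
  have h2 := sobolevNorm_nonneg s ξ
  have h3 := sobolevNorm_nonneg (s + 2) ψ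
  have h4 := sobolevNorm_nonneg s ρ
  have h5 := sobolevNorm_nonneg s q
  gcongr
  linarith

lemma norm_quantizedHamiltonian_sub_le {s : ℝ} (hs : 0 ≤ s) {N : ℕ} (hN : 2 ≤ N)
    {ρ q ξ ψ : S2 → ℝ} (hρ : MemSobolev s ρ) (hq : MemSobolev s q)
    (hξ : MemSobolev (s + 2) ξ) (hψ : MemSobolev (s + 2) ψ) :
    ‖quantizedHamiltonian N ρ q ξ ψ - (hamiltonian ρ q ξ ψ : ℂ)‖ ≤
      2 * hbar N ^ s * (sobolevNorm s ψ * sobolevNorm (s + 2) ψ + sobolevNorm s q ^ 2 +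
        sobolevNorm s ρ ^ 2 + sobolevNorm s ξ * sobolevNorm (s + 2) ξ) := by
  have hψ' := norm_pairing_error_le hs hN hq hq (hψ.of_le (by linarith)) hψ
  have hξ' := norm_pairing_error_le hs hN hρ hρ (hξ.of_le (by linarith)) hξ
  rw [quantizedHamiltonian_eq hN, hamiltonian]
  simp only [pow_two (q _), pow_two (ρ _)]
  set A := ∑ l ∈ Finset.range N, -((l : ℂ) * (l + 1)) * coeffPair ψ ψ l -
    ∑ l ∈ Finset.range N, coeffPair q q l
  set B := ∑ l ∈ Finset.range N, -((l : ℂ) * (l + 1)) * coeffPair ξ ξ l -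
    ∑ l ∈ Finset.range N, coeffPair ρ ρ l
  set a := ∫ x, (ψ x * lapl ψ x - q x * q x) ∂area
  set b := ∫ x, (ξ x * lapl ξ x - ρ x * ρ x) ∂area
  -- The error splits into two pairing errors, each with weight `½`.
  have e : -(1 / 2) * A - 1 / 2 * B - ((-(1 / 2) * a - 1 / 2 * b : ℝ) : ℂ) =
      -(1 / 2) * (A - a) + -(1 / 2) * (B - b) := by
    push_cast
    ring
  have e2 : ‖(-(1 / 2) : ℂ)‖ = 1 / 2 := by norm_num
  rw [e]
  refine (norm_add_le _ _).trans ?_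
  rw [norm_mul, norm_mul, e2]
  have h1 := Real.rpow_nonneg (hbar_pos hN).le s
  have h2 := mul_nonneg h1 (mul_nonneg (sobolevNorm_nonneg s ξ) (sobolevNorm_nonneg (s + 2) ξ))
  have h3 := mul_nonneg h1 (mul_nonneg (sobolevNorm_nonneg s ψ) (sobolevNorm_nonneg (s + 2) ψ))
  have h4 := mul_nonneg h1 (sq_nonneg (sobolevNorm s ρ))
  have h5 := mul_nonneg h1 (sq_nonneg (sobolevNorm s q))
  rw [mul_add] at hψ' hξ'
  linarith

lemma hbar_le {N : ℕ} (hN : 2 ≤ N) : hbar N ≤ 4 * (N : ℝ)⁻¹ := by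
  have hN' : (2 : ℝ) ≤ N := by exact_mod_cast hN
  -- For `N ≥ 2` one has `N²/4 ≤ N² - 1`, which is where the constant `4` comes from.
  have h2 : (N : ℝ) / 2 ≤ Real.sqrt ((N : ℝ) ^ 2 - 1) := Real.le_sqrt_of_sq_le (by nlinarith)
  rw [hbar, ← div_eq_mul_inv, div_le_div_iff₀ (by linarith) (by linarith)]
  linarith

lemma isBigO_rpow_neg_of_norm_le {s : ℝ} (hs : 0 ≤ s) {u : ℕ → ℂ} {C : ℝ} (hC : 0 ≤ C)
    (h : ∀ N : ℕ, 2 ≤ N → ‖u N‖ ≤ 2 * hbar N ^ s * C) :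
    u =O[atTop] fun N : ℕ => (N : ℝ) ^ (-s) := by
  refine IsBigO.of_bound (2 * 4 ^ s * C) ?_
  filter_upwards [eventually_ge_atTop 2] with N hN
  have h1 : hbar N ^ s ≤ 4 ^ s * (N : ℝ) ^ (-s) := by
    rw [Real.rpow_neg N.cast_nonneg, ← Real.inv_rpow N.cast_nonneg,
      ← Real.mul_rpow (by norm_num) (by positivity)]
    exact Real.rpow_le_rpow (hbar_pos hN).le (hbar_le hN) hs
  rw [Real.norm_of_nonneg (by positivity)]
  calc ‖u N‖ ≤ 2 * hbar N ^ s * C := h N hN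
    _ ≤ 2 * (4 ^ s * (N : ℝ) ^ (-s)) * C := by gcongr
    _ = _ := by ring

lemma tendsto_of_isBigO_rpow_neg {s : ℝ} (hs : 0 < s) {u : ℕ → ℂ} {a : ℂ}
    (h : (fun N => u N - a) =O[atTop] fun N : ℕ => (N : ℝ) ^ (-s)) :
    Tendsto u atTop (𝓝 a) :=
  tendsto_sub_nhds_zero_iff.mp
    (h.trans_tendsto ((tendsto_rpow_neg_atTop hs).comp tendsto_natCast_atTop_atTop))

end SphereMHD

end

theorem mainTheorem6 (s : ℝ) (hs : 1 < s) (ρ q ξ ψ : S2 → ℝ)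
    (hρ : MemSobolev s ρ) (hq : MemSobolev s q)
    (hξ : MemSobolev (s + 2) ξ) (hψ : MemSobolev (s + 2) ψ) :
    (IsWeakLaplacian ξ (lapl ξ) ∧ IsWeakLaplacian ψ (lapl ψ)) ∧
    Tendsto (fun N : ℕ => quantizedCrossHelicity N ρ q ξ ψ) atTop
      (𝓝 (crossHelicity ρ q ξ ψ : ℂ)) ∧
    Tendsto (fun N : ℕ => quantizedHamiltonian N ρ q ξ ψ) atTop
      (𝓝 (hamiltonian ρ q ξ ψ : ℂ)) ∧
    (∀ N : ℕ, 2 ≤ N →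
      ‖quantizedCrossHelicity N ρ q ξ ψ - (crossHelicity ρ q ξ ψ : ℂ)‖ ≤
        2 * hbar N ^ s * (sobolevNorm s ξ * sobolevNorm (s + 2) ψ +
          sobolevNorm s ρ * sobolevNorm s q)) ∧
    (∀ N : ℕ, 2 ≤ N →
      ‖quantizedHamiltonian N ρ q ξ ψ - (hamiltonian ρ q ξ ψ : ℂ)‖ ≤
        2 * hbar N ^ s * (sobolevNorm s ψ * sobolevNorm (s + 2) ψ + sobolevNorm s q ^ 2 +
          sobolevNorm s ρ ^ 2 + sobolevNorm s ξ * sobolevNorm (s + 2) ξ)) ∧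
    (fun N : ℕ => quantizedCrossHelicity N ρ q ξ ψ - (crossHelicity ρ q ξ ψ : ℂ))
      =O[atTop] (fun N : ℕ => (N : ℝ) ^ (-s)) ∧
    (fun N : ℕ => quantizedHamiltonian N ρ q ξ ψ - (hamiltonian ρ q ξ ψ : ℂ))
      =O[atTop] (fun N : ℕ => (N : ℝ) ^ (-s)) := by
  have hs0 : 0 ≤ s := by linarith
  have hI : ∀ N : ℕ, 2 ≤ N → _ := fun N hN =>
    norm_quantizedCrossHelicity_sub_le hs0 hN hρ hq hξ hψ
  have hH : ∀ N : ℕ, 2 ≤ N → _ := fun N hN =>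
    norm_quantizedHamiltonian_sub_le hs0 hN hρ hq hξ hψ
  have n := sobolevNorm_nonneg
  have hI' := isBigO_rpow_neg_of_norm_le hs0
    (add_nonneg (mul_nonneg (n _ _) (n _ _)) (mul_nonneg (n _ _) (n _ _))) hI
  have hH' := isBigO_rpow_neg_of_norm_le hs0
    (add_nonneg (add_nonneg (add_nonneg (mul_nonneg (n _ _) (n _ _)) (sq_nonneg _)) (sq_nonneg _))
      (mul_nonneg (n _ _) (n _ _))) hH
  exact ⟨⟨hξ.isWeakLaplacian_lapl hs0, hψ.isWeakLaplacian_lapl hs0⟩,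
    tendsto_of_isBigO_rpow_neg (by linarith) hI', tendsto_of_isBigO_rpow_neg (by linarith) hH',
    hI, hH, hI', hH'⟩
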